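/- **Setting.** Let $\mathcal D$ be a monoidal dagger category (not necessarily symmetric): a monoidal category with an identity-on-objects involutive contravariant functor $\dagger$ such that $(f\otimes g)^\dagger=f^\dagger\otimes g^\dagger$ and the associators and unitors are unitary. A *dagger dual* of $A$ is an object $A^*$ with $\eta\colon I\to A^*\otimes A$, $\varepsilon\colon A\otimes A^*\to I$ satisfying the snake equations; put $\eta'=\varepsilon^\dagger$, $\varepsilon'=\eta^\dagger$. For $f\colon A\to B$ let $f_*=(f^*)^\dagger\colon A^*\to B^*$, where $f^*=(\mathrm{id}_{A^*}\otimes\varepsilon_B)(\mathrm{id}_{A^*}\otimes f\otimes \mathrm{id}_{B^*})(\eta_A\otimes\mathrm{id}_{B^*})$. Coherence isomorphisms are suppressed. A *dagger Frobenius 3-structure* is an object $A$ with a dagger dual $A^*$ and $\mu\colon A\otimes A^*\otimes A\to A$ with $\mu(\mathrm{id}_{A\otimes A^*}\otimes\mu)=\mu(\mu\otimes\mathrm{id}_{A^*\otimes A})$ and $$\mu^\dagger=(\mu\otimes\mathrm{id}_{A^*\otimes A})(\mathrm{id}_{A\otimes A^*}\otimes\eta'\otimes\mathrm{id}_A)(\mathrm{id}_A\otimes\eta)=(\mathrm{id}_{A\otimes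 A^*}\otimes\mu)(\mathrm{id}_A\otimes\eta\otimes\mathrm{id}_{A^*\otimes A})(\eta'\otimes\mathrm{id}_A).$$ It is *normal* if $\mu(\eta'\otimes\mathrm{id}_A)=\mathrm{id}_A=\mu(\mathrm{id}_A\otimes\eta)$. A morphism $g\colon(A,\mu)\to(B,\nu)$ is a morphism $g\colon A\to B$ with $g\mu=\nu(g\otimes g_*\otimes g)$. Normal dagger Frobenius 3-structures and these morphisms form the category $\mathrm{Tern}_{\mathrm{norm}}(\mathcal D)$. A *symmetric dagger Frobenius 2-structure* is an object $B$ with a dagger dual and a monoid structure $(m,u)$ on $B$ with $(m\otimes\mathrm{id})(\mathrm{id}\otimes m^\dagger)=(\mathrm{id}\otimes m)(m^\dagger\otimes\mathrm{id})$ and for which the two maps $(u^\dagger m\otimes\mathrm{id}_{B^*})(\mathrm{id}_B\otimes\eta')$ and $(\mathrm{id}_{B^*}\otimes u^\dagger m)(\eta\otimes\mathrm{id}_B)$ from $B$ to $B^*$ are equal; this common map is the *involution* $s_B$ (it is unitary). It is *special* if $m m^\dagger=\mathrm{id}_B$. A morphism of 2-structures is a morphism $f\colon B\to B'$ with $f m=m'(f\otimes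 f)$ and $s_{B'}f=f_*s_B$. The ternary multiplication induced by a 2-structure is $\hat m=m(m\otimes\mathrm{id})(\mathrm{id}\otimes s_B^\dagger\otimes\mathrm{id})\colon B\otimes B^*\otimes B\to B$. Suppose $\mathcal D$ has zero morphisms and binary *dagger biproducts* (biproducts with $\pi_A=\kappa_A^\dagger$, $\pi_B=\kappa_B^\dagger$), which are *distributive*: the canonical map $u\colon(A\otimes B)\oplus(A\otimes C)\to A\otimes(B\oplus C)$ is an isomorphism with $u^{-1}=u^\dagger$. Suppose also that every dagger idempotent $p$ (i.e. $p=p^\dagger p$) has a dagger splitting: $p=ii^\dagger$ with $i^\dagger i=\mathrm{id}$. Let $\mathrm{BinSub}(\mathcal D)$ be the category whose objects are triples consisting of a normal dagger Frobenius 3-structure $(A,\mu)$, a symmetric dagger Frobenius 2-structure $(B,m,u)$, and an isometry $i\colon A\to B$ (that is, $i^\dagger i=\mathrm{id}_A$) with $i\mu=\hat m(i\otimes i_*\otimes i)$ and $m(i\otimes i)=0$. A morphism from $((A,\mu),i,(B,m,u))$ to $((A',\mu'),i',(B',m',u'))$ is a morphism $f\colon B\to B'$ of 2-structures with $fi=i'i'^\dagger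 fi$. Let $S\colon\mathrm{BinSub}(\mathcal D)\to\mathrm{Tern}_{\mathrm{norm}}(\mathcal D)$ be the functor sending an object to $(A,\mu)$ and a morphism $f$ to $i'^\dagger f i$. **Theorem (Enveloping Structure).** Under these assumptions $S$ has a left adjoint $E$ such that $S\circ E$ is the identity functor and the unit of the adjunction is the identity. Moreover $E$ can be chosen so that, in addition, if the addition of morphisms induced by the biproducts is idempotent ($f+f=f$ for all $f$), then the 2-structure of $E(\mu)$ is special for every $\mu$. -/

import Mathlib

open CategoryTheory MonoidalCategory Limits

universe v u

namespace Enveloping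

/-! ### Monoidal dagger categories -/

/-- A monoidal dagger category: an involutive, identity-on-objects contravariant functor
`dag` which is strictly monoidal and for which the coherence isomorphisms are unitary. -/
class MonoidalDaggerCategory (D : Type u) [Category.{v} D] [MonoidalCategory D] where
  dag : ∀ {X Y : D}, (X ⟶ Y) → (Y ⟶ X)
  dag_id : ∀ X : D, dag (𝟙 X) = 𝟙 X
  dag_comp : ∀ {X Y Z : D} (f : X ⟶ Y) (g : Y ⟶ Z), dag (f ≫ g) = dag g ≫ dag f
  dag_dag : ∀ {X Y : D} (f : X ⟶ Y), dag (dag f) = f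
  dag_tensor : ∀ {X Y X' Y' : D} (f : X ⟶ Y) (g : X' ⟶ Y'),
    dag (f ⊗ₘ g) = dag f ⊗ₘ dag g
  dag_associator : ∀ X Y Z : D, dag (α_ X Y Z).hom = (α_ X Y Z).inv
  dag_leftUnitor : ∀ X : D, dag (λ_ X).hom = (λ_ X).inv
  dag_rightUnitor : ∀ X : D, dag (ρ_ X).hom = (ρ_ X).inv


section

variable {D : Type u} [Category.{v} D] [MonoidalCategory D] [MonoidalDaggerCategory D]

/-- The dagger `f†` of a morphism. -/
def dag {X Y : D} (f : X ⟶ Y) : Y ⟶ X := MonoidalDaggerCategory.dag f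

@[simp]
theorem dag_id (X : D) : dag (𝟙 X) = 𝟙 X := MonoidalDaggerCategory.dag_id X

@[simp]
theorem dag_comp {X Y Z : D} (f : X ⟶ Y) (g : Y ⟶ Z) : dag (f ≫ g) = dag g ≫ dag f :=
  MonoidalDaggerCategory.dag_comp f g

@[simp]
theorem dag_dag {X Y : D} (f : X ⟶ Y) : dag (dag f) = f := MonoidalDaggerCategory.dag_dag f

@[simp]
theorem dag_associator (X Y Z : D) : dag (α_ X Y Z).hom = (α_ X Y Z).inv :=
  MonoidalDaggerCategory.dag_associator X Y Z

@[simp]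
theorem dag_leftUnitor (X : D) : dag (λ_ X).hom = (λ_ X).inv :=
  MonoidalDaggerCategory.dag_leftUnitor X

@[simp]
theorem dag_rightUnitor (X : D) : dag (ρ_ X).hom = (ρ_ X).inv :=
  MonoidalDaggerCategory.dag_rightUnitor X

@[simp]
theorem dag_whiskerLeft (X : D) {Y Z : D} (f : Y ⟶ Z) : dag (X ◁ f) = X ◁ dag f := by
  simp only [dag, ← id_tensorHom, MonoidalDaggerCategory.dag_tensor,
    MonoidalDaggerCategory.dag_id]

@[simp]
theorem dag_whiskerRight {Y Z : D} (f : Y ⟶ Z) (X : D) : dag (f ▷ X) = dag f ▷ X := by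
  simp only [dag, ← tensorHom_id, MonoidalDaggerCategory.dag_tensor,
    MonoidalDaggerCategory.dag_id]

@[simp]
theorem dag_associator_inv (X Y Z : D) : dag (α_ X Y Z).inv = (α_ X Y Z).hom := by
  rw [← MonoidalDaggerCategory.dag_associator]; exact MonoidalDaggerCategory.dag_dag _

@[simp]
theorem dag_leftUnitor_inv (X : D) : dag (λ_ X).inv = (λ_ X).hom := by
  rw [← MonoidalDaggerCategory.dag_leftUnitor]; exact MonoidalDaggerCategory.dag_dag _

@[simp]
theorem dag_rightUnitor_inv (X : D) : dag (ρ_ X).inv = (ρ_ X).hom := by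
  rw [← MonoidalDaggerCategory.dag_rightUnitor]; exact MonoidalDaggerCategory.dag_dag _

/-- An isometry: `i† ∘ i = id`. -/
def IsIsometry {X Y : D} (i : X ⟶ Y) : Prop := i ≫ dag i = 𝟙 X

/-- A dagger idempotent: `p = p† ∘ p`. -/
def IsDaggerIdempotent {X : D} (p : X ⟶ X) : Prop := p = p ≫ dag p

/-! ### Dagger duals -/

/-- A dagger dual of `A`: an object `A*` with `η : I ⟶ A* ⊗ A` and `ε : A ⊗ A* ⟶ I`
satisfying the two snake equations.  The remaining data of a two-sided dagger dual is
`η' = ε†` and `ε' = η†`, see `DaggerDual.reversePairing`. -/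
structure DaggerDual (A : D) where
  star : D
  pairing : ExactPairing star A

namespace DaggerDual

variable {A B C : D}

/-- `η : I ⟶ A* ⊗ A` -/
def cup (a : DaggerDual A) : 𝟙_ D ⟶ a.star ⊗ A := a.pairing.coevaluation'

/-- `ε : A ⊗ A* ⟶ I` -/
def cap (a : DaggerDual A) : A ⊗ a.star ⟶ 𝟙_ D := a.pairing.evaluation'

/-- `η' = ε† : I ⟶ A ⊗ A*` -/
def cup' (a : DaggerDual A) : 𝟙_ D ⟶ A ⊗ a.star := dag a.cap

/-- `ε' = η† : A* ⊗ A ⟶ I` -/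
def cap' (a : DaggerDual A) : a.star ⊗ A ⟶ 𝟙_ D := dag a.cup

/-- The maps `η'` and `ε'` make `A` a dual of `A*`. -/
@[reducible]
def reversePairing (a : DaggerDual A) : ExactPairing A a.star where
  coevaluation' := a.cup'
  evaluation' := a.cap'
  coevaluation_evaluation' := by
    simpa [cup', cap', cup, cap] using congrArg dag a.pairing.evaluation_coevaluation'
  evaluation_coevaluation' := by
    simpa [cup', cap', cup, cap] using congrArg dag a.pairing.coevaluation_evaluation'

/-- The transpose `f* : B* ⟶ A*` of `f : A ⟶ B`,
`f* = (id ⊗ ε_B) ∘ (id ⊗ f ⊗ id) ∘ (η_A ⊗ id)`. -/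
def transpose (a : DaggerDual A) (b : DaggerDual B) (f : A ⟶ B) : b.star ⟶ a.star :=
  (λ_ b.star).inv ≫ a.cup ▷ b.star ≫ (a.star ◁ f) ▷ b.star ≫ (α_ _ _ _).hom ≫
    a.star ◁ b.cap ≫ (ρ_ a.star).hom

/-- The conjugate `f_* = (f*)† : A* ⟶ B*` of `f : A ⟶ B`. -/
def conj (a : DaggerDual A) (b : DaggerDual B) (f : A ⟶ B) : a.star ⟶ b.star :=
  dag (a.transpose b f)

set_option linter.unusedSectionVars false in
theorem transpose_id (a : DaggerDual A) : a.transpose a (𝟙 A) = 𝟙 a.star :=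
  letI : HasLeftDual A := @HasLeftDual.mk D _ _ A a.star a.pairing
  leftAdjointMate_id (X := A)

set_option linter.unusedSectionVars false in
theorem transpose_comp (a : DaggerDual A) (b : DaggerDual B) (c : DaggerDual C)
    (f : A ⟶ B) (g : B ⟶ C) :
    a.transpose c (f ≫ g) = b.transpose c g ≫ a.transpose b f :=
  letI : HasLeftDual A := @HasLeftDual.mk D _ _ A a.star a.pairing
  letI : HasLeftDual B := @HasLeftDual.mk D _ _ B b.star b.pairing
  letI : HasLeftDual C := @HasLeftDual.mk D _ _ C c.star c.pairing
  comp_leftAdjointMate (f := f) (g := g)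

theorem conj_id (a : DaggerDual A) : a.conj a (𝟙 A) = 𝟙 a.star := by
  rw [conj, transpose_id]; exact MonoidalDaggerCategory.dag_id _

theorem conj_comp (a : DaggerDual A) (b : DaggerDual B) (c : DaggerDual C)
    (f : A ⟶ B) (g : B ⟶ C) : a.conj c (f ≫ g) = a.conj b f ≫ b.conj c g := by
  rw [conj, transpose_comp a b c]; exact MonoidalDaggerCategory.dag_comp _ _

end DaggerDual

/-! ### Frobenius 3-structures -/

section Ternary

variable {A B C : D} (a : DaggerDual A) (b : DaggerDual B) (c : DaggerDual C)

/-- The comultiplication obtained by bending the middle and right inputs of a ternary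
multiplication to the right: the middle leg through `η`, the right leg through `η'`. -/
def comulRight (m : A ⊗ (a.star ⊗ A) ⟶ A) : A ⟶ A ⊗ (a.star ⊗ A) :=
  (ρ_ A).inv ≫ A ◁ a.cup ≫ A ◁ a.star ◁ (λ_ A).inv ≫ A ◁ a.star ◁ (a.cup' ▷ A) ≫
    A ◁ a.star ◁ (α_ A a.star A).hom ≫ A ◁ (α_ a.star A (a.star ⊗ A)).inv ≫
    (α_ A (a.star ⊗ A) (a.star ⊗ A)).inv ≫ m ▷ (a.star ⊗ A)

/-- The comultiplication obtained by bending the left and middle inputs of a ternary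
multiplication to the left: the middle leg through `η'`, the left leg through `η`. -/
def comulLeft (m : A ⊗ (a.star ⊗ A) ⟶ A) : A ⟶ A ⊗ (a.star ⊗ A) :=
  (λ_ A).inv ≫ a.cup' ▷ A ≫ (α_ A a.star A).hom ≫ A ◁ (λ_ (a.star ⊗ A)).inv ≫
    A ◁ (a.cup ▷ (a.star ⊗ A)) ≫ A ◁ (α_ a.star A (a.star ⊗ A)).hom ≫ A ◁ a.star ◁ m

/-- `g ∘ m = n ∘ (g ⊗ g_* ⊗ g)`: `g` preserves ternary multiplications. -/
def PreservesTernary (m : A ⊗ (a.star ⊗ A) ⟶ A) (n : B ⊗ (b.star ⊗ B) ⟶ B)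
    (g : A ⟶ B) : Prop :=
  m ≫ g = (g ⊗ₘ (a.conj b g ⊗ₘ g)) ≫ n

theorem PreservesTernary.id (m : A ⊗ (a.star ⊗ A) ⟶ A) :
    PreservesTernary a a m m (𝟙 A) := by
  simp [PreservesTernary, DaggerDual.conj_id]

theorem PreservesTernary.comp {a : DaggerDual A} {b : DaggerDual B} {c : DaggerDual C}
    {m : A ⊗ (a.star ⊗ A) ⟶ A} {n : B ⊗ (b.star ⊗ B) ⟶ B} {p : C ⊗ (c.star ⊗ C) ⟶ C}
    {g : A ⟶ B} {h : B ⟶ C} (hg : PreservesTernary a b m n g)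
    (hh : PreservesTernary b c n p h) : PreservesTernary a c m p (g ≫ h) := by
  unfold PreservesTernary at *
  rw [← Category.assoc, hg, Category.assoc, hh, DaggerDual.conj_comp a b c,
    ← Category.assoc, tensorHom_comp_tensorHom, tensorHom_comp_tensorHom]

end Ternary

end

/-- A dagger Frobenius 3-structure. -/
structure Frobenius3 (D : Type u) [Category.{v} D] [MonoidalCategory D]
    [MonoidalDaggerCategory D] where
  carrier : D
  dual : DaggerDual carrier
  mul : carrier ⊗ (dual.star ⊗ carrier) ⟶ carrier
  /-- `[a, b, [c, d, e]] = [[a, b, c], d, e]` -/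
  assoc : carrier ◁ dual.star ◁ mul ≫ mul =
    carrier ◁ (α_ dual.star carrier (dual.star ⊗ carrier)).inv ≫
      (α_ carrier (dual.star ⊗ carrier) (dual.star ⊗ carrier)).inv ≫
      mul ▷ (dual.star ⊗ carrier) ≫ mul
  symmetry : comulRight dual mul = comulLeft dual mul
  dagger_symmetry : comulRight dual mul = dag mul

/-- A normal dagger Frobenius 3-structure: the left and right loops are identities. -/
structure NormalFrobenius3 (D : Type u) [Category.{v} D] [MonoidalCategory D]
    [MonoidalDaggerCategory D] extends Frobenius3 D where
  left_loop : (λ_ carrier).inv ≫ dual.cup' ▷ carrier ≫ (α_ _ _ _).hom ≫ mul = 𝟙 carrier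
  right_loop : (ρ_ carrier).inv ≫ carrier ◁ dual.cup ≫ mul = 𝟙 carrier

section

variable {D : Type u} [Category.{v} D] [MonoidalCategory D] [MonoidalDaggerCategory D]

/-- A morphism of 3-structures. -/
@[ext]
structure Frobenius3.Hom (S T : Frobenius3 D) where
  hom : S.carrier ⟶ T.carrier
  preserves : PreservesTernary S.dual T.dual S.mul T.mul hom

instance : Category (Frobenius3 D) where
  Hom := Frobenius3.Hom
  id S := ⟨𝟙 _, PreservesTernary.id S.dual S.mul⟩
  comp f g := ⟨f.hom ≫ g.hom, f.preserves.comp g.preserves⟩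
  id_comp f := Frobenius3.Hom.ext (Category.id_comp f.hom)
  comp_id f := Frobenius3.Hom.ext (Category.comp_id f.hom)
  assoc f g h := Frobenius3.Hom.ext (Category.assoc f.hom g.hom h.hom)

/-- Normal 3-structures form a full subcategory of the 3-structures. -/
instance : Category (NormalFrobenius3 D) where
  Hom S T := Frobenius3.Hom S.toFrobenius3 T.toFrobenius3
  id S := 𝟙 S.toFrobenius3
  comp f g := ⟨f.hom ≫ g.hom, f.preserves.comp g.preserves⟩
  id_comp f := Frobenius3.Hom.ext (Category.id_comp f.hom)
  comp_id f := Frobenius3.Hom.ext (Category.comp_id f.hom)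
  assoc f g h := Frobenius3.Hom.ext (Category.assoc f.hom g.hom h.hom)

/-! ### Symmetric dagger Frobenius 2-structures -/

section Binary

variable {B : D} (b : DaggerDual B)

/-- Given a multiplication and a counit, the map `B ⟶ B*` obtained by bending the right
input of the pairing `counit ∘ mul` with `η'`. -/
def involutionRight (m : B ⊗ B ⟶ B) (e : B ⟶ 𝟙_ D) : B ⟶ b.star :=
  (ρ_ B).inv ≫ B ◁ b.cup' ≫ (α_ B B b.star).inv ≫ (m ≫ e) ▷ b.star ≫ (λ_ b.star).hom

/-- Given a multiplication and a counit, the map `B ⟶ B*` obtained by bending the left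
input of the pairing `counit ∘ mul` with `η`. -/
def involutionLeft (m : B ⊗ B ⟶ B) (e : B ⟶ 𝟙_ D) : B ⟶ b.star :=
  (λ_ B).inv ≫ b.cup ▷ B ≫ (α_ b.star B B).hom ≫ b.star ◁ (m ≫ e) ≫ (ρ_ b.star).hom

end Binary

end

/-- A symmetric dagger Frobenius 2-structure on a dagger dual object.  The comultiplication
is `mul†` and the counit is `one†`; the comonoid laws are the daggers of the monoid laws. -/
structure Frobenius2 (D : Type u) [Category.{v} D] [MonoidalCategory D]
    [MonoidalDaggerCategory D] where
  carrier : D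
  dual : DaggerDual carrier
  mul : carrier ⊗ carrier ⟶ carrier
  one : 𝟙_ D ⟶ carrier
  one_mul : one ▷ carrier ≫ mul = (λ_ carrier).hom
  mul_one : carrier ◁ one ≫ mul = (ρ_ carrier).hom
  mul_assoc : mul ▷ carrier ≫ mul = (α_ carrier carrier carrier).hom ≫ carrier ◁ mul ≫ mul
  /-- `(mul ⊗ id) ∘ (id ⊗ mul†) = (id ⊗ mul) ∘ (mul† ⊗ id)` -/
  frobenius : carrier ◁ dag mul ≫ (α_ carrier carrier carrier).inv ≫ mul ▷ carrier =
    dag mul ▷ carrier ≫ (α_ carrier carrier carrier).hom ≫ carrier ◁ mul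
  symmetric : involutionRight dual mul (dag one) = involutionLeft dual mul (dag one)

section

variable {D : Type u} [Category.{v} D] [MonoidalCategory D] [MonoidalDaggerCategory D]

namespace Frobenius2

variable (B : Frobenius2 D)

/-- The involution `B ⟶ B*` of a symmetric 2-structure. -/
def involution : B.carrier ⟶ B.dual.star := involutionRight B.dual B.mul (dag B.one)

/-- A 2-structure is special when `mul ∘ mul† = id`. -/
def IsSpecial : Prop := dag B.mul ≫ B.mul = 𝟙 B.carrier

/-- The 3-structure multiplication induced by a 2-structure,
`mul ∘ (mul ⊗ id) ∘ (id ⊗ s ⊗ id)`, where `s : B* ⟶ B` is the dagger (equivalently, the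
inverse) of the involution `B ⟶ B*`. -/
def ternaryMul : B.carrier ⊗ (B.dual.star ⊗ B.carrier) ⟶ B.carrier :=
  B.carrier ◁ (dag B.involution ▷ B.carrier) ≫
    (α_ B.carrier B.carrier B.carrier).inv ≫ B.mul ▷ B.carrier ≫ B.mul

theorem snake : (ρ_ B.carrier).inv ≫ B.carrier ◁ (B.one ≫ dag B.mul) ≫ (α_ _ _ _).inv ≫
    (B.mul ≫ dag B.one) ▷ B.carrier ≫ (λ_ B.carrier).hom = 𝟙 B.carrier := by
  have h1 : dag B.mul ≫ dag B.one ▷ B.carrier = (λ_ B.carrier).inv := by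
    simpa using congrArg dag B.one_mul
  have h2 : B.carrier ◁ dag B.mul ≫ (α_ _ _ _).inv ≫ B.mul ▷ B.carrier ≫
      dag B.one ▷ B.carrier = dag B.mul ▷ B.carrier ≫ (α_ _ _ _).hom ≫
      B.carrier ◁ B.mul ≫ dag B.one ▷ B.carrier := by
    simpa using congrArg (fun t => t ≫ dag B.one ▷ B.carrier) B.frobenius
  have h3 : B.carrier ◁ B.one ≫ dag B.mul ▷ B.carrier ≫ (α_ _ _ _).hom ≫
      B.carrier ◁ B.mul = (ρ_ B.carrier).hom ≫ dag B.mul := by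
    rw [whisker_exchange_assoc, tensor_whiskerLeft, Category.assoc, Category.assoc,
      Iso.inv_hom_id_assoc, ← whiskerLeft_comp, B.mul_one]
    simp
  simp only [whiskerLeft_comp, comp_whiskerRight, Category.assoc]
  rw [reassoc_of% h2, reassoc_of% h3, reassoc_of% h1]
  simp

/-- The pairing `counit ∘ mul` and copairing `mul† ∘ one` make `B` dual to itself. -/
@[reducible]
def selfPairing : ExactPairing B.carrier B.carrier where
  coevaluation' := B.one ≫ dag B.mul
  evaluation' := B.mul ≫ dag B.one
  coevaluation_evaluation' := by
    rw [← cancel_epi (ρ_ B.carrier).inv, ← cancel_mono (λ_ B.carrier).hom]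
    simpa using B.snake
  evaluation_coevaluation' := by
    rw [← cancel_epi (λ_ B.carrier).inv, ← cancel_mono (ρ_ B.carrier).hom]
    simpa using congrArg dag B.snake

/-- The involution is unitary. -/
theorem involution_unitary : B.involution ≫ dag B.involution = 𝟙 _ ∧
    dag B.involution ≫ B.involution = 𝟙 _ := by
  have h1 : (rightDualIso B.selfPairing B.dual.reversePairing).hom = B.involution := by
    simp only [rightDualIso, rightAdjointMate, id_whiskerRight, whiskerLeft_id,
      Category.id_comp]
    rfl
  have h2 : (rightDualIso B.selfPairing B.dual.reversePairing).inv = dag B.involution := by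
    have h : B.involution = involutionLeft B.dual B.mul (dag B.one) := B.symmetric
    rw [h]
    simp only [rightDualIso, rightAdjointMate, id_whiskerRight, whiskerLeft_id,
      Category.id_comp, involutionLeft, dag_comp, dag_whiskerLeft, dag_whiskerRight, dag_dag,
      dag_leftUnitor_inv, dag_rightUnitor, dag_associator, Category.assoc]
    rfl
  rw [← h2, ← h1]; simp

/-- A morphism of 2-structures preserves multiplication and involution. -/
@[ext]
structure Hom (B C : Frobenius2 D) where
  hom : B.carrier ⟶ C.carrier
  map_mul : B.mul ≫ hom = (hom ⊗ₘ hom) ≫ C.mul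
  map_involution : hom ≫ C.involution = B.involution ≫ B.dual.conj C.dual hom

/-- Morphisms of 2-structures preserve the induced ternary multiplications. -/
theorem Hom.preservesTernary {B C : Frobenius2 D} (f : Hom B C) :
    PreservesTernary B.dual C.dual B.ternaryMul C.ternaryMul f.hom := by
  have hinv : B.dual.conj C.dual f.hom ≫ dag C.involution = dag B.involution ≫ f.hom := by
    calc _ = dag B.involution ≫ (B.involution ≫ B.dual.conj C.dual f.hom) ≫
            dag C.involution := by
          rw [Category.assoc, ← Category.assoc, B.involution_unitary.2, Category.id_comp]
      _ = _ := by
          rw [← f.map_involution, Category.assoc, C.involution_unitary.1, Category.comp_id]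
  have hm := f.map_mul
  unfold PreservesTernary ternaryMul
  calc _ = B.carrier ◁ dag B.involution ▷ B.carrier ≫ (α_ _ _ _).inv ≫
          B.mul ▷ B.carrier ≫ (f.hom ⊗ₘ f.hom) ≫ C.mul := by
        simp only [Category.assoc, hm]
    _ = B.carrier ◁ dag B.involution ▷ B.carrier ≫ (α_ _ _ _).inv ≫
          ((f.hom ⊗ₘ f.hom) ⊗ₘ f.hom) ≫ C.mul ▷ C.carrier ≫ C.mul := by
        rw [whiskerRight_comp_tensorHom_assoc, hm, tensorHom_comp_whiskerRight_assoc]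
    _ = (f.hom ⊗ₘ ((dag B.involution ≫ f.hom) ⊗ₘ f.hom)) ≫ (α_ _ _ _).inv ≫
          C.mul ▷ C.carrier ≫ C.mul := by
        rw [← associator_inv_naturality_assoc, whiskerLeft_comp_tensorHom_assoc,
          whiskerRight_comp_tensorHom]
    _ = _ := by
        rw [← hinv, tensorHom_comp_whiskerLeft_assoc, tensorHom_comp_whiskerRight]

instance : Category (Frobenius2 D) where
  Hom := Hom
  id B := ⟨𝟙 _, by simp, by simp [DaggerDual.conj_id]⟩
  comp {B C E} f g := ⟨f.hom ≫ g.hom,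
    by rw [← Category.assoc, f.map_mul, Category.assoc, g.map_mul, ← Category.assoc,
      tensorHom_comp_tensorHom],
    by rw [Category.assoc, g.map_involution, ← Category.assoc, f.map_involution,
      Category.assoc, ← DaggerDual.conj_comp]⟩
  id_comp f := Hom.ext (Category.id_comp f.hom)
  comp_id f := Hom.ext (Category.comp_id f.hom)
  assoc f g h := Hom.ext (Category.assoc f.hom g.hom h.hom)

end Frobenius2

end

/-! ### Sub-3-structures of 2-structures -/

/-- The objects of `BinSub(D)`: a normal dagger 3-structure `tern`, a symmetric dagger
Frobenius 2-structure `two`, and an isometry `incl` between them which is a morphism of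
3-structures and satisfies `mul ∘ (incl ⊗ incl) = 0`. -/
structure BinSub (D : Type u) [Category.{v} D] [MonoidalCategory D]
    [MonoidalDaggerCategory D] [HasZeroMorphisms D] where
  tern : NormalFrobenius3 D
  two : Frobenius2 D
  incl : tern.carrier ⟶ two.carrier
  isometry : IsIsometry incl
  preserves : PreservesTernary tern.dual two.dual tern.mul two.ternaryMul incl
  mul_zero : (incl ⊗ₘ incl) ≫ two.mul = 0

namespace BinSub

variable {D : Type u} [Category.{v} D] [MonoidalCategory D] [MonoidalDaggerCategory D]
  [HasZeroMorphisms D]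

/-- A morphism of `BinSub(D)`: a morphism `f` of the ambient 2-structures with
`f ∘ i = i' ∘ i'† ∘ f ∘ i`. -/
@[ext]
structure Hom (X Y : BinSub D) where
  two : X.two ⟶ Y.two
  restricts : X.incl ≫ two.hom = X.incl ≫ two.hom ≫ dag Y.incl ≫ Y.incl

instance : Category (BinSub D) where
  Hom := Hom
  id X := ⟨𝟙 X.two, by
    have h : X.incl ≫ dag X.incl = 𝟙 _ := X.isometry
    change X.incl ≫ 𝟙 _ = X.incl ≫ 𝟙 _ ≫ dag X.incl ≫ X.incl
    rw [Category.id_comp, Category.comp_id, ← Category.assoc, h, Category.id_comp]⟩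
  comp {X Y Z} f g := ⟨f.two ≫ g.two, by
    change X.incl ≫ f.two.hom ≫ g.two.hom =
      X.incl ≫ (f.two.hom ≫ g.two.hom) ≫ dag Z.incl ≫ Z.incl
    have hf := f.restricts
    have hg := g.restricts
    calc X.incl ≫ f.two.hom ≫ g.two.hom
        = (X.incl ≫ f.two.hom ≫ dag Y.incl ≫ Y.incl) ≫ g.two.hom := by
          rw [← hf, Category.assoc]
      _ = (X.incl ≫ f.two.hom ≫ dag Y.incl) ≫ Y.incl ≫ g.two.hom := by
          simp only [Category.assoc]
      _ = (X.incl ≫ f.two.hom ≫ dag Y.incl ≫ Y.incl) ≫ g.two.hom ≫ dag Z.incl ≫ Z.incl := by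
          rw [hg]; simp only [Category.assoc]
      _ = _ := by rw [← hf]; simp only [Category.assoc]⟩
  id_comp f := Hom.ext (Category.id_comp f.two)
  comp_id f := Hom.ext (Category.comp_id f.two)
  assoc f g h := Hom.ext (Category.assoc f.two g.two h.two)

/-- For a morphism `f` of `BinSub(D)`, the map `i'† ∘ f ∘ i` is a morphism of 3-structures. -/
def restrict {X Y : BinSub D} (f : X ⟶ Y) : X.tern ⟶ Y.tern where
  hom := X.incl ≫ f.two.hom ≫ dag Y.incl
  preserves := by
    have hiso : Y.incl ≫ dag Y.incl = 𝟙 _ := Y.isometry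
    have hg : (X.incl ≫ f.two.hom ≫ dag Y.incl) ≫ Y.incl = X.incl ≫ f.two.hom := by
      rw [f.restricts]; simp only [Category.assoc]
    have h := X.preserves.comp (Frobenius2.Hom.preservesTernary f.two)
    generalize X.incl ≫ f.two.hom ≫ dag Y.incl = g at hg ⊢
    rw [← hg] at h
    unfold PreservesTernary at h ⊢
    have hY : _ = _ := Y.preserves
    have h' := congrArg (fun t => t ≫ dag Y.incl) h
    rw [DaggerDual.conj_comp _ Y.tern.dual, ← tensorHom_comp_tensorHom,
      ← tensorHom_comp_tensorHom, Category.assoc (g ⊗ₘ _), ← hY] at h'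
    simpa [hiso] using h'

end BinSub

section

variable (D : Type u) [Category.{v} D] [MonoidalCategory D] [MonoidalDaggerCategory D]
  [HasZeroMorphisms D]

/-- The functor `S` picking out the sub-3-structure, acting on morphisms by
`f ↦ i'† ∘ f ∘ i`. -/
def subFunctor : BinSub D ⥤ NormalFrobenius3 D where
  obj X := X.tern
  map f := BinSub.restrict f
  map_id X := Frobenius3.Hom.ext (by
    change X.incl ≫ 𝟙 _ ≫ dag X.incl = 𝟙 _
    rw [Category.id_comp]; exact X.isometry)
  map_comp {X Y Z} f g := Frobenius3.Hom.ext (by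
    change X.incl ≫ (f.two.hom ≫ g.two.hom) ≫ dag Z.incl =
      (X.incl ≫ f.two.hom ≫ dag Y.incl) ≫ Y.incl ≫ g.two.hom ≫ dag Z.incl
    have hf := f.restricts
    calc _ = (X.incl ≫ f.two.hom) ≫ g.two.hom ≫ dag Z.incl := by simp only [Category.assoc]
      _ = _ := by rw [hf]; simp only [Category.assoc])

/-! ### Dagger biproducts and dagger splittings -/

variable {D} in
/-- A bicone is a dagger biproduct when it is a biproduct with `π = κ†`. -/
structure IsDaggerBiproduct {A B : D} (b : BinaryBicone A B) : Prop where
  isBilimit : Nonempty b.IsBilimit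
  fst_eq : b.fst = dag b.inl
  snd_eq : b.snd = dag b.inr

/-- Any two objects have a dagger biproduct. -/
class HasDaggerBiproducts : Prop where
  exists_biproduct : ∀ A B : D, ∃ b : BinaryBicone A B, IsDaggerBiproduct b

theorem hasBinaryBiproducts [HasDaggerBiproducts D] : HasBinaryBiproducts D where
  has_binary_biproduct A B := by
    obtain ⟨b, ⟨h⟩, -, -⟩ := HasDaggerBiproducts.exists_biproduct A B
    exact ⟨⟨b, h⟩⟩

/-- Dagger biproducts are distributive when the canonical map
`u : (A ⊗ B) ⊕ (A ⊗ C) ⟶ A ⊗ (B ⊕ C)` is an isomorphism with inverse `u†`. -/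
def DistributiveDaggerBiproducts : Prop :=
  ∀ (A B C : D) (b : BinaryBicone B C) (t : BinaryBicone (A ⊗ B) (A ⊗ C)),
    IsDaggerBiproduct b → IsDaggerBiproduct t →
    ∀ u : t.pt ⟶ A ⊗ b.pt, t.inl ≫ u = A ◁ b.inl → t.inr ≫ u = A ◁ b.inr →
      u ≫ dag u = 𝟙 t.pt ∧ dag u ≫ u = 𝟙 (A ⊗ b.pt)

/-- Every dagger idempotent `p` has a dagger splitting: `p = i ∘ i†` for an isometry `i`. -/
def HasDaggerSplittings : Prop :=
  ∀ (X : D) (p : X ⟶ X), IsDaggerIdempotent p →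
    ∃ (Y : D) (i : Y ⟶ X), IsIsometry i ∧ p = dag i ≫ i

/-- The addition of morphisms induced by biproducts is idempotent. -/
def AdditionIdempotent [HasDaggerBiproducts D] : Prop :=
  letI : HasBinaryBiproducts D := hasBinaryBiproducts D
  ∀ (X Y : D) (f : X ⟶ Y),
    letI := SemiadditiveOfBinaryBiproducts.addCommMonoidHomOfHasBinaryBiproducts X Y
    f + f = f

end

end Enveloping

/-!
The enveloping 2-structure of `A` is its linking algebra.  One should think of `A` as a space of
operators that is closed under `x y* z`, and of an element of `X ⊗ Y*` as an operator from `Y` to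
`X`.

The products `x* y` span the right algebra `R` of `A`.  It is split off from `A* ⊗ A` by the dagger
idempotent `x* ⊗ y ↦ ∑ z* ⊗ [z, x, y]` (`isDaggerIdempotent_rightProjection`), and it is a special
dagger Frobenius monoid which acts on `A` from the right.  Both `A` and `R` are dagger modules over
`R` (`DaggerModule`), with `R`-valued inner product `⟨x, y⟩ = x* y`, and so is the direct sum
`C = A ⊕ R` (`exists_directSum`).  The `R`-linear endomorphisms of a dagger module `C` form a dagger
Frobenius monoid, split off from `C ⊗ C*` by the dagger idempotent `x ⊗ y* ↦ ∑ x ⟨y, z⟩ ⊗ z*`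
(`DaggerModule.LeftAlgebra`).  For `C = A ⊕ R` this is the algebra of matrices with entries in
`A A*`, `A`, `A*` and `R`.  The elements of `A` are the off-diagonal matrices `(a, r) ↦ (x r, 0)`;
their products vanish, and they have the given triple product.  A dagger Frobenius monoid is its own
dagger dual, and with this choice of dual it is a symmetric 2-structure whose involution is the
identity (`FrobeniusMonoid.frobenius2`).

For the universal property let `g : A ⟶ Y` preserve triple products and have `g g = 0`.  All maps
into `Y` are treated as families `γ : X ⊗ Y ⟶ Y` of left multiplication operators; the conjugate of
a map then corresponds to the family `γ*` of adjoint operators (`DaggerDual.leftMul_conj`).  If `A`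
is represented by `γ`, then `R` is represented by the operators `γ* γ`, the module `C` by the
family `γ'` with components `γ` and `γ* γ`, and the algebra of endomorphisms by `γ' γ'*`
(`LeftAlgebra.mul_represent`).  The hypothesis `g g = 0` makes the mixed inner products of the
summands `A` and `R` vanish in `Y`, as they do in `C` (`exists_representation`).  The extension is
unique because the algebra is spanned by the products `c c'*` with `c` and `c'` in `C`, and `R` by
the products `x* y` with `x` and `y` in `A` (`hom_ext`).  Hence restriction to `A` is bijective on
morphisms, which gives the adjunction, with the identity as its unit.

In the enveloping algebra `m m†` is multiplication by `∑ ⟨c, c⟩`.  Each of the two summands of `C`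
contributes the unit of `R` to this sum, so that the algebra is special as soon as addition is
idempotent (`isSpecial`).

Most equations between morphisms are stated after tensoring on the right with an arbitrary object
`Z` and bracketing everything to the right.  In this form composites contain no associators or
unitors, and laws can be applied in the middle of a tensor product by rewriting.
-/

namespace Enveloping

/-! ### Extension of morphisms by a spectator object -/

section Extension

variable {D : Type u} [Category.{v} D] [MonoidalCategory D]

section Definitions

variable {X Y V W : D}

/-- `f ⊗ Z` for `f : I ⟶ X`, with the unitor absorbed.  In `extij f Z` the digits are the numbers
of tensor factors in the source and the target of `f`; all objects are bracketed to the right,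
so that composites of whiskered extensions contain no coherence isomorphisms. -/
def ext01 (f : 𝟙_ D ⟶ X) (Z : D) : Z ⟶ X ⊗ Z := (λ_ Z).inv ≫ f ▷ Z

/-- `f ⊗ Z` for `f : X ⟶ I`. -/
def ext10 (f : X ⟶ 𝟙_ D) (Z : D) : X ⊗ Z ⟶ Z := f ▷ Z ≫ (λ_ Z).hom

/-- `f ⊗ Z` for `f : X ⊗ Y ⟶ I`. -/
def ext20 (f : X ⊗ Y ⟶ 𝟙_ D) (Z : D) : X ⊗ (Y ⊗ Z) ⟶ Z :=
  (α_ X Y Z).inv ≫ f ▷ Z ≫ (λ_ Z).hom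

/-- `f ⊗ Z` for `f : I ⟶ X ⊗ Y`. -/
def ext02 (f : 𝟙_ D ⟶ X ⊗ Y) (Z : D) : Z ⟶ X ⊗ (Y ⊗ Z) :=
  (λ_ Z).inv ≫ f ▷ Z ≫ (α_ X Y Z).hom

/-- `f ⊗ Z` for `f : X ⊗ Y ⟶ W`. -/
def ext21 (f : X ⊗ Y ⟶ W) (Z : D) : X ⊗ (Y ⊗ Z) ⟶ W ⊗ Z := (α_ X Y Z).inv ≫ f ▷ Z

/-- `f ⊗ Z` for `f : W ⟶ X ⊗ Y`. -/
def ext12 (f : W ⟶ X ⊗ Y) (Z : D) : W ⊗ Z ⟶ X ⊗ (Y ⊗ Z) := f ▷ Z ≫ (α_ X Y Z).hom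

/-- `f ⊗ Z` for `f : X ⊗ Y ⟶ V ⊗ W`. -/
def ext22 (f : X ⊗ Y ⟶ V ⊗ W) (Z : D) : X ⊗ (Y ⊗ Z) ⟶ V ⊗ (W ⊗ Z) :=
  (α_ X Y Z).inv ≫ f ▷ Z ≫ (α_ V W Z).hom

/-- `f ⊗ Z` for `f : X ⊗ (Y ⊗ V) ⟶ W`. -/
def ext31 (f : X ⊗ (Y ⊗ V) ⟶ W) (Z : D) : X ⊗ (Y ⊗ (V ⊗ Z)) ⟶ W ⊗ Z :=
  X ◁ (α_ Y V Z).inv ≫ (α_ X (Y ⊗ V) Z).inv ≫ f ▷ Z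

/-- `f ⊗ Z` for `f : W ⟶ X ⊗ (Y ⊗ V)`. -/
def ext13 (f : W ⟶ X ⊗ (Y ⊗ V)) (Z : D) : W ⊗ Z ⟶ X ⊗ (Y ⊗ (V ⊗ Z)) :=
  f ▷ Z ≫ (α_ X (Y ⊗ V) Z).hom ≫ X ◁ (α_ Y V Z).hom

end Definitions

section Naturality

variable {X Y V W Z Z' : D} (k : Z ⟶ Z')

theorem ext01_natural (f : 𝟙_ D ⟶ X) : k ≫ ext01 f Z' = ext01 f Z ≫ X ◁ k := by
  simp [ext01, ← whisker_exchange]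

theorem ext20_natural (f : X ⊗ Y ⟶ 𝟙_ D) :
    X ◁ Y ◁ k ≫ ext20 f Z' = ext20 f Z ≫ k := by
  simp only [ext20, Category.assoc, associator_inv_naturality_right_assoc,
    whisker_exchange_assoc]
  simp

theorem ext02_natural (f : 𝟙_ D ⟶ X ⊗ Y) :
    k ≫ ext02 f Z' = ext02 f Z ≫ X ◁ Y ◁ k := by
  simp only [ext02, Category.assoc, ← associator_naturality_right, ← whisker_exchange_assoc]
  simp

theorem ext21_natural (f : X ⊗ Y ⟶ W) :
    X ◁ Y ◁ k ≫ ext21 f Z' = ext21 f Z ≫ W ◁ k := by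
  simp only [ext21, Category.assoc, associator_inv_naturality_right_assoc, whisker_exchange]

theorem ext12_natural (f : W ⟶ X ⊗ Y) :
    W ◁ k ≫ ext12 f Z' = ext12 f Z ≫ X ◁ Y ◁ k := by
  simp only [ext12, Category.assoc, ← associator_naturality_right, whisker_exchange_assoc]

theorem ext22_natural {V' : D} (f : X ⊗ Y ⟶ V ⊗ V') :
    X ◁ Y ◁ k ≫ ext22 f Z' = ext22 f Z ≫ V ◁ V' ◁ k := by
  simp only [ext22, Category.assoc, associator_inv_naturality_right_assoc,
    whisker_exchange_assoc, associator_naturality_right]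

theorem ext31_natural (f : X ⊗ (Y ⊗ V) ⟶ W) :
    X ◁ Y ◁ V ◁ k ≫ ext31 f Z' = ext31 f Z ≫ W ◁ k := by
  simp only [ext31, Category.assoc, ← whiskerLeft_comp_assoc, associator_inv_naturality_right]
  simp only [whiskerLeft_comp, Category.assoc, associator_inv_naturality_right_assoc,
    whisker_exchange]

end Naturality

/-- A morphism is determined by its extensions. -/
theorem eq_of_whiskerRight_eq {X Y : D} {f g : X ⟶ Y} (h : ∀ Z : D, f ▷ Z = g ▷ Z) : f = g := by
  simpa using h (𝟙_ D)

theorem whiskerLeft_of_comp {X Y Z : D} (W : D) {f : X ⟶ Y} {g : Y ⟶ Z} {k : X ⟶ Z}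
    (h : f ≫ g = k) : W ◁ f ≫ W ◁ g = W ◁ k := by
  rw [← whiskerLeft_comp, h]

theorem whiskerLeft_of_comp_id {X Y : D} (W : D) {f : X ⟶ Y} {g : Y ⟶ X}
    (h : f ≫ g = 𝟙 X) : W ◁ f ≫ W ◁ g = 𝟙 (W ⊗ X) := by
  rw [← whiskerLeft_comp, h, whiskerLeft_id]

theorem whiskerLeft_of_comm {X Y Y' Z : D} (W : D) {f : X ⟶ Y} {g : Y ⟶ Z} {f' : X ⟶ Y'}
    {g' : Y' ⟶ Z} (h : f ≫ g = f' ≫ g') : W ◁ f ≫ W ◁ g = W ◁ f' ≫ W ◁ g' := by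
  rw [← whiskerLeft_comp, h, whiskerLeft_comp]

variable [MonoidalDaggerCategory D]

section Dagger

variable {X Y V W : D} (Z : D)

theorem dag_ext01 (f : 𝟙_ D ⟶ X) : dag (ext01 f Z) = ext10 (dag f) Z := by
  simp [ext01, ext10]

theorem dag_ext20 (f : X ⊗ Y ⟶ 𝟙_ D) : dag (ext20 f Z) = ext02 (dag f) Z := by
  simp [ext20, ext02]

theorem dag_ext02 (f : 𝟙_ D ⟶ X ⊗ Y) : dag (ext02 f Z) = ext20 (dag f) Z := by
  simp [ext20, ext02]

theorem dag_ext21 (f : X ⊗ Y ⟶ W) : dag (ext21 f Z) = ext12 (dag f) Z := by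
  simp [ext21, ext12]

theorem dag_ext12 (f : W ⟶ X ⊗ Y) : dag (ext12 f Z) = ext21 (dag f) Z := by
  simp [ext21, ext12]

theorem dag_ext31 (f : X ⊗ (Y ⊗ V) ⟶ W) : dag (ext31 f Z) = ext13 (dag f) Z := by
  simp [ext31, ext13]

end Dagger

theorem dag_ext22 {X Y V W : D} (f : X ⊗ Y ⟶ V ⊗ W) (Z : D) :
    dag (ext22 f Z) = ext22 (dag f) Z := by
  simp [ext22]

set_option linter.unusedSectionVars false in
theorem ext22_injective {X Y V W : D} {f g : X ⊗ Y ⟶ V ⊗ W}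
    (h : ∀ Z, ext22 f Z = ext22 g Z) : f = g :=
  eq_of_whiskerRight_eq fun Z => by simpa [ext22] using h Z

theorem dag_injective {X Y : D} {f g : X ⟶ Y} (h : dag f = dag g) : f = g := by
  rw [← dag_dag f, h, dag_dag]

end Extension

/-! ### Snake equations for dagger duals -/

namespace DaggerDual

variable {D : Type u} [Category.{v} D] [MonoidalCategory D] [MonoidalDaggerCategory D]
  {X : D} (a : DaggerDual X)

/-- The dagger dual `X` of `X*`, with cup `η'` and cap `ε'`. -/
def reverse : DaggerDual a.star := ⟨X, a.reversePairing⟩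

theorem dag_cap : dag a.cap = a.cup' := rfl

theorem dag_cup : dag a.cup = a.cap' := rfl

theorem dag_cap' : dag a.cap' = a.cup := dag_dag _

theorem dag_cup' : dag a.cup' = a.cap := dag_dag _

set_option linter.unusedSectionVars false in
theorem cup_cap (Z : D) : X ◁ ext02 a.cup Z ≫ ext20 a.cap (X ⊗ Z) = 𝟙 (X ⊗ Z) := by
  have h : X ◁ a.cup ≫ (α_ _ _ _).inv ≫ a.cap ▷ X = (ρ_ _).hom ≫ (λ_ _).inv :=
    a.pairing.coevaluation_evaluation'
  calc _ = (ρ_ X).inv ▷ Z ≫ ((X ◁ a.cup ≫ (α_ X a.star X).inv ≫ a.cap ▷ X) ▷ Z) ≫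
        (α_ _ _ _).hom ≫ (λ_ _).hom := by
        simp only [ext02, ext20]; monoidal
    _ = _ := by rw [h]; monoidal

set_option linter.unusedSectionVars false in
theorem cup_cap_star (Z : D) :
    ext02 a.cup (a.star ⊗ Z) ≫ a.star ◁ ext20 a.cap Z = 𝟙 (a.star ⊗ Z) := by
  have h : a.cup ▷ a.star ≫ (α_ _ _ _).hom ≫ a.star ◁ a.cap = (λ_ _).hom ≫ (ρ_ _).inv :=
    a.pairing.evaluation_coevaluation'
  calc _ = (λ_ _).inv ≫ (α_ _ _ _).inv ≫
        ((a.cup ▷ a.star ≫ (α_ _ _ _).hom ≫ a.star ◁ a.cap) ▷ Z) ≫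
        (α_ _ _ _).hom ≫ a.star ◁ (λ_ _).hom := by
        simp only [ext02, ext20]; monoidal
    _ = _ := by rw [h]; monoidal

theorem cup'_cap' (Z : D) :
    ext02 a.cup' (X ⊗ Z) ≫ X ◁ ext20 a.cap' Z = 𝟙 (X ⊗ Z) := by
  simpa [dag_ext20, dag_ext02, dag_cap, dag_cup] using congrArg dag (a.cup_cap Z)

theorem cup'_cap'_star (Z : D) :
    a.star ◁ ext02 a.cup' Z ≫ ext20 a.cap' (a.star ⊗ Z) = 𝟙 (a.star ⊗ Z) := by
  simpa [dag_ext20, dag_ext02, dag_cap, dag_cup] using congrArg dag (a.cup_cap_star Z)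

/-- A dagger dual from snake equations stated on extensions. -/
@[reducible] def ofExt (S : D) (n : 𝟙_ D ⟶ S ⊗ X) (e : X ⊗ S ⟶ 𝟙_ D)
    (h : ∀ Z, X ◁ ext02 n Z ≫ ext20 e (X ⊗ Z) = 𝟙 (X ⊗ Z))
    (h' : ∀ Z, ext02 n (S ⊗ Z) ≫ S ◁ ext20 e Z = 𝟙 (S ⊗ Z)) : DaggerDual X where
  star := S
  pairing :=
    { coevaluation' := n
      evaluation' := e
      coevaluation_evaluation' := by
        refine eq_of_whiskerRight_eq fun Z => ?_
        calc _ = (ρ_ X).hom ▷ Z ≫ (X ◁ ext02 n Z ≫ ext20 e (X ⊗ Z)) ≫ (λ_ _).inv ≫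
              (α_ _ _ _).inv := by
              simp only [ext02, ext20]; monoidal
          _ = _ := by rw [h]; monoidal
      evaluation_coevaluation' := by
        refine eq_of_whiskerRight_eq fun Z => ?_
        calc _ = (α_ _ _ _).hom ≫ (λ_ _).hom ≫ (ext02 n (S ⊗ Z) ≫ S ◁ ext20 e Z) ≫
              S ◁ (λ_ _).inv ≫ (α_ _ _ _).inv := by
              simp only [ext02, ext20]; monoidal
          _ = _ := by rw [h']; monoidal }

end DaggerDual

/-! ### Dagger Frobenius monoids -/

/-- A dagger Frobenius monoid: the comultiplication is `mul†`, and no dual is chosen. -/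
structure FrobeniusMonoid (D : Type u) [Category.{v} D] [MonoidalCategory D]
    [MonoidalDaggerCategory D] where
  carrier : D
  mul : carrier ⊗ carrier ⟶ carrier
  one : 𝟙_ D ⟶ carrier
  one_mul : one ▷ carrier ≫ mul = (λ_ carrier).hom
  mul_one : carrier ◁ one ≫ mul = (ρ_ carrier).hom
  mul_assoc : mul ▷ carrier ≫ mul = (α_ carrier carrier carrier).hom ≫ carrier ◁ mul ≫ mul
  frobenius : carrier ◁ dag mul ≫ (α_ carrier carrier carrier).inv ≫ mul ▷ carrier =
    dag mul ▷ carrier ≫ (α_ carrier carrier carrier).hom ≫ carrier ◁ mul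

namespace FrobeniusMonoid

variable {D : Type u} [Category.{v} D] [MonoidalCategory D] [MonoidalDaggerCategory D]

/-- The laws of a dagger Frobenius monoid may be checked on extensions. -/
@[reducible] def ofExt (R : D) (m : R ⊗ R ⟶ R) (o : 𝟙_ D ⟶ R)
    (one_mul : ∀ Z, ext01 o (R ⊗ Z) ≫ ext21 m Z = 𝟙 (R ⊗ Z))
    (mul_one : ∀ Z, R ◁ ext01 o Z ≫ ext21 m Z = 𝟙 (R ⊗ Z))
    (mul_assoc : ∀ Z, ext21 m (R ⊗ Z) ≫ ext21 m Z = R ◁ ext21 m Z ≫ ext21 m Z)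
    (frobenius : ∀ Z, R ◁ ext12 (dag m) Z ≫ ext21 m (R ⊗ Z) =
      ext12 (dag m) (R ⊗ Z) ≫ R ◁ ext21 m Z) : FrobeniusMonoid D where
  carrier := R
  mul := m
  one := o
  one_mul := by
    refine eq_of_whiskerRight_eq fun Z => ?_
    calc _ = (λ_ R).hom ▷ Z ≫ ext01 o (R ⊗ Z) ≫ ext21 m Z := by
          simp only [ext01, ext21]; monoidal
      _ = _ := by rw [one_mul]; simp
  mul_one := by
    refine eq_of_whiskerRight_eq fun Z => ?_
    calc _ = (ρ_ R).hom ▷ Z ≫ R ◁ ext01 o Z ≫ ext21 m Z := by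
          simp only [ext01, ext21]; monoidal
      _ = _ := by rw [mul_one]; simp
  mul_assoc := by
    refine eq_of_whiskerRight_eq fun Z => ?_
    calc _ = (α_ _ _ _).hom ≫ (α_ _ _ _).hom ≫ ext21 m (R ⊗ Z) ≫ ext21 m Z := by
          simp only [ext21]; monoidal
      _ = _ := by rw [mul_assoc]; simp only [ext21]; monoidal
  frobenius := by
    refine eq_of_whiskerRight_eq fun Z => ?_
    calc _ = (α_ _ _ _).hom ≫ (R ◁ ext12 (dag m) Z ≫ ext21 m (R ⊗ Z)) ≫ (α_ _ _ _).inv := by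
          simp only [ext21, ext12]; monoidal
      _ = _ := by rw [frobenius]; simp only [ext21, ext12]; monoidal

variable (R : FrobeniusMonoid D)

theorem one_mul_ext (Z : D) :
    ext01 R.one (R.carrier ⊗ Z) ≫ ext21 R.mul Z = 𝟙 (R.carrier ⊗ Z) := by
  calc _ = (λ_ (R.carrier ⊗ Z)).inv ≫ (α_ _ _ _).inv ≫ (R.one ▷ R.carrier ≫ R.mul) ▷ Z := by
        simp only [ext01, ext21]; monoidal
    _ = _ := by rw [R.one_mul]; monoidal

theorem mul_one_ext (Z : D) :
    R.carrier ◁ ext01 R.one Z ≫ ext21 R.mul Z = 𝟙 (R.carrier ⊗ Z) := by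
  calc _ = (ρ_ R.carrier).inv ▷ Z ≫ (R.carrier ◁ R.one ≫ R.mul) ▷ Z := by
        simp only [ext01, ext21]; monoidal
    _ = _ := by rw [R.mul_one]; monoidal

theorem mul_assoc_ext (Z : D) : ext21 R.mul (R.carrier ⊗ Z) ≫ ext21 R.mul Z =
    R.carrier ◁ ext21 R.mul Z ≫ ext21 R.mul Z := by
  calc _ = (α_ _ _ _).inv ≫ (α_ _ _ _).inv ≫ (R.mul ▷ R.carrier ≫ R.mul) ▷ Z := by
        simp only [ext21]; monoidal
    _ = _ := by rw [R.mul_assoc]; simp only [ext21]; monoidal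

theorem frobenius_ext (Z : D) :
    R.carrier ◁ ext12 (dag R.mul) Z ≫ ext21 R.mul (R.carrier ⊗ Z) =
      ext12 (dag R.mul) (R.carrier ⊗ Z) ≫ R.carrier ◁ ext21 R.mul Z := by
  calc _ = (α_ _ _ _).inv ≫ (R.carrier ◁ dag R.mul ≫ (α_ _ _ _).inv ≫ R.mul ▷ R.carrier) ▷ Z ≫
          (α_ _ _ _).hom := by
        simp only [ext21, ext12]; monoidal
    _ = _ := by rw [R.frobenius]; simp only [ext21, ext12]; monoidal

theorem comul_counit_ext (Z : D) :
    ext12 (dag R.mul) Z ≫ ext10 (dag R.one) (R.carrier ⊗ Z) = 𝟙 (R.carrier ⊗ Z) := by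
  simpa [dag_ext21, dag_ext01] using congrArg dag (R.one_mul_ext Z)

theorem comul_counit_right_ext (Z : D) :
    ext12 (dag R.mul) Z ≫ R.carrier ◁ ext10 (dag R.one) Z = 𝟙 (R.carrier ⊗ Z) := by
  simpa [dag_ext21, dag_ext01] using congrArg dag (R.mul_one_ext Z)

theorem mul_comul_ext (Z : D) : ext21 R.mul Z ≫ ext12 (dag R.mul) Z =
    ext12 (dag R.mul) (R.carrier ⊗ Z) ≫ R.carrier ◁ ext21 R.mul Z := by
  have hassoc : ext12 (dag R.mul) Z ≫ ext12 (dag R.mul) (R.carrier ⊗ Z) =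
      ext12 (dag R.mul) Z ≫ R.carrier ◁ ext12 (dag R.mul) Z := by
    simpa [dag_ext21] using congrArg dag (R.mul_assoc_ext Z)
  -- insert a unit on the left and move it through the Frobenius law
  calc _ = ext01 R.one _ ≫ R.carrier ◁ ext21 R.mul Z ≫ R.carrier ◁ ext12 (dag R.mul) Z ≫
          ext21 R.mul (R.carrier ⊗ Z) := by
        rw [← reassoc_of% (ext01_natural (ext21 R.mul Z) R.one),
          ← reassoc_of% (ext01_natural (ext12 (dag R.mul) Z) R.one), R.one_mul_ext,
          Category.comp_id]
    _ = ext01 R.one _ ≫ ext12 (dag R.mul) (R.carrier ⊗ (R.carrier ⊗ Z)) ≫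
          R.carrier ◁ (R.carrier ◁ ext21 R.mul Z ≫ ext21 R.mul Z) := by
        rw [R.frobenius_ext, reassoc_of% (ext12_natural (ext21 R.mul Z) (dag R.mul)),
          whiskerLeft_comp]
    _ = ext01 R.one _ ≫ (ext12 (dag R.mul) (R.carrier ⊗ (R.carrier ⊗ Z)) ≫
          R.carrier ◁ ext21 R.mul (R.carrier ⊗ Z)) ≫ R.carrier ◁ ext21 R.mul Z := by
        rw [← R.mul_assoc_ext, whiskerLeft_comp, Category.assoc]
    _ = _ := by
        rw [← R.frobenius_ext, Category.assoc,
          ← reassoc_of% (ext01_natural (ext12 (dag R.mul) (R.carrier ⊗ Z)) R.one),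
          reassoc_of% (R.one_mul_ext (R.carrier ⊗ (R.carrier ⊗ Z)))]

/-- The copairing `mul† ∘ one`. -/
def cup : 𝟙_ D ⟶ R.carrier ⊗ R.carrier := R.one ≫ dag R.mul

/-- The pairing `one† ∘ mul`. -/
def cap : R.carrier ⊗ R.carrier ⟶ 𝟙_ D := R.mul ≫ dag R.one

theorem dag_cap : dag R.cap = R.cup := by simp [cap, cup]

theorem dag_cup : dag R.cup = R.cap := by simp [cap, cup]

theorem ext02_cup (Z : D) : ext02 R.cup Z = ext01 R.one Z ≫ ext12 (dag R.mul) Z := by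
  simp only [cup, ext02, ext01, ext12]; monoidal

theorem ext20_cap (Z : D) : ext20 R.cap Z = ext21 R.mul Z ≫ ext10 (dag R.one) Z := by
  simp only [cap, ext20, ext10, ext21]; monoidal

/-- Multiplying the first leg of the copairing by `x` on the left gives `mul† x`. -/
theorem whiskerLeft_cup_mul (Z : D) :
    R.carrier ◁ ext02 R.cup Z ≫ ext21 R.mul (R.carrier ⊗ Z) = ext12 (dag R.mul) Z := by
  rw [R.ext02_cup, whiskerLeft_comp, Category.assoc, R.frobenius_ext, ← R.mul_comul_ext,
    reassoc_of% (R.mul_one_ext Z)]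

/-- Multiplying the second leg of the copairing by `x` on the right gives `mul† x`. -/
theorem cup_whiskerLeft_mul (Z : D) :
    ext02 R.cup (R.carrier ⊗ Z) ≫ R.carrier ◁ ext21 R.mul Z = ext12 (dag R.mul) Z := by
  rw [R.ext02_cup, Category.assoc, ← R.mul_comul_ext, reassoc_of% (R.one_mul_ext Z)]

theorem whiskerLeft_cup_cap (Z : D) :
    R.carrier ◁ ext02 R.cup Z ≫ ext20 R.cap (R.carrier ⊗ Z) = 𝟙 (R.carrier ⊗ Z) := by
  rw [R.ext20_cap, reassoc_of% (R.whiskerLeft_cup_mul Z), R.comul_counit_ext]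

theorem cup_cap_whiskerLeft (Z : D) :
    ext02 R.cup (R.carrier ⊗ Z) ≫ R.carrier ◁ ext20 R.cap Z = 𝟙 (R.carrier ⊗ Z) := by
  rw [R.ext20_cap, whiskerLeft_comp, reassoc_of% (R.cup_whiskerLeft_mul Z),
    R.comul_counit_right_ext]

/-- A dagger Frobenius monoid is its own dagger dual. -/
@[reducible] def selfDual : DaggerDual R.carrier :=
  .ofExt R.carrier R.cup R.cap R.whiskerLeft_cup_cap R.cup_cap_whiskerLeft

theorem selfDual_cup : R.selfDual.cup = R.cup := rfl

theorem selfDual_cup' : R.selfDual.cup' = R.cup := R.dag_cap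

theorem selfDual_cap' : R.selfDual.cap' = R.cap := R.dag_cup

end FrobeniusMonoid

/-! ### The right algebra of a 3-structure -/

namespace NormalFrobenius3

variable {D : Type u} [Category.{v} D] [MonoidalCategory D] [MonoidalDaggerCategory D]
  (T : NormalFrobenius3 D)

theorem assoc_ext (Z : D) :
    T.carrier ◁ T.dual.star ◁ ext31 T.mul Z ≫ ext31 T.mul Z =
      ext31 T.mul (T.dual.star ⊗ (T.carrier ⊗ Z)) ≫ ext31 T.mul Z := by
  calc _ = T.carrier ◁ T.dual.star ◁ T.carrier ◁ (α_ _ _ _).inv ≫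
        T.carrier ◁ T.dual.star ◁ (α_ _ _ _).inv ≫ T.carrier ◁ (α_ _ _ _).inv ≫
        (α_ _ _ _).inv ≫ (T.carrier ◁ T.dual.star ◁ T.mul ≫ T.mul) ▷ Z := by
        simp only [ext31]; monoidal
    _ = _ := by rw [T.assoc]; simp only [ext31]; monoidal

theorem left_loop_ext (Z : D) :
    ext02 T.dual.cup' (T.carrier ⊗ Z) ≫ ext31 T.mul Z = 𝟙 (T.carrier ⊗ Z) := by
  calc _ = ((λ_ _).inv ≫ T.dual.cup' ▷ T.carrier ≫ (α_ _ _ _).hom ≫ T.mul) ▷ Z := by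
        simp only [ext31, ext02]; monoidal
    _ = _ := by rw [T.left_loop]; monoidal

theorem right_loop_ext (Z : D) :
    T.carrier ◁ ext02 T.dual.cup Z ≫ ext31 T.mul Z = 𝟙 (T.carrier ⊗ Z) := by
  calc _ = ((ρ_ _).inv ≫ T.carrier ◁ T.dual.cup ≫ T.mul) ▷ Z := by
        simp only [ext31, ext02]; monoidal
    _ = _ := by rw [T.right_loop]; monoidal

theorem comulRight_ext (Z : D) : ext13 (dag T.mul) Z =
    T.carrier ◁ ext02 T.dual.cup Z ≫ T.carrier ◁ T.dual.star ◁ ext02 T.dual.cup' (T.carrier ⊗ Z) ≫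
      ext31 T.mul (T.dual.star ⊗ (T.carrier ⊗ Z)) := by
  rw [← T.dagger_symmetry]
  simp only [ext13, ext02, ext31, comulRight]
  monoidal

theorem comulLeft_ext (Z : D) : ext13 (dag T.mul) Z =
    ext02 T.dual.cup' (T.carrier ⊗ Z) ≫
      T.carrier ◁ ext02 T.dual.cup (T.dual.star ⊗ (T.carrier ⊗ Z)) ≫
      T.carrier ◁ T.dual.star ◁ ext31 T.mul Z := by
  rw [← T.dagger_symmetry, T.symmetry]
  simp only [ext13, ext02, ext31, comulLeft]
  monoidal

/-- The map `x* ⊗ y ↦ ∑ z* ⊗ [z, x, y]` on `A* ⊗ A`.  Under the identification of `A* ⊗ A`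
with endomorphisms of `A` it is the projection onto the right multiplications
`z ↦ [z, x, y]`. -/
def rightProjection : T.dual.star ⊗ T.carrier ⟶ T.dual.star ⊗ T.carrier :=
  ext02 T.dual.cup (T.dual.star ⊗ T.carrier) ≫ T.dual.star ◁ T.mul

theorem rightProjection_ext (Z : D) : ext22 T.rightProjection Z =
    ext02 T.dual.cup (T.dual.star ⊗ (T.carrier ⊗ Z)) ≫ T.dual.star ◁ ext31 T.mul Z := by
  simp only [rightProjection, ext22, ext02, ext31]
  monoidal

theorem comul_eq_rightProjection (Z : D) : ext13 (dag T.mul) Z =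
    ext02 T.dual.cup' (T.carrier ⊗ Z) ≫ T.carrier ◁ ext22 T.rightProjection Z := by
  rw [comulLeft_ext, rightProjection_ext, whiskerLeft_comp]

theorem cup_rightProjection (Z : D) :
    ext02 T.dual.cup Z ≫ ext22 T.rightProjection Z = ext02 T.dual.cup Z := by
  rw [rightProjection_ext, reassoc_of% (ext02_natural (ext02 T.dual.cup Z) T.dual.cup),
    ← whiskerLeft_comp, right_loop_ext, whiskerLeft_id, Category.comp_id]

/-- The triple product absorbs the right projection. -/
theorem whiskerLeft_rightProjection_mul (Z : D) :
    T.carrier ◁ ext22 T.rightProjection Z ≫ ext31 T.mul Z = ext31 T.mul Z := by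
  rw [rightProjection_ext, whiskerLeft_comp, Category.assoc, assoc_ext,
    reassoc_of% (T.right_loop_ext (T.dual.star ⊗ (T.carrier ⊗ Z)))]

theorem mul_rightProjection (Z : D) :
    T.dual.star ◁ ext31 T.mul Z ≫ ext22 T.rightProjection Z =
      ext22 T.rightProjection (T.dual.star ⊗ (T.carrier ⊗ Z)) ≫ T.dual.star ◁ ext31 T.mul Z := by
  rw [rightProjection_ext, rightProjection_ext, Category.assoc, ← whiskerLeft_comp, ← assoc_ext,
    whiskerLeft_comp, reassoc_of% (ext02_natural (T.dual.star ◁ ext31 T.mul Z) T.dual.cup)]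

theorem rightProjection_idempotent (Z : D) :
    ext22 T.rightProjection Z ≫ ext22 T.rightProjection Z = ext22 T.rightProjection Z := by
  conv_lhs => arg 1; rw [rightProjection_ext]
  rw [Category.assoc, mul_rightProjection, reassoc_of% (T.cup_rightProjection _),
    ← rightProjection_ext]

theorem dag_rightProjection : dag T.rightProjection = T.rightProjection := by
  refine ext22_injective fun Z => ?_
  rw [← dag_ext22]
  conv_lhs => rw [rightProjection_ext]
  rw [dag_comp, dag_whiskerLeft, dag_ext31, comul_eq_rightProjection, dag_ext02,
    whiskerLeft_comp, Category.assoc, ext20_natural, T.dual.dag_cup,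
    reassoc_of% (T.dual.cup'_cap'_star (T.carrier ⊗ Z))]

theorem isDaggerIdempotent_rightProjection : IsDaggerIdempotent T.rightProjection := by
  rw [IsDaggerIdempotent, dag_rightProjection]
  refine ext22_injective fun Z => ?_
  have h : ext22 (T.rightProjection ≫ T.rightProjection) Z =
      ext22 T.rightProjection Z ≫ ext22 T.rightProjection Z := by
    simp [ext22]
  rw [h, rightProjection_idempotent]

/-- The right algebra of a 3-structure: a dagger splitting of the projection onto the right
multiplications.  For a space of operators `A` it is the span of the products `x* y`. -/
structure RightAlgebra where
  carrier : D
  incl : carrier ⟶ T.dual.star ⊗ T.carrier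
  isometry : IsIsometry incl
  split : T.rightProjection = dag incl ≫ incl

end NormalFrobenius3

namespace NormalFrobenius3.RightAlgebra

variable {D : Type u} [Category.{v} D] [MonoidalCategory D] [MonoidalDaggerCategory D]
  {T : NormalFrobenius3 D} (R : T.RightAlgebra)

theorem isometry_ext (Z : D) :
    ext12 R.incl Z ≫ ext21 (dag R.incl) Z = 𝟙 (R.carrier ⊗ Z) := by
  have h : R.incl ≫ dag R.incl = 𝟙 _ := R.isometry
  simp [ext12, ext21, ← comp_whiskerRight, h]

theorem split_ext (Z : D) :
    ext21 (dag R.incl) Z ≫ ext12 R.incl Z = ext22 T.rightProjection Z := by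
  simp [ext12, ext21, ext22, R.split]

theorem incl_rightProjection (Z : D) :
    ext12 R.incl Z ≫ ext22 T.rightProjection Z = ext12 R.incl Z := by
  rw [← split_ext, reassoc_of% (R.isometry_ext Z)]

theorem rightProjection_proj (Z : D) :
    ext22 T.rightProjection Z ≫ ext21 (dag R.incl) Z = ext21 (dag R.incl) Z := by
  rw [← split_ext, Category.assoc, R.isometry_ext Z, Category.comp_id]

/-- The right action `z ⊗ x* y ↦ [z, x, y]` of the right algebra. -/
def act : T.carrier ⊗ R.carrier ⟶ T.carrier := T.carrier ◁ R.incl ≫ T.mul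

theorem act_ext (Z : D) :
    ext21 R.act Z = T.carrier ◁ ext12 R.incl Z ≫ ext31 T.mul Z := by
  simp only [act, ext21, ext12, ext31]
  monoidal

theorem whiskerLeft_proj_act (Z : D) :
    T.carrier ◁ ext21 (dag R.incl) Z ≫ ext21 R.act Z = ext31 T.mul Z := by
  rw [act_ext, ← whiskerLeft_comp_assoc, split_ext, whiskerLeft_rightProjection_mul]

theorem coact_ext (Z : D) : ext12 (dag R.act) Z =
    ext02 T.dual.cup' (T.carrier ⊗ Z) ≫ T.carrier ◁ ext21 (dag R.incl) Z := by
  rw [← dag_ext21, act_ext, dag_comp, dag_whiskerLeft, dag_ext12, dag_ext31,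
    comul_eq_rightProjection, Category.assoc, ← whiskerLeft_comp, rightProjection_proj]

/-- The multiplication `(x* y)(z* w) = x* [y, z, w]`. -/
def mul : R.carrier ⊗ R.carrier ⟶ R.carrier :=
  ext12 R.incl R.carrier ≫ T.dual.star ◁ R.act ≫ dag R.incl

theorem mul_ext (Z : D) : ext21 R.mul Z =
    ext12 R.incl (R.carrier ⊗ Z) ≫ T.dual.star ◁ ext21 R.act Z ≫ ext21 (dag R.incl) Z := by
  simp only [mul, ext21, ext12]
  monoidal

/-- The unit of the right algebra, the image of the copairing `∑ x* ⊗ x`. -/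
def one : 𝟙_ D ⟶ R.carrier := T.dual.cup ≫ dag R.incl

theorem one_ext (Z : D) :
    ext01 R.one Z = ext02 T.dual.cup Z ≫ ext21 (dag R.incl) Z := by
  simp only [one, ext21, ext01, ext02]
  monoidal

theorem one_incl (Z : D) : ext01 R.one Z ≫ ext12 R.incl Z = ext02 T.dual.cup Z := by
  rw [one_ext, Category.assoc, split_ext, cup_rightProjection]

theorem act_rightProjection (Z : D) :
    T.dual.star ◁ ext21 R.act Z ≫ ext22 T.rightProjection Z =
      ext22 T.rightProjection (R.carrier ⊗ Z) ≫ T.dual.star ◁ ext21 R.act Z := by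
  rw [act_ext, whiskerLeft_comp, Category.assoc, mul_rightProjection,
    reassoc_of% (ext22_natural (ext12 R.incl Z) T.rightProjection)]

/-- The image of the right algebra in `A* ⊗ A` is closed under multiplication. -/
theorem mul_incl (Z : D) : ext21 R.mul Z ≫ ext12 R.incl Z =
    ext12 R.incl (R.carrier ⊗ Z) ≫ T.dual.star ◁ ext21 R.act Z := by
  rw [mul_ext, Category.assoc, Category.assoc, split_ext, act_rightProjection,
    reassoc_of% (R.incl_rightProjection _)]

theorem proj_mul (Z : D) : ext21 (dag R.incl) (R.carrier ⊗ Z) ≫ ext21 R.mul Z =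
    T.dual.star ◁ ext21 R.act Z ≫ ext21 (dag R.incl) Z := by
  rw [mul_ext, reassoc_of% (R.split_ext (R.carrier ⊗ Z)),
    ← reassoc_of% (R.act_rightProjection Z), rightProjection_proj]

theorem act_assoc_ext (Z : D) : ext21 R.act (R.carrier ⊗ Z) ≫ ext21 R.act Z =
    T.carrier ◁ ext21 R.mul Z ≫ ext21 R.act Z := by
  conv_rhs => rw [act_ext, ← whiskerLeft_comp_assoc, mul_incl, act_ext, whiskerLeft_comp,
    whiskerLeft_comp, whiskerLeft_comp, Category.assoc, Category.assoc, assoc_ext,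
    reassoc_of% (ext31_natural (ext12 R.incl Z) T.mul)]
  rw [act_ext, act_ext, Category.assoc]

theorem act_one_ext (Z : D) :
    T.carrier ◁ ext01 R.one Z ≫ ext21 R.act Z = 𝟙 (T.carrier ⊗ Z) := by
  rw [act_ext, ← whiskerLeft_comp_assoc, one_incl, right_loop_ext]

theorem act_coact_ext (Z : D) : ext21 R.act Z ≫ ext12 (dag R.act) Z =
    ext12 (dag R.act) (R.carrier ⊗ Z) ≫ T.carrier ◁ ext21 R.mul Z := by
  rw [coact_ext, coact_ext, Category.assoc, ← whiskerLeft_comp, proj_mul, whiskerLeft_comp,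
    reassoc_of% (ext02_natural (ext21 R.act Z) T.dual.cup')]

theorem coact_act_ext (Z : D) : ext12 (dag R.act) Z ≫ ext21 R.act Z = 𝟙 (T.carrier ⊗ Z) := by
  rw [coact_ext, Category.assoc, whiskerLeft_proj_act, left_loop_ext]

theorem comul_ext (Z : D) : ext12 (dag R.mul) Z = ext12 R.incl Z ≫
    T.dual.star ◁ ext12 (dag R.act) Z ≫ ext21 (dag R.incl) (R.carrier ⊗ Z) := by
  rw [← dag_ext21, mul_ext]
  simp [dag_ext12, dag_ext21]

/-- The right algebra as a dagger Frobenius monoid. -/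
@[reducible] def frobeniusMonoid : FrobeniusMonoid D :=
  .ofExt R.carrier R.mul R.one
    (fun Z => by
      rw [mul_ext, reassoc_of% (R.one_incl (R.carrier ⊗ Z)), act_ext, whiskerLeft_comp,
        Category.assoc, ← reassoc_of% (ext02_natural (ext12 R.incl Z) T.dual.cup),
        ← reassoc_of% (T.rightProjection_ext Z), rightProjection_proj, isometry_ext])
    (fun Z => by
      rw [mul_ext, reassoc_of% (ext12_natural (ext01 R.one Z) R.incl),
        reassoc_of% (whiskerLeft_of_comp_id T.dual.star (R.act_one_ext Z)), isometry_ext])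
    (fun Z => by
      conv_lhs => rw [mul_ext R Z, reassoc_of% (R.mul_incl (R.carrier ⊗ Z)),
        reassoc_of% (whiskerLeft_of_comm T.dual.star (R.act_assoc_ext Z)),
        ← reassoc_of% (ext12_natural (ext21 R.mul Z) R.incl), ← mul_ext])
    (fun Z => by
      -- both sides reduce to the Frobenius law of the action of the right algebra on `A`
      have h : ext12 (dag R.act) (R.carrier ⊗ Z) ≫ T.carrier ◁ ext21 R.mul Z =
          T.carrier ◁ ext12 (dag R.mul) Z ≫ ext21 R.act (R.carrier ⊗ Z) := by
        rw [← act_coact_ext]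
        simpa [dag_ext21, dag_ext12] using congrArg dag (R.act_coact_ext Z)
      rw [comul_ext R (R.carrier ⊗ Z), Category.assoc, Category.assoc,
        ← ext21_natural (ext21 R.mul Z) (dag R.incl),
        reassoc_of% (whiskerLeft_of_comm T.dual.star h), mul_ext R (R.carrier ⊗ Z),
        reassoc_of% (ext12_natural (ext12 (dag R.mul) Z) R.incl)])

theorem comul_mul : dag R.mul ≫ R.mul = 𝟙 R.carrier := by
  refine eq_of_whiskerRight_eq fun Z => ?_
  calc _ = ext12 (dag R.mul) Z ≫ ext21 R.mul Z := by simp [ext12, ext21]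
    _ = 𝟙 (R.carrier ⊗ Z) := by
      rw [comul_ext, mul_ext, Category.assoc, Category.assoc, reassoc_of% (R.split_ext _),
        ← reassoc_of% (R.act_rightProjection Z), rightProjection_proj,
        reassoc_of% (whiskerLeft_of_comp_id T.dual.star (R.coact_act_ext Z)), isometry_ext]
    _ = _ := by simp

end NormalFrobenius3.RightAlgebra

/-! ### Dagger modules -/

section

variable {D : Type u} [Category.{v} D] [MonoidalCategory D] [MonoidalDaggerCategory D]

namespace DaggerDual

variable {X R : D} (a : DaggerDual X) (act : X ⊗ R ⟶ X)

/-- The `R`-valued inner product `X* ⊗ X ⟶ R` of a right action `act : X ⊗ R ⟶ X`, obtained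
from the coaction `act†` by pairing its first leg with `X*`. -/
def inner : a.star ⊗ X ⟶ R := a.star ◁ dag act ≫ ext20 a.cap' R

/-- The left coaction `x* ↦ ∑ ⟨x, y⟩ ⊗ y*` on the dual of a right module. -/
def coactStar : a.star ⟶ R ⊗ a.star :=
  (ρ_ a.star).inv ≫ a.star ◁ a.cup' ≫ ext21 (a.inner act) a.star

theorem inner_ext (Z : D) : ext21 (a.inner act) Z =
    a.star ◁ ext12 (dag act) Z ≫ ext20 a.cap' (R ⊗ Z) := by
  simp only [inner, ext21, ext12, ext20]
  monoidal

theorem coactStar_ext (Z : D) : ext12 (a.coactStar act) Z =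
    a.star ◁ ext02 a.cup' Z ≫ ext21 (a.inner act) (a.star ⊗ Z) := by
  simp only [coactStar, ext21, ext12, ext02]
  monoidal

end DaggerDual

/-- A right module over a dagger Frobenius monoid `R`, on an object with a dagger dual.  The law
`act_coact` says that the action is compatible with the dagger, `coact_act` that it is
non-degenerate and normalized, and `symmetric` that the action on `X*` obtained from the chosen
dual through the inner product is a dagger action as well. -/
structure DaggerModule (R : FrobeniusMonoid D) where
  carrier : D
  dual : DaggerDual carrier
  act : carrier ⊗ R.carrier ⟶ carrier
  act_assoc : act ▷ R.carrier ≫ act = (α_ _ _ _).hom ≫ carrier ◁ R.mul ≫ act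
  act_one : carrier ◁ R.one ≫ act = (ρ_ carrier).hom
  act_coact : act ≫ dag act = dag act ▷ R.carrier ≫ (α_ _ _ _).hom ≫ carrier ◁ R.mul
  coact_act : dag act ≫ act = 𝟙 carrier
  symmetric : dual.coactStar act =
    ext02 R.cup dual.star ≫ R.carrier ◁ dag (dual.coactStar act)

namespace DaggerModule

variable {R : FrobeniusMonoid D}

/-- The laws of a dagger module may be checked on extensions. -/
@[reducible] def ofExt {X : D} (a : DaggerDual X) (act : X ⊗ R.carrier ⟶ X)
    (act_assoc : ∀ Z, ext21 act (R.carrier ⊗ Z) ≫ ext21 act Z = X ◁ ext21 R.mul Z ≫ ext21 act Z)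
    (act_one : ∀ Z, X ◁ ext01 R.one Z ≫ ext21 act Z = 𝟙 (X ⊗ Z))
    (act_coact : ∀ Z, ext21 act Z ≫ ext12 (dag act) Z =
      ext12 (dag act) (R.carrier ⊗ Z) ≫ X ◁ ext21 R.mul Z)
    (coact_act : ∀ Z, ext12 (dag act) Z ≫ ext21 act Z = 𝟙 (X ⊗ Z))
    (symmetric : ∀ Z, ext12 (a.coactStar act) Z =
      ext02 R.cup (a.star ⊗ Z) ≫ R.carrier ◁ ext21 (dag (a.coactStar act)) Z) :
    DaggerModule R where
  carrier := X
  dual := a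
  act := act
  act_assoc := by
    refine eq_of_whiskerRight_eq fun Z => ?_
    calc _ = (α_ _ _ _).hom ≫ (α_ _ _ _).hom ≫ ext21 act (R.carrier ⊗ Z) ≫ ext21 act Z := by
          simp only [ext21]; monoidal
      _ = _ := by rw [act_assoc]; simp only [ext21]; monoidal
  act_one := by
    refine eq_of_whiskerRight_eq fun Z => ?_
    calc _ = (ρ_ X).hom ▷ Z ≫ X ◁ ext01 R.one Z ≫ ext21 act Z := by
          simp only [ext01, ext21]; monoidal
      _ = _ := by rw [act_one]; simp
  act_coact := by
    refine eq_of_whiskerRight_eq fun Z => ?_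
    calc _ = (α_ _ _ _).hom ≫ (ext21 act Z ≫ ext12 (dag act) Z) ≫ (α_ _ _ _).inv := by
          simp only [ext12, ext21]; monoidal
      _ = _ := by rw [act_coact]; simp only [ext12, ext21]; monoidal
  coact_act := by
    refine eq_of_whiskerRight_eq fun Z => ?_
    calc _ = ext12 (dag act) Z ≫ ext21 act Z := by simp [ext12, ext21]
      _ = _ := by rw [coact_act]; simp
  symmetric := by
    refine eq_of_whiskerRight_eq fun Z => ?_
    calc _ = ext12 (a.coactStar act) Z ≫ (α_ _ _ _).inv := by simp [ext12]
      _ = _ := by rw [symmetric]; simp only [ext02, ext21]; monoidal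

variable (X : DaggerModule R)

/-- The inner product of a dagger module. -/
def inner : X.dual.star ⊗ X.carrier ⟶ R.carrier := X.dual.inner X.act

/-- The left coaction on the dual of a dagger module. -/
def coactStar : X.dual.star ⟶ R.carrier ⊗ X.dual.star := X.dual.coactStar X.act

theorem inner_ext (Z : D) : ext21 X.inner Z =
    X.dual.star ◁ ext12 (dag X.act) Z ≫ ext20 X.dual.cap' (R.carrier ⊗ Z) :=
  X.dual.inner_ext X.act Z

theorem coactStar_ext (Z : D) : ext12 X.coactStar Z =
    X.dual.star ◁ ext02 X.dual.cup' Z ≫ ext21 X.inner (X.dual.star ⊗ Z) :=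
  X.dual.coactStar_ext X.act Z

theorem act_assoc_ext (Z : D) : ext21 X.act (R.carrier ⊗ Z) ≫ ext21 X.act Z =
    X.carrier ◁ ext21 R.mul Z ≫ ext21 X.act Z := by
  calc _ = (α_ _ _ _).inv ≫ (α_ _ _ _).inv ≫ (X.act ▷ R.carrier ≫ X.act) ▷ Z := by
        simp only [ext21]; monoidal
    _ = _ := by rw [X.act_assoc]; simp only [ext21]; monoidal

theorem act_one_ext (Z : D) :
    X.carrier ◁ ext01 R.one Z ≫ ext21 X.act Z = 𝟙 (X.carrier ⊗ Z) := by
  calc _ = (ρ_ X.carrier).inv ▷ Z ≫ (X.carrier ◁ R.one ≫ X.act) ▷ Z := by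
        simp only [ext01, ext21]; monoidal
    _ = _ := by rw [X.act_one]; monoidal

theorem act_coact_ext (Z : D) : ext21 X.act Z ≫ ext12 (dag X.act) Z =
    ext12 (dag X.act) (R.carrier ⊗ Z) ≫ X.carrier ◁ ext21 R.mul Z := by
  calc _ = (α_ _ _ _).inv ≫ (X.act ≫ dag X.act) ▷ Z ≫ (α_ _ _ _).hom := by
        simp only [ext21, ext12]; monoidal
    _ = _ := by rw [X.act_coact]; simp only [ext21, ext12]; monoidal

theorem coact_act_ext (Z : D) :
    ext12 (dag X.act) Z ≫ ext21 X.act Z = 𝟙 (X.carrier ⊗ Z) := by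
  simp [ext12, ext21, ← comp_whiskerRight, X.coact_act]

theorem symmetric_ext (Z : D) : ext12 X.coactStar Z =
    ext02 R.cup (X.dual.star ⊗ Z) ≫ R.carrier ◁ ext21 (dag X.coactStar) Z := by
  calc _ = X.coactStar ▷ Z ≫ (α_ _ _ _).hom := rfl
    _ = _ := by
      have h : X.coactStar = ext02 R.cup X.dual.star ≫ R.carrier ◁ dag X.coactStar := X.symmetric
      conv_lhs => rw [h]
      simp only [ext21, ext02]; monoidal

/-- The coaction bends into the action along the copairing of `R`. -/
theorem coact_eq_cup_act (Z : D) : ext12 (dag X.act) Z =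
    X.carrier ◁ ext02 R.cup Z ≫ ext21 X.act (R.carrier ⊗ Z) := by
  have h : ext21 X.act Z ≫ ext12 (dag X.act) Z =
      X.carrier ◁ ext12 (dag R.mul) Z ≫ ext21 X.act (R.carrier ⊗ Z) := by
    simpa [dag_ext21, dag_ext12] using congrArg dag (X.act_coact_ext Z)
  rw [R.ext02_cup, whiskerLeft_comp, Category.assoc, ← h, reassoc_of% (X.act_one_ext Z)]

/-- The coaction is `x ↦ ∑ y ⊗ ⟨y, x⟩`. -/
theorem coact_eq_cup'_inner (Z : D) : ext12 (dag X.act) Z =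
    ext02 X.dual.cup' (X.carrier ⊗ Z) ≫ X.carrier ◁ ext21 X.inner Z := by
  rw [X.inner_ext, whiskerLeft_comp,
    ← reassoc_of% (ext02_natural (ext12 (dag X.act) Z) X.dual.cup'), X.dual.cup'_cap',
    Category.comp_id]

/-- The inner product is linear in its second argument. -/
theorem inner_mul (Z : D) : ext21 X.inner (R.carrier ⊗ Z) ≫ ext21 R.mul Z =
    X.dual.star ◁ ext21 X.act Z ≫ ext21 X.inner Z := by
  rw [X.inner_ext, X.inner_ext, Category.assoc, ← ext20_natural,
    reassoc_of% (whiskerLeft_of_comm X.dual.star (X.act_coact_ext Z))]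

/-! ### The left algebra of a dagger module -/

/-- The map `x ⊗ y* ↦ ∑ x ⟨y, z⟩ ⊗ z*` on `X ⊗ X*`, the projection of the endomorphisms of `X`
onto the `R`-linear ones. -/
def leftProjection : X.carrier ⊗ X.dual.star ⟶ X.carrier ⊗ X.dual.star :=
  X.carrier ◁ X.coactStar ≫ ext21 X.act X.dual.star

theorem leftProjection_ext (Z : D) : ext22 X.leftProjection Z =
    X.carrier ◁ ext12 X.coactStar Z ≫ ext21 X.act (X.dual.star ⊗ Z) := by
  simp only [leftProjection, ext22, ext12, ext21]
  monoidal

theorem cup'_leftProjection (Z : D) :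
    ext02 X.dual.cup' Z ≫ ext22 X.leftProjection Z = ext02 X.dual.cup' Z := by
  rw [leftProjection_ext, X.coactStar_ext, whiskerLeft_comp, Category.assoc,
    ← reassoc_of% (ext02_natural (ext02 X.dual.cup' Z) X.dual.cup'),
    ← reassoc_of% (X.coact_eq_cup'_inner (X.dual.star ⊗ Z)), coact_act_ext, Category.comp_id]

theorem coactStar_coactStar (Z : D) : ext12 X.coactStar Z ≫ R.carrier ◁ ext12 X.coactStar Z ≫
    ext21 R.mul (X.dual.star ⊗ Z) = ext12 X.coactStar Z := by
  conv_lhs => arg 1; rw [X.coactStar_ext]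
  rw [Category.assoc,
    ← reassoc_of% (ext21_natural (ext12 X.coactStar Z) X.inner), inner_mul,
    reassoc_of% (whiskerLeft_of_comp X.dual.star (X.leftProjection_ext Z).symm),
    reassoc_of% (whiskerLeft_of_comp X.dual.star (X.cup'_leftProjection Z)),
    ← X.coactStar_ext]

theorem leftProjection_act (Z : D) : ext22 X.leftProjection (X.carrier ⊗ Z) ≫
      X.carrier ◁ ext20 X.dual.cap' Z = X.carrier ◁ ext21 X.inner Z ≫ ext21 X.act Z := by
  have h : ext12 X.coactStar (X.carrier ⊗ Z) ≫ R.carrier ◁ ext20 X.dual.cap' Z =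
      ext21 X.inner Z := by
    rw [X.coactStar_ext, Category.assoc, ← ext21_natural,
      reassoc_of% (whiskerLeft_of_comp_id X.dual.star (X.dual.cup'_cap' Z))]
  rw [leftProjection_ext, Category.assoc, ← ext21_natural,
    reassoc_of% (whiskerLeft_of_comp X.carrier h)]

theorem leftProjection_idempotent (Z : D) :
    ext22 X.leftProjection Z ≫ ext22 X.leftProjection Z = ext22 X.leftProjection Z := by
  rw [leftProjection_ext, Category.assoc, ← reassoc_of% (ext21_natural (ext12 X.coactStar Z) X.act),
    act_assoc_ext, ← whiskerLeft_comp_assoc, ← whiskerLeft_comp_assoc, Category.assoc,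
    coactStar_coactStar]

theorem dag_leftProjection : dag X.leftProjection = X.leftProjection := by
  refine ext22_injective fun Z => ?_
  rw [← dag_ext22, leftProjection_ext, dag_comp, dag_whiskerLeft, dag_ext12, dag_ext21,
    coact_eq_cup_act, Category.assoc, ← ext21_natural, ← whiskerLeft_comp_assoc,
    ← symmetric_ext]

theorem isDaggerIdempotent_leftProjection : IsDaggerIdempotent X.leftProjection := by
  rw [IsDaggerIdempotent, dag_leftProjection]
  refine ext22_injective fun Z => ?_
  have h : ext22 (X.leftProjection ≫ X.leftProjection) Z =
      ext22 X.leftProjection Z ≫ ext22 X.leftProjection Z := by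
    simp [ext22]
  rw [h, leftProjection_idempotent]

/-- A map of the form `f : Y ⊗ X ⟶ X` that is `R`-linear commutes with the projection onto
`R`-linear endomorphisms. -/
theorem leftProjection_comm {Y : D} {f : ∀ Z, Y ⊗ (X.carrier ⊗ Z) ⟶ X.carrier ⊗ Z}
    (natural : ∀ {Z Z' : D} (k : Z ⟶ Z'), Y ◁ X.carrier ◁ k ≫ f Z' = f Z ≫ X.carrier ◁ k)
    (linear : ∀ Z, Y ◁ ext21 X.act Z ≫ f Z = f (R.carrier ⊗ Z) ≫ ext21 X.act Z) (Z : D) :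
    Y ◁ ext22 X.leftProjection Z ≫ f (X.dual.star ⊗ Z) =
      f (X.dual.star ⊗ Z) ≫ ext22 X.leftProjection Z := by
  rw [leftProjection_ext, whiskerLeft_comp, Category.assoc, linear,
    reassoc_of% (natural (ext12 X.coactStar Z))]

/-- The left algebra of a module: a dagger splitting of the projection onto the `R`-linear
endomorphisms. -/
structure LeftAlgebra where
  carrier : D
  incl : carrier ⟶ X.carrier ⊗ X.dual.star
  isometry : IsIsometry incl
  split : X.leftProjection = dag incl ≫ incl

end DaggerModule

namespace DaggerModule.LeftAlgebra

variable {R : FrobeniusMonoid D} {X : DaggerModule R} (B : X.LeftAlgebra)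

theorem isometry_ext (Z : D) :
    ext12 B.incl Z ≫ ext21 (dag B.incl) Z = 𝟙 (B.carrier ⊗ Z) := by
  have h : B.incl ≫ dag B.incl = 𝟙 _ := B.isometry
  simp [ext12, ext21, ← comp_whiskerRight, h]

theorem split_ext (Z : D) :
    ext21 (dag B.incl) Z ≫ ext12 B.incl Z = ext22 X.leftProjection Z := by
  simp [ext12, ext21, ext22, B.split]

theorem incl_leftProjection (Z : D) :
    ext12 B.incl Z ≫ ext22 X.leftProjection Z = ext12 B.incl Z := by
  rw [← split_ext, reassoc_of% (B.isometry_ext Z)]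

theorem leftProjection_proj (Z : D) :
    ext22 X.leftProjection Z ≫ ext21 (dag B.incl) Z = ext21 (dag B.incl) Z := by
  rw [← split_ext, Category.assoc, B.isometry_ext Z, Category.comp_id]

/-- The action of the left algebra on the module by endomorphisms. -/
def apply : B.carrier ⊗ X.carrier ⟶ X.carrier :=
  ext12 B.incl X.carrier ≫ X.carrier ◁ X.dual.cap' ≫ (ρ_ X.carrier).hom

theorem apply_ext (Z : D) : ext21 B.apply Z =
    ext12 B.incl (X.carrier ⊗ Z) ≫ X.carrier ◁ ext20 X.dual.cap' Z := by
  simp only [apply, ext21, ext12, ext20]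
  monoidal

theorem apply_ext_inner (Z : D) : ext21 B.apply Z =
    ext12 B.incl (X.carrier ⊗ Z) ≫ X.carrier ◁ ext21 X.inner Z ≫ ext21 X.act Z := by
  rw [← leftProjection_act, reassoc_of% (B.incl_leftProjection _), apply_ext]

theorem act_apply (Z : D) : B.carrier ◁ ext21 X.act Z ≫ ext21 B.apply Z =
    ext21 B.apply (R.carrier ⊗ Z) ≫ ext21 X.act Z := by
  rw [apply_ext_inner, apply_ext_inner, Category.assoc, Category.assoc, act_assoc_ext,
    reassoc_of% (whiskerLeft_of_comm X.carrier (X.inner_mul Z)),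
    reassoc_of% (ext12_natural (ext21 X.act Z) B.incl)]

theorem leftProjection_apply (Z : D) :
    B.carrier ◁ ext22 X.leftProjection Z ≫ ext21 B.apply (X.dual.star ⊗ Z) =
      ext21 B.apply (X.dual.star ⊗ Z) ≫ ext22 X.leftProjection Z :=
  X.leftProjection_comm (f := ext21 B.apply) (fun k => ext21_natural k B.apply) B.act_apply Z

/-- Composition of endomorphisms. -/
def mul : B.carrier ⊗ B.carrier ⟶ B.carrier :=
  B.carrier ◁ B.incl ≫ ext21 B.apply X.dual.star ≫ dag B.incl

theorem mul_ext (Z : D) : ext21 B.mul Z = B.carrier ◁ ext12 B.incl Z ≫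
    ext21 B.apply (X.dual.star ⊗ Z) ≫ ext21 (dag B.incl) Z := by
  simp only [mul, ext21, ext12]
  monoidal

/-- The identity endomorphism. -/
def one : 𝟙_ D ⟶ B.carrier := X.dual.cup' ≫ dag B.incl

theorem one_ext (Z : D) :
    ext01 B.one Z = ext02 X.dual.cup' Z ≫ ext21 (dag B.incl) Z := by
  simp only [one, ext21, ext01, ext02]
  monoidal

theorem one_incl (Z : D) : ext01 B.one Z ≫ ext12 B.incl Z = ext02 X.dual.cup' Z := by
  rw [one_ext, Category.assoc, split_ext, cup'_leftProjection]

theorem mul_incl (Z : D) : ext21 B.mul Z ≫ ext12 B.incl Z =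
    B.carrier ◁ ext12 B.incl Z ≫ ext21 B.apply (X.dual.star ⊗ Z) := by
  rw [mul_ext, Category.assoc, Category.assoc, split_ext, ← leftProjection_apply,
    ← whiskerLeft_comp_assoc, B.incl_leftProjection]

theorem proj_mul (Z : D) : B.carrier ◁ ext21 (dag B.incl) Z ≫ ext21 B.mul Z =
    ext21 B.apply (X.dual.star ⊗ Z) ≫ ext21 (dag B.incl) Z := by
  rw [mul_ext, ← whiskerLeft_comp_assoc, split_ext, reassoc_of% (B.leftProjection_apply Z),
    leftProjection_proj]

theorem mul_apply (Z : D) : ext21 B.mul (X.carrier ⊗ Z) ≫ ext21 B.apply Z =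
    B.carrier ◁ ext21 B.apply Z ≫ ext21 B.apply Z := by
  conv_lhs => rw [apply_ext, reassoc_of% (B.mul_incl (X.carrier ⊗ Z)), ← ext21_natural,
    ← whiskerLeft_comp_assoc, ← apply_ext]

theorem one_apply (Z : D) :
    ext01 B.one (X.carrier ⊗ Z) ≫ ext21 B.apply Z = 𝟙 (X.carrier ⊗ Z) := by
  rw [apply_ext, reassoc_of% (B.one_incl (X.carrier ⊗ Z)), X.dual.cup'_cap']

theorem comul_ext (Z : D) : ext12 (dag B.mul) Z = ext12 B.incl Z ≫
    ext12 (dag B.apply) (X.dual.star ⊗ Z) ≫ B.carrier ◁ ext21 (dag B.incl) Z := by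
  rw [← dag_ext21, mul_ext]
  simp [dag_ext12, dag_ext21]

theorem dag_apply_ext (Z : D) : ext12 (dag B.apply) Z =
    X.carrier ◁ ext02 X.dual.cup Z ≫ ext21 (dag B.incl) (X.carrier ⊗ Z) := by
  rw [← dag_ext21, apply_ext]
  simp [dag_ext12, dag_ext20, X.dual.dag_cap']

/-- The left algebra of a module as a dagger Frobenius monoid. -/
@[reducible] def frobeniusMonoid : FrobeniusMonoid D :=
  .ofExt B.carrier B.mul B.one
    (fun Z => by
      rw [mul_ext, ← reassoc_of% (ext01_natural (ext12 B.incl Z) B.one),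
        reassoc_of% (B.one_apply (X.dual.star ⊗ Z)), isometry_ext])
    (fun Z => by
      rw [one_ext, whiskerLeft_comp, Category.assoc, proj_mul, apply_ext, Category.assoc,
        reassoc_of% (ext12_natural (ext02 X.dual.cup' Z) B.incl),
        reassoc_of% (whiskerLeft_of_comp_id X.carrier (X.dual.cup'_cap'_star Z)), isometry_ext])
    (fun Z => by
      conv_lhs => rw [mul_ext B Z, ← reassoc_of% (ext21_natural (ext12 B.incl Z) B.mul),
        reassoc_of% (B.mul_apply (X.dual.star ⊗ Z))]
      conv_rhs => rw [mul_ext B Z, ← whiskerLeft_comp_assoc, Category.assoc, Category.assoc,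
        split_ext, ← leftProjection_apply, ← whiskerLeft_comp_assoc, B.incl_leftProjection,
        whiskerLeft_comp, Category.assoc])
    (fun Z => by
      -- both sides are the compression of a self-adjoint map of `X ⊗ X* ⊗ X ⊗ X*`
      have h : B.carrier ◁ ext12 (dag B.mul) Z ≫ ext21 B.mul (B.carrier ⊗ Z) =
          ext12 B.incl (B.carrier ⊗ Z) ≫ X.carrier ◁ X.dual.star ◁ ext12 B.incl Z ≫
            X.carrier ◁ (ext20 X.dual.cap' (X.dual.star ⊗ Z) ≫
              ext02 X.dual.cup (X.dual.star ⊗ Z)) ≫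
            ext21 (dag B.incl) (X.carrier ⊗ (X.dual.star ⊗ Z)) ≫
            B.carrier ◁ ext21 (dag B.incl) Z := by
        rw [comul_ext, dag_apply_ext, ← ext20_natural, whiskerLeft_comp X.carrier]
        simp only [Category.assoc]
        rw [← reassoc_of% (ext12_natural (ext12 B.incl Z) B.incl),
          ← reassoc_of% (ext12_natural (X.carrier ◁ ext02 X.dual.cup (X.dual.star ⊗ Z)) B.incl),
          ← reassoc_of% (B.apply_ext (X.dual.star ⊗ (X.carrier ⊗ (X.dual.star ⊗ Z)))),
          ← reassoc_of% (B.proj_mul (X.carrier ⊗ (X.dual.star ⊗ Z))),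
          ← ext21_natural (ext21 (dag B.incl) Z) B.mul]
        simp only [whiskerLeft_comp, Category.assoc]
      have h' := congrArg dag h
      simp only [dag_comp, dag_whiskerLeft, dag_ext12, dag_ext21, dag_ext20, dag_ext02, dag_dag,
        X.dual.dag_cap', X.dual.dag_cup, Category.assoc] at h'
      rw [h, h', ← reassoc_of% (ext12_natural (ext12 B.incl Z) B.incl),
        ext21_natural (ext21 (dag B.incl) Z) (dag B.incl)])

theorem comul_mul (h : ∀ Z, ext02 X.dual.cup Z ≫ ext21 X.inner Z = ext01 R.one Z) :
    dag B.mul ≫ B.mul = 𝟙 B.carrier := by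
  refine eq_of_whiskerRight_eq fun Z => ?_
  calc _ = ext12 (dag B.mul) Z ≫ ext21 B.mul Z := by simp [ext12, ext21]
    _ = 𝟙 (B.carrier ⊗ Z) := by
      rw [comul_ext, Category.assoc, Category.assoc, proj_mul, dag_apply_ext, Category.assoc,
        apply_ext, Category.assoc, reassoc_of% (B.split_ext _),
        reassoc_of% (X.leftProjection_act _),
        reassoc_of% (whiskerLeft_of_comp X.carrier (h _)), reassoc_of% (X.act_one_ext _),
        isometry_ext]
    _ = _ := by simp

end DaggerModule.LeftAlgebra

end

/-! ### The modules `A` and `R` over the right algebra -/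

namespace FrobeniusMonoid

variable {D : Type u} [Category.{v} D] [MonoidalCategory D] [MonoidalDaggerCategory D]
  (R : FrobeniusMonoid D)

theorem inner_mul_ext (Z : D) : ext21 (R.selfDual.inner R.mul) Z = ext21 R.mul Z := by
  rw [R.selfDual.inner_ext, selfDual_cap', ext20_cap]
  change R.carrier ◁ ext12 (dag R.mul) Z ≫ ext21 R.mul (R.carrier ⊗ Z) ≫ _ = _
  rw [reassoc_of% (R.frobenius_ext Z), ← reassoc_of% (R.mul_comul_ext Z), R.comul_counit_ext,
    Category.comp_id]

theorem inner_mul : R.selfDual.inner R.mul = R.mul :=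
  eq_of_whiskerRight_eq fun Z => (cancel_epi _).1 (R.inner_mul_ext Z)

theorem coactStar_mul : R.selfDual.coactStar R.mul = dag R.mul := by
  refine eq_of_whiskerRight_eq fun Z => ?_
  have h : ext12 (R.selfDual.coactStar R.mul) Z = ext12 (dag R.mul) Z := by
    rw [R.selfDual.coactStar_ext, inner_mul_ext, selfDual_cup']
    exact R.whiskerLeft_cup_mul Z
  exact (cancel_mono _).1 h

/-- A special dagger Frobenius monoid is a dagger module over itself. -/
@[reducible] def selfModule (special : dag R.mul ≫ R.mul = 𝟙 R.carrier) : DaggerModule R :=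
  .ofExt R.selfDual R.mul R.mul_assoc_ext R.mul_one_ext R.mul_comul_ext
    (fun Z => by simp [ext12, ext21, ← comp_whiskerRight, special])
    (fun Z => by
      rw [coactStar_mul, dag_dag]
      exact (R.cup_whiskerLeft_mul Z).symm)

end FrobeniusMonoid

namespace NormalFrobenius3.RightAlgebra

variable {D : Type u} [Category.{v} D] [MonoidalCategory D] [MonoidalDaggerCategory D]
  {T : NormalFrobenius3 D} (R : T.RightAlgebra)

theorem inner_act_ext (Z : D) : ext21 (T.dual.inner R.act) Z = ext21 (dag R.incl) Z := by
  rw [T.dual.inner_ext, coact_ext, whiskerLeft_comp, Category.assoc, ext20_natural,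
    reassoc_of% (T.dual.cup'_cap'_star (T.carrier ⊗ Z))]

theorem coactStar_act_ext (Z : D) : ext12 (T.dual.coactStar R.act) Z =
    T.dual.star ◁ ext02 T.dual.cup' Z ≫ ext21 (dag R.incl) (T.dual.star ⊗ Z) := by
  rw [T.dual.coactStar_ext, inner_act_ext]

theorem cup_ext (Z : D) : ext01 R.one Z ≫ ext12 (dag R.mul) Z = ext02 T.dual.cup Z ≫
    T.dual.star ◁ ext12 (dag R.act) Z ≫ ext21 (dag R.incl) (R.carrier ⊗ Z) := by
  rw [comul_ext, reassoc_of% (R.one_incl Z)]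

/-- The left coaction on `A*` is a dagger action.  This is the only law of the right algebra and of
its action which uses the expression for `μ†` bent to the right. -/
theorem symmetric_ext (Z : D) : ext12 (T.dual.coactStar R.act) Z =
    ext01 R.one (T.dual.star ⊗ Z) ≫ ext12 (dag R.mul) (T.dual.star ⊗ Z) ≫
      R.carrier ◁ ext21 (dag (T.dual.coactStar R.act)) Z := by
  have hd : ext21 (dag (T.dual.coactStar R.act)) Z =
      ext12 R.incl (T.dual.star ⊗ Z) ≫ T.dual.star ◁ ext20 T.dual.cap Z := by
    rw [← dag_ext12, coactStar_act_ext]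
    simp [dag_ext21, dag_ext02, T.dual.dag_cup']
  -- the comultiplication of `A` with its last leg capped off, computed by bending to the right
  have hc : ext13 (dag T.mul) (T.dual.star ⊗ Z) ≫
      T.carrier ◁ T.dual.star ◁ ext20 T.dual.cap Z =
        T.carrier ◁ T.dual.star ◁ ext02 T.dual.cup' Z ≫ ext31 T.mul (T.dual.star ⊗ Z) := by
    rw [comulRight_ext, Category.assoc, Category.assoc, ← ext31_natural, ← whiskerLeft_comp_assoc _
      (T.dual.star ◁ ext02 _ _), ← whiskerLeft_comp, ← ext02_natural, whiskerLeft_comp,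
      whiskerLeft_comp, Category.assoc, ← whiskerLeft_comp_assoc, T.dual.cup_cap_star,
      whiskerLeft_id, Category.id_comp]
  have hl : ext12 (dag R.act) (T.dual.star ⊗ Z) ≫
      T.carrier ◁ ext21 (dag (T.dual.coactStar R.act)) Z =
        T.carrier ◁ T.dual.star ◁ ext02 T.dual.cup' Z ≫ ext31 T.mul (T.dual.star ⊗ Z) := by
    rw [coact_ext, hd, whiskerLeft_comp, Category.assoc,
      reassoc_of% (whiskerLeft_of_comp T.carrier (R.split_ext (T.dual.star ⊗ Z))),
      ← reassoc_of% (T.comul_eq_rightProjection (T.dual.star ⊗ Z)), hc]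
  rw [reassoc_of% (R.cup_ext (T.dual.star ⊗ Z)), ← ext21_natural,
    reassoc_of% (whiskerLeft_of_comm T.dual.star hl),
    ← reassoc_of% (ext02_natural (T.dual.star ◁ ext02 T.dual.cup' Z) T.dual.cup),
    ← reassoc_of% (T.rightProjection_ext (T.dual.star ⊗ Z)), rightProjection_proj,
    coactStar_act_ext]

/-- `A` as a dagger module over its right algebra. -/
@[reducible] def module : DaggerModule R.frobeniusMonoid :=
  .ofExt T.dual R.act R.act_assoc_ext R.act_one_ext R.act_coact_ext R.coact_act_ext fun Z => by
    rw [FrobeniusMonoid.ext02_cup, Category.assoc]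
    exact R.symmetric_ext Z

/-- The right algebra as a dagger module over itself. -/
@[reducible] def selfModule : DaggerModule R.frobeniusMonoid :=
  R.frobeniusMonoid.selfModule R.comul_mul

end NormalFrobenius3.RightAlgebra

/-! ### Orthogonal summands of dagger modules -/

section Summand

variable {D : Type u} [Category.{v} D] [MonoidalCategory D] [MonoidalDaggerCategory D]

/-- Isometries `κ : X ⟶ C` and `σ : X* ⟶ C*` which are compatible with the dagger duals, in the
sense that `σ` and `κ†` are mates as well as `κ` and `σ†`, and such that `κ` and `κ†` are linear
for right actions of `R`. -/
structure IsSummand {X C R : D} (a : DaggerDual X) (c : DaggerDual C) (act : X ⊗ R ⟶ X)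
    (act' : C ⊗ R ⟶ C) (κ : X ⟶ C) (σ : a.star ⟶ c.star) : Prop where
  isometry : κ ≫ dag κ = 𝟙 X
  star_isometry : σ ≫ dag σ = 𝟙 a.star
  whiskerRight_cap : κ ▷ c.star ≫ c.cap = X ◁ dag σ ≫ a.cap
  whiskerLeft_cap : C ◁ σ ≫ c.cap = dag κ ▷ a.star ≫ a.cap
  act_incl : κ ▷ R ≫ act' = act ≫ κ
  act_proj : act' ≫ dag κ = dag κ ▷ R ≫ act

namespace IsSummand

variable {X C R : D} {a : DaggerDual X} {c : DaggerDual C} {act : X ⊗ R ⟶ X}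
  {act' : C ⊗ R ⟶ C} {κ : X ⟶ C} {σ : a.star ⟶ c.star} (h : IsSummand a c act act' κ σ)
include h

theorem incl_cap (Z : D) : κ ▷ (c.star ⊗ Z) ≫ ext20 c.cap Z =
    X ◁ (dag σ ▷ Z) ≫ ext20 a.cap Z := by
  calc _ = (α_ _ _ _).inv ≫ (κ ▷ c.star ≫ c.cap) ▷ Z ≫ (λ_ Z).hom := by
        simp only [ext20]; monoidal
    _ = _ := by rw [h.whiskerRight_cap]; simp only [ext20]; monoidal

theorem starIncl_cap (Z : D) : C ◁ (σ ▷ Z) ≫ ext20 c.cap Z =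
    dag κ ▷ (a.star ⊗ Z) ≫ ext20 a.cap Z := by
  calc _ = (α_ _ _ _).inv ≫ (C ◁ σ ≫ c.cap) ▷ Z ≫ (λ_ Z).hom := by
        simp only [ext20]; monoidal
    _ = _ := by rw [h.whiskerLeft_cap]; simp only [ext20]; monoidal

theorem cup_starProj (Z : D) : ext02 c.cup Z ≫ dag σ ▷ (C ⊗ Z) =
    ext02 a.cup Z ≫ a.star ◁ (κ ▷ Z) := by
  have hσ : dag σ ▷ (C ⊗ Z) = ext02 a.cup (c.star ⊗ (C ⊗ Z)) ≫ a.star ◁ κ ▷ (c.star ⊗ (C ⊗ Z)) ≫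
      a.star ◁ ext20 c.cap (C ⊗ Z) := by
    rw [whiskerLeft_of_comm a.star (h.incl_cap (C ⊗ Z)),
      ← reassoc_of% (ext02_natural (dag σ ▷ (C ⊗ Z)) a.cup), a.cup_cap_star, Category.comp_id]
  rw [hσ, reassoc_of% (ext02_natural (ext02 c.cup Z) a.cup),
    reassoc_of% (whiskerLeft_of_comm a.star (whisker_exchange κ (ext02 c.cup Z))),
    whiskerLeft_of_comp_id a.star (c.cup_cap Z), Category.comp_id]

theorem cup_proj (Z : D) : ext02 c.cup Z ≫ c.star ◁ (dag κ ▷ Z) =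
    ext02 a.cup Z ≫ σ ▷ (X ⊗ Z) := by
  have hσ : σ ▷ (X ⊗ Z) = ext02 c.cup (a.star ⊗ (X ⊗ Z)) ≫
      c.star ◁ dag κ ▷ (a.star ⊗ (X ⊗ Z)) ≫ c.star ◁ ext20 a.cap (X ⊗ Z) := by
    rw [← whiskerLeft_of_comm c.star (h.starIncl_cap (X ⊗ Z)),
      ← reassoc_of% (ext02_natural (σ ▷ (X ⊗ Z)) c.cup), c.cup_cap_star, Category.comp_id]
  rw [hσ, reassoc_of% (ext02_natural (ext02 a.cup Z) c.cup),
    reassoc_of% (whiskerLeft_of_comm c.star (whisker_exchange (dag κ) (ext02 a.cup Z))),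
    whiskerLeft_of_comp_id c.star (a.cup_cap Z), Category.comp_id]

theorem starIncl_cap' (Z : D) : σ ▷ (C ⊗ Z) ≫ ext20 c.cap' Z =
    a.star ◁ (dag κ ▷ Z) ≫ ext20 a.cap' Z := by
  simpa [dag_ext02, DaggerDual.dag_cup] using congrArg dag (h.cup_starProj Z)

theorem incl_cap' (Z : D) : c.star ◁ (κ ▷ Z) ≫ ext20 c.cap' Z =
    dag σ ▷ (X ⊗ Z) ≫ ext20 a.cap' Z := by
  simpa [dag_ext02, DaggerDual.dag_cup] using congrArg dag (h.cup_proj Z)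

theorem cup'_starProj (Z : D) : ext02 c.cup' Z ≫ C ◁ (dag σ ▷ Z) =
    ext02 a.cup' Z ≫ κ ▷ (a.star ⊗ Z) := by
  simpa [dag_ext20, DaggerDual.dag_cap] using congrArg dag (h.starIncl_cap Z)

theorem cup'_proj (Z : D) : ext02 c.cup' Z ≫ dag κ ▷ (c.star ⊗ Z) =
    ext02 a.cup' Z ≫ X ◁ (σ ▷ Z) := by
  simpa [dag_ext20, DaggerDual.dag_cap] using congrArg dag (h.incl_cap Z)

theorem incl_act (Z : D) : κ ▷ (R ⊗ Z) ≫ ext21 act' Z = ext21 act Z ≫ κ ▷ Z := by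
  calc _ = (α_ _ _ _).inv ≫ (κ ▷ R ≫ act') ▷ Z := by simp only [ext21]; monoidal
    _ = _ := by rw [h.act_incl]; simp only [ext21]; monoidal

theorem act_proj_ext (Z : D) : ext21 act' Z ≫ dag κ ▷ Z = dag κ ▷ (R ⊗ Z) ≫ ext21 act Z := by
  calc _ = (α_ _ _ _).inv ≫ (act' ≫ dag κ) ▷ Z := by simp only [ext21]; monoidal
    _ = _ := by rw [h.act_proj]; simp only [ext21]; monoidal

theorem incl_coact (Z : D) : κ ▷ Z ≫ ext12 (dag act') Z = ext12 (dag act) Z ≫ κ ▷ (R ⊗ Z) := by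
  simpa [dag_ext21] using congrArg dag (h.act_proj_ext Z)

theorem coact_proj (Z : D) :
    ext12 (dag act') Z ≫ dag κ ▷ (R ⊗ Z) = dag κ ▷ Z ≫ ext12 (dag act) Z := by
  simpa [dag_ext21] using congrArg dag (h.incl_act Z)

theorem starIncl_inner (Z : D) : σ ▷ (C ⊗ Z) ≫ ext21 (c.inner act') Z =
    a.star ◁ (dag κ ▷ Z) ≫ ext21 (a.inner act) Z := by
  rw [c.inner_ext, a.inner_ext, ← whisker_exchange_assoc, h.starIncl_cap',
    reassoc_of% (whiskerLeft_of_comm a.star (h.coact_proj Z))]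

theorem incl_inner (Z : D) : c.star ◁ (κ ▷ Z) ≫ ext21 (c.inner act') Z =
    dag σ ▷ (X ⊗ Z) ≫ ext21 (a.inner act) Z := by
  rw [c.inner_ext, a.inner_ext, reassoc_of% (whiskerLeft_of_comm c.star (h.incl_coact Z)),
    h.incl_cap', whisker_exchange_assoc]

theorem starIncl_coactStar (Z : D) : σ ▷ Z ≫ ext12 (c.coactStar act') Z =
    ext12 (a.coactStar act) Z ≫ R ◁ (σ ▷ Z) := by
  rw [c.coactStar_ext, a.coactStar_ext, ← whisker_exchange_assoc, h.starIncl_inner,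
    reassoc_of% (whiskerLeft_of_comm a.star (h.cup'_proj Z)), Category.assoc, ext21_natural]

theorem coactStar_starProj (Z : D) : ext12 (c.coactStar act') Z ≫ R ◁ (dag σ ▷ Z) =
    dag σ ▷ Z ≫ ext12 (a.coactStar act) Z := by
  rw [c.coactStar_ext, a.coactStar_ext, Category.assoc, ← ext21_natural,
    reassoc_of% (whiskerLeft_of_comm c.star (h.cup'_starProj Z)), h.incl_inner,
    whisker_exchange_assoc]

end IsSummand

end Summand

/-! ### Dagger biproducts and the tensor product -/

section Biproduct

variable {D : Type u} [Category.{v} D] [MonoidalCategory D] [MonoidalDaggerCategory D]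
  [HasZeroMorphisms D]

theorem dag_zero (X Y : D) : dag (0 : X ⟶ Y) = 0 := by
  have h : (0 : X ⟶ Y) = (0 : X ⟶ X) ≫ dag (0 : Y ⟶ X) := zero_comp.symm
  rw [h, dag_comp, dag_dag, zero_comp]

theorem exists_id_eq_zero (hsplit : HasDaggerSplittings D) (X : D) :
    ∃ Y : D, 𝟙 Y = 0 := by
  obtain ⟨Y, i, hi, h⟩ := hsplit X 0 (by rw [IsDaggerIdempotent, zero_comp])
  refine ⟨Y, ?_⟩
  have hi : i ≫ dag i = 𝟙 Y := hi
  calc 𝟙 Y = i ≫ (dag i ≫ i) ≫ dag i := by rw [Category.assoc, hi, Category.comp_id, hi]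
    _ = 0 := by rw [← h, zero_comp, comp_zero]

/-- An object with a dual turns zero morphisms into zero morphisms. -/
theorem zero_whiskerRight (hsplit : HasDaggerSplittings D) {W : D} (w : DaggerDual W) (X Y : D) :
    (0 : X ⟶ Y) ▷ W = 0 := by
  obtain ⟨Z, hZ⟩ := exists_id_eq_zero hsplit X
  let _ := w.reversePairing
  -- `Z ⊗ W` is a zero object, since `- ⊗ W` has a right adjoint
  have h : 𝟙 (Z ⊗ W) = 0 := by
    refine (tensorRightHomEquiv Z W w.star (Z ⊗ W)).injective ?_
    rw [← Category.id_comp (tensorRightHomEquiv Z W w.star (Z ⊗ W) (𝟙 _)),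
      ← Category.id_comp (tensorRightHomEquiv Z W w.star (Z ⊗ W) 0), hZ, zero_comp, zero_comp]
  rw [← zero_comp (f := (0 : Z ⟶ Y)) (X := X), comp_whiskerRight,
    ← Category.id_comp ((0 : Z ⟶ Y) ▷ W), h, zero_comp, comp_zero]

/-- Two morphisms with a common target which are jointly epimorphic. -/
def JointlyEpi {X Y C : D} (i : X ⟶ C) (j : Y ⟶ C) : Prop :=
  ∀ ⦃Z : D⦄ (f g : C ⟶ Z), i ≫ f = i ≫ g → j ≫ f = j ≫ g → f = g

set_option linter.unusedSectionVars false in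
theorem JointlyEpi.whiskerRight {X Y C : D} {i : X ⟶ C} {j : Y ⟶ C} (h : JointlyEpi i j) {W : D}
    (w : DaggerDual W) : JointlyEpi (i ▷ W) (j ▷ W) := by
  intro Z f g h₁ h₂
  let _ := w.reversePairing
  have key : ∀ {V : D} (i : V ⟶ C), i ▷ W ≫ f = i ▷ W ≫ g →
      i ≫ tensorRightHomEquiv C W w.star Z f = i ≫ tensorRightHomEquiv C W w.star Z g := by
    intro V i hi
    refine (tensorRightHomEquiv V W w.star Z).symm.injective ?_
    simpa [tensorRightHomEquiv_symm_naturality] using hi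
  exact (tensorRightHomEquiv C W w.star Z).injective (h _ _ (key _ h₁) (key _ h₂))

namespace IsDaggerBiproduct

variable {X Y : D} {b : BinaryBicone X Y} (hb : IsDaggerBiproduct b)
include hb

theorem hom_ext {Z : D} {f g : Z ⟶ b.pt} (h₁ : f ≫ dag b.inl = g ≫ dag b.inl)
    (h₂ : f ≫ dag b.inr = g ≫ dag b.inr) : f = g := by
  rw [← hb.fst_eq] at h₁
  rw [← hb.snd_eq] at h₂
  obtain ⟨hl⟩ := hb.isBilimit
  exact BinaryFan.IsLimit.hom_ext hl.isLimit h₁ h₂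

theorem hom_ext' {Z : D} {f g : b.pt ⟶ Z} (h₁ : b.inl ≫ f = b.inl ≫ g)
    (h₂ : b.inr ≫ f = b.inr ≫ g) : f = g := by
  obtain ⟨hl⟩ := hb.isBilimit
  exact BinaryCofan.IsColimit.hom_ext hl.isColimit h₁ h₂

theorem exists_desc {Z : D} (f : X ⟶ Z) (g : Y ⟶ Z) :
    ∃ k : b.pt ⟶ Z, b.inl ≫ k = f ∧ b.inr ≫ k = g := by
  obtain ⟨hl⟩ := hb.isBilimit
  obtain ⟨k, h₁, h₂⟩ := BinaryCofan.IsColimit.desc' hl.isColimit f g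
  exact ⟨k, h₁, h₂⟩

theorem exists_lift {Z : D} (f : Z ⟶ X) (g : Z ⟶ Y) :
    ∃ k : Z ⟶ b.pt, k ≫ dag b.inl = f ∧ k ≫ dag b.inr = g := by
  obtain ⟨k, h₁, h₂⟩ := hb.exists_desc (dag f) (dag g)
  exact ⟨dag k, by rw [← dag_comp, h₁, dag_dag], by rw [← dag_comp, h₂, dag_dag]⟩

theorem inl_inl : b.inl ≫ dag b.inl = 𝟙 X := by rw [← hb.fst_eq, b.inl_fst]
theorem inr_inr : b.inr ≫ dag b.inr = 𝟙 Y := by rw [← hb.snd_eq, b.inr_snd]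
theorem inl_inr : b.inl ≫ dag b.inr = 0 := by rw [← hb.snd_eq, b.inl_snd]

theorem jointlyEpi : JointlyEpi b.inl b.inr := fun _ _ _ => hb.hom_ext'

/-- Tensoring on the right with an object that has a dual preserves the coproduct property. -/
theorem whiskerRight_hom_ext {W Z : D} (w : DaggerDual W) {f g : b.pt ⊗ W ⟶ Z}
    (h₁ : b.inl ▷ W ≫ f = b.inl ▷ W ≫ g) (h₂ : b.inr ▷ W ≫ f = b.inr ▷ W ≫ g) : f = g :=
  hb.jointlyEpi.whiskerRight w _ _ h₁ h₂

theorem whiskerRight_tensor_hom_ext {W V Z : D} (w : DaggerDual W) (v : DaggerDual V)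
    {f g : b.pt ⊗ (W ⊗ V) ⟶ Z} (h₁ : b.inl ▷ (W ⊗ V) ≫ f = b.inl ▷ (W ⊗ V) ≫ g)
    (h₂ : b.inr ▷ (W ⊗ V) ≫ f = b.inr ▷ (W ⊗ V) ≫ g) : f = g := by
  rw [← cancel_epi (α_ b.pt W V).hom]
  refine (hb.jointlyEpi.whiskerRight w).whiskerRight v _ _ ?_ ?_
  · rw [associator_naturality_left_assoc, h₁, associator_naturality_left_assoc]
  · rw [associator_naturality_left_assoc, h₂, associator_naturality_left_assoc]

variable [HasDaggerBiproducts D] (hdist : DistributiveDaggerBiproducts D)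
include hdist

theorem exists_distributor (W : D) : ∃ t : BinaryBicone (W ⊗ X) (W ⊗ Y), IsDaggerBiproduct t ∧
    ∃ u : t.pt ⟶ W ⊗ b.pt, t.inl ≫ u = W ◁ b.inl ∧ t.inr ≫ u = W ◁ b.inr ∧
      u ≫ dag u = 𝟙 _ ∧ dag u ≫ u = 𝟙 _ := by
  obtain ⟨t, ht⟩ := HasDaggerBiproducts.exists_biproduct (W ⊗ X) (W ⊗ Y)
  obtain ⟨u, h₁, h₂⟩ := ht.exists_desc (W ◁ b.inl) (W ◁ b.inr)
  exact ⟨t, ht, u, h₁, h₂, hdist W X Y b t hb ht u h₁ h₂⟩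

theorem whiskerLeft_hom_ext' {W Z : D} {f g : W ⊗ b.pt ⟶ Z}
    (h₁ : W ◁ b.inl ≫ f = W ◁ b.inl ≫ g) (h₂ : W ◁ b.inr ≫ f = W ◁ b.inr ≫ g) : f = g := by
  obtain ⟨t, ht, u, hl, hr, -, hu⟩ := hb.exists_distributor hdist W
  have h : u ≫ f = u ≫ g := ht.hom_ext' (by simpa [← hl] using h₁) (by simpa [← hr] using h₂)
  rw [← Category.id_comp f, ← hu, Category.assoc, h, ← Category.assoc, hu, Category.id_comp]

theorem whiskerLeft_whiskerRight_hom_ext {W V Z : D} (v : DaggerDual V)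
    {f g : W ⊗ (b.pt ⊗ V) ⟶ Z} (h₁ : W ◁ b.inl ▷ V ≫ f = W ◁ b.inl ▷ V ≫ g)
    (h₂ : W ◁ b.inr ▷ V ≫ f = W ◁ b.inr ▷ V ≫ g) : f = g := by
  have h : JointlyEpi (W ◁ b.inl) (W ◁ b.inr) := fun _ _ _ => hb.whiskerLeft_hom_ext' hdist
  rw [← cancel_epi (α_ W b.pt V).hom]
  refine h.whiskerRight v _ _ ?_ ?_
  · rw [associator_naturality_middle_assoc, h₁, associator_naturality_middle_assoc]
  · rw [associator_naturality_middle_assoc, h₂, associator_naturality_middle_assoc]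

theorem exists_whiskerLeft_desc {W Z : D} (f : W ⊗ X ⟶ Z) (g : W ⊗ Y ⟶ Z) :
    ∃ k : W ⊗ b.pt ⟶ Z, W ◁ b.inl ≫ k = f ∧ W ◁ b.inr ≫ k = g := by
  obtain ⟨t, ht, u, hl, hr, hu, -⟩ := hb.exists_distributor hdist W
  obtain ⟨k, h₁, h₂⟩ := ht.exists_desc f g
  exact ⟨dag u ≫ k, by rw [← hl, Category.assoc, reassoc_of% hu, h₁],
    by rw [← hr, Category.assoc, reassoc_of% hu, h₂]⟩

theorem exists_whiskerLeft_lift {W Z : D} (f : Z ⟶ W ⊗ X) (g : Z ⟶ W ⊗ Y) :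
    ∃ k : Z ⟶ W ⊗ b.pt, k ≫ W ◁ dag b.inl = f ∧ k ≫ W ◁ dag b.inr = g := by
  obtain ⟨k, h₁, h₂⟩ := hb.exists_whiskerLeft_desc hdist (dag f) (dag g)
  exact ⟨dag k, by simpa using congrArg dag h₁, by simpa using congrArg dag h₂⟩

end IsDaggerBiproduct

theorem whiskerLeft_zero [HasDaggerBiproducts D] (hdist : DistributiveDaggerBiproducts D)
    (W X Y : D) : W ◁ (0 : X ⟶ Y) = 0 := by
  obtain ⟨b, hb⟩ := HasDaggerBiproducts.exists_biproduct X Y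
  obtain ⟨t, ht, u, hl, hr, hu, -⟩ := hb.exists_distributor hdist W
  rw [← hb.inl_inr, whiskerLeft_comp, ← dag_whiskerLeft, ← hl, ← hr, dag_comp, Category.assoc,
    reassoc_of% hu, ht.inl_inr]

end Biproduct

/-! ### Direct sums of dagger modules -/

section Laws

variable {D : Type u} [Category.{v} D] [MonoidalCategory D] [MonoidalDaggerCategory D]
  {R : FrobeniusMonoid D} {C S : D} {act : C ⊗ R.carrier ⟶ C}
  (X : DaggerModule R) {κ : X.carrier ⟶ C} {σ : X.dual.star ⟶ S}

theorem snake_proj (n : 𝟙_ D ⟶ S ⊗ C) (e : C ⊗ S ⟶ 𝟙_ D)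
    (hn : n ≫ S ◁ dag κ = X.dual.cup ≫ σ ▷ X.carrier)
    (he : C ◁ σ ≫ e = dag κ ▷ X.dual.star ≫ X.dual.cap) :
    C ◁ n ≫ (α_ C S C).inv ≫ e ▷ C ≫ (λ_ C).hom ≫ dag κ = (ρ_ C).hom ≫ dag κ := by
  have h : X.carrier ◁ X.dual.cup ≫ (α_ _ _ _).inv ≫ X.dual.cap ▷ X.carrier =
      (ρ_ _).hom ≫ (λ_ _).inv := X.dual.pairing.coevaluation_evaluation'
  calc _ = C ◁ (n ≫ S ◁ dag κ) ≫ (α_ _ _ _).inv ≫ e ▷ _ ≫ (λ_ _).hom := by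
        rw [← leftUnitor_naturality, ← whisker_exchange_assoc]; monoidal
    _ = C ◁ X.dual.cup ≫ (α_ _ _ _).inv ≫ (C ◁ σ ≫ e) ▷ _ ≫ (λ_ _).hom := by
        rw [hn]; monoidal
    _ = C ◁ X.dual.cup ≫ dag κ ▷ _ ≫ (α_ _ _ _).inv ≫ X.dual.cap ▷ _ ≫ (λ_ _).hom := by
        rw [he]; monoidal
    _ = _ := by
        rw [whisker_exchange_assoc, reassoc_of% h]; simp

theorem snake_starIncl (n : 𝟙_ D ⟶ S ⊗ C) (e : C ⊗ S ⟶ 𝟙_ D)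
    (hn : n ≫ S ◁ dag κ = X.dual.cup ≫ σ ▷ X.carrier)
    (he : C ◁ σ ≫ e = dag κ ▷ X.dual.star ≫ X.dual.cap) :
    σ ≫ (λ_ S).inv ≫ n ▷ S ≫ (α_ S C S).hom ≫ S ◁ e = σ ≫ (ρ_ S).inv := by
  have h : X.dual.cup ▷ X.dual.star ≫ (α_ _ _ _).hom ≫ X.dual.star ◁ X.dual.cap =
      (λ_ _).hom ≫ (ρ_ _).inv := X.dual.pairing.evaluation_coevaluation'
  calc _ = (λ_ _).inv ≫ n ▷ _ ≫ (α_ _ _ _).hom ≫ S ◁ (C ◁ σ ≫ e) := by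
        rw [reassoc_of% (leftUnitor_inv_naturality σ), whisker_exchange_assoc]; monoidal
    _ = (λ_ _).inv ≫ (n ≫ S ◁ dag κ) ▷ _ ≫ (α_ _ _ _).hom ≫ S ◁ X.dual.cap := by
        rw [he]; monoidal
    _ = (λ_ _).inv ≫ X.dual.cup ▷ _ ≫ (α_ _ _ _).hom ≫ σ ▷ _ ≫ S ◁ X.dual.cap := by
        rw [hn]; monoidal
    _ = _ := by
        rw [← whisker_exchange, reassoc_of% h]; simp

namespace IsSummand

variable {X} {c : DaggerDual C} {σ : X.dual.star ⟶ c.star}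
  (h : IsSummand X.dual c X.act act κ σ)
include h

theorem act_assoc_proj : (act ▷ R.carrier ≫ act) ≫ dag κ =
    ((α_ _ _ _).hom ≫ C ◁ R.mul ≫ act) ≫ dag κ := by
  simp only [Category.assoc, h.act_proj]
  rw [← comp_whiskerRight_assoc, h.act_proj, comp_whiskerRight_assoc, X.act_assoc,
    whisker_exchange_assoc]
  monoidal

theorem act_one_proj : (C ◁ R.one ≫ act) ≫ dag κ = (ρ_ C).hom ≫ dag κ := by
  rw [Category.assoc, h.act_proj, whisker_exchange_assoc, X.act_one, rightUnitor_naturality]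

theorem incl_coact_plain : κ ≫ dag act = dag X.act ≫ κ ▷ R.carrier := by
  simpa using congrArg dag h.act_proj

theorem incl_act_coact : κ ▷ R.carrier ≫ act ≫ dag act =
    κ ▷ R.carrier ≫ dag act ▷ R.carrier ≫ (α_ _ _ _).hom ≫ C ◁ R.mul := by
  rw [reassoc_of% h.act_incl, h.incl_coact_plain, reassoc_of% X.act_coact,
    ← comp_whiskerRight_assoc, h.incl_coact_plain, comp_whiskerRight_assoc, whisker_exchange]
  monoidal

theorem incl_coact_act : κ ≫ dag act ≫ act = κ := by
  rw [reassoc_of% h.incl_coact_plain, h.act_incl, reassoc_of% X.coact_act]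

theorem starIncl_symmetric : σ ≫ c.coactStar act =
    σ ≫ ext02 R.cup c.star ≫ R.carrier ◁ dag (c.coactStar act) := by
  have h₁ : σ ≫ c.coactStar act = X.dual.coactStar X.act ≫ R.carrier ◁ σ :=
    eq_of_whiskerRight_eq fun Z => (cancel_mono (α_ _ _ _).hom).1 <| by
      simpa [ext12] using h.starIncl_coactStar Z
  have h₂ : c.coactStar act ≫ R.carrier ◁ dag σ = dag σ ≫ X.dual.coactStar X.act :=
    eq_of_whiskerRight_eq fun Z => (cancel_mono (α_ _ _ _).hom).1 <| by
      simpa [ext12] using h.coactStar_starProj Z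
  have h₃ : R.carrier ◁ σ ≫ dag (c.coactStar act) = dag (X.dual.coactStar X.act) ≫ σ := by
    simpa using congrArg dag h₂
  rw [h₁, reassoc_of% (ext02_natural σ R.cup), whiskerLeft_of_comm R.carrier h₃]
  conv_lhs => rw [X.symmetric]
  rw [Category.assoc]

end IsSummand

end Laws

section DirectSum

variable {D : Type u} [Category.{v} D] [MonoidalCategory D] [MonoidalDaggerCategory D]
  [HasZeroMorphisms D]

/-- The bicone given by two orthogonal isometries, with their daggers as projections. -/
@[reducible] def daggerBicone {X Y C : D} (i : X ⟶ C) (j : Y ⟶ C) (hi : i ≫ dag i = 𝟙 X)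
    (hj : j ≫ dag j = 𝟙 Y) (hij : i ≫ dag j = 0) : BinaryBicone X Y where
  pt := C
  fst := dag i
  snd := dag j
  inl := i
  inr := j
  inl_fst := hi
  inl_snd := hij
  inr_fst := by simpa [dag_zero] using congrArg dag hij
  inr_snd := hj

theorem exists_daggerBicone [HasDaggerBiproducts D] (X Y : D) :
    ∃ (C : D) (i : X ⟶ C) (j : Y ⟶ C) (hi : i ≫ dag i = 𝟙 X) (hj : j ≫ dag j = 𝟙 Y)
      (hij : i ≫ dag j = 0), IsDaggerBiproduct (daggerBicone i j hi hj hij) := by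
  obtain ⟨b, hb⟩ := HasDaggerBiproducts.exists_biproduct X Y
  refine ⟨b.pt, b.inl, b.inr, hb.inl_inl, hb.inr_inr, hb.inl_inr, ?_⟩
  have h₁ := hb.fst_eq
  have h₂ := hb.snd_eq
  have h₃ := hb.isBilimit
  obtain ⟨C, p, q, i, j, h, h', h'', h'''⟩ := b
  dsimp only at h₁ h₂
  subst h₁ h₂
  exact ⟨h₃, rfl, rfl⟩

/-- A direct sum of two dagger modules, whose dual is a direct sum of the duals. -/
structure DirectSum {R : FrobeniusMonoid D} (X Y : DaggerModule R) where
  module : DaggerModule R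
  inl : X.carrier ⟶ module.carrier
  inr : Y.carrier ⟶ module.carrier
  inlStar : X.dual.star ⟶ module.dual.star
  inrStar : Y.dual.star ⟶ module.dual.star
  summand_inl : IsSummand X.dual module.dual X.act module.act inl inlStar
  summand_inr : IsSummand Y.dual module.dual Y.act module.act inr inrStar
  inl_inr : inl ≫ dag inr = 0
  inlStar_inrStar : inlStar ≫ dag inrStar = 0
  isBiproduct : IsDaggerBiproduct
    (daggerBicone inl inr summand_inl.isometry summand_inr.isometry inl_inr)
  isBiproduct_star : IsDaggerBiproduct (daggerBicone inlStar inrStar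
    summand_inl.star_isometry summand_inr.star_isometry inlStar_inrStar)


/-- Two dagger modules have a direct sum.  Distributivity gives the pairings of `C` with `C*`; the
remaining laws are checked on the two summands, where zero morphisms are preserved by tensoring
with an object that has a dual. -/
theorem exists_directSum [HasDaggerBiproducts D] (hdist : DistributiveDaggerBiproducts D)
    (hsplit : HasDaggerSplittings D) {R : FrobeniusMonoid D} (X Y : DaggerModule R) :
    Nonempty (DirectSum X Y) := by
  obtain ⟨C, i, j, hi, hj, hij, hb⟩ := exists_daggerBicone X.carrier Y.carrier
  obtain ⟨S, k, l, hk, hl, hkl, hs⟩ := exists_daggerBicone X.dual.star Y.dual.star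
  have hji : j ≫ dag i = 0 := by simpa [dag_zero] using congrArg dag hij
  have hlk : l ≫ dag k = 0 := by simpa [dag_zero] using congrArg dag hkl
  obtain ⟨e, hek, hel⟩ := hs.exists_whiskerLeft_desc hdist (dag i ▷ _ ≫ X.dual.cap)
    (dag j ▷ _ ≫ Y.dual.cap)
  obtain ⟨n, hni, hnj⟩ := hb.exists_whiskerLeft_lift hdist (X.dual.cup ≫ k ▷ _)
    (Y.dual.cup ≫ l ▷ _)
  obtain ⟨act, hacti, hactj⟩ := hb.exists_lift (dag i ▷ _ ≫ X.act) (dag j ▷ _ ≫ Y.act)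
  dsimp only at hek hel hni hnj hacti hactj e n act
  let c : DaggerDual C := ⟨S,
    { coevaluation' := n
      evaluation' := e
      coevaluation_evaluation' := by
        have h : C ◁ n ≫ (α_ C S C).inv ≫ e ▷ C ≫ (λ_ C).hom = (ρ_ C).hom := by
          refine hb.hom_ext ?_ ?_ <;> simp only [Category.assoc]
          · exact snake_proj X n e hni hek
          · exact snake_proj Y n e hnj hel
        simp [← h]
      evaluation_coevaluation' := by
        have h : (λ_ S).inv ≫ n ▷ S ≫ (α_ S C S).hom ≫ S ◁ e = (ρ_ S).inv := by
          refine hs.hom_ext' ?_ ?_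
          · exact snake_starIncl X n e hni hek
          · exact snake_starIncl Y n e hnj hel
        simp [← h] }⟩
  have hi' : IsSummand X.dual c X.act act i k := by
    refine ⟨hi, hk, ?_, hek, ?_, hacti⟩
    · refine hs.whiskerLeft_hom_ext' hdist ?_ ?_
      · change X.carrier ◁ k ≫ i ▷ S ≫ e = X.carrier ◁ k ≫ X.carrier ◁ dag k ≫ _
        rw [whisker_exchange_assoc, hek, ← comp_whiskerRight_assoc, hi,
          reassoc_of% (whiskerLeft_of_comp_id _ hk), id_whiskerRight, Category.id_comp]
      · change X.carrier ◁ l ≫ i ▷ S ≫ e = X.carrier ◁ l ≫ X.carrier ◁ dag k ≫ _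
        rw [whisker_exchange_assoc, hel, ← comp_whiskerRight_assoc, hij,
          zero_whiskerRight hsplit Y.dual.reverse, ← whiskerLeft_comp_assoc, hlk,
          whiskerLeft_zero hdist, zero_comp, zero_comp]
    · refine hb.hom_ext ?_ ?_
      · change (i ▷ _ ≫ act) ≫ dag i = (X.act ≫ i) ≫ dag i
        rw [Category.assoc, Category.assoc, hacti, hi, ← comp_whiskerRight_assoc, hi,
          id_whiskerRight, Category.id_comp, Category.comp_id]
      · change (i ▷ _ ≫ act) ≫ dag j = (X.act ≫ i) ≫ dag j
        rw [Category.assoc, Category.assoc, hactj, hij, ← comp_whiskerRight_assoc, hij,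
          zero_whiskerRight hsplit R.selfDual, zero_comp, comp_zero]
  have hj' : IsSummand Y.dual c Y.act act j l := by
    refine ⟨hj, hl, ?_, hel, ?_, hactj⟩
    · refine hs.whiskerLeft_hom_ext' hdist ?_ ?_
      · change Y.carrier ◁ k ≫ j ▷ S ≫ e = Y.carrier ◁ k ≫ Y.carrier ◁ dag l ≫ _
        rw [whisker_exchange_assoc, hek, ← comp_whiskerRight_assoc, hji,
          zero_whiskerRight hsplit X.dual.reverse, ← whiskerLeft_comp_assoc, hkl,
          whiskerLeft_zero hdist, zero_comp, zero_comp]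
      · change Y.carrier ◁ l ≫ j ▷ S ≫ e = Y.carrier ◁ l ≫ Y.carrier ◁ dag l ≫ _
        rw [whisker_exchange_assoc, hel, ← comp_whiskerRight_assoc, hj,
          reassoc_of% (whiskerLeft_of_comp_id _ hl), id_whiskerRight, Category.id_comp]
    · refine hb.hom_ext ?_ ?_
      · change (j ▷ _ ≫ act) ≫ dag i = (Y.act ≫ j) ≫ dag i
        rw [Category.assoc, Category.assoc, hacti, hji, ← comp_whiskerRight_assoc, hji,
          zero_whiskerRight hsplit R.selfDual, zero_comp, comp_zero]
      · change (j ▷ _ ≫ act) ≫ dag j = (Y.act ≫ j) ≫ dag j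
        rw [Category.assoc, Category.assoc, hactj, hj, ← comp_whiskerRight_assoc, hj,
          id_whiskerRight, Category.id_comp, Category.comp_id]
  exact ⟨{
    module :=
      { carrier := C
        dual := c
        act := act
        act_assoc := hb.hom_ext hi'.act_assoc_proj hj'.act_assoc_proj
        act_one := hb.hom_ext hi'.act_one_proj hj'.act_one_proj
        act_coact := hb.whiskerRight_hom_ext R.selfDual hi'.incl_act_coact hj'.incl_act_coact
        coact_act := hb.hom_ext' (hi'.incl_coact_act.trans (Category.comp_id _).symm)
          (hj'.incl_coact_act.trans (Category.comp_id _).symm)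
        symmetric := hs.hom_ext' hi'.starIncl_symmetric hj'.starIncl_symmetric }
    inl := i
    inr := j
    inlStar := k
    inrStar := l
    summand_inl := hi'
    summand_inr := hj'
    inl_inr := hij
    inlStar_inrStar := hkl
    isBiproduct := hb
    isBiproduct_star := hs }⟩

end DirectSum

/-! ### Families of operators and their adjoints -/

section Operators

variable {D : Type u} [Category.{v} D] [MonoidalCategory D] [MonoidalDaggerCategory D]

namespace DaggerDual

variable {X B : D} (a : DaggerDual X) (γ : X ⊗ B ⟶ B)

/-- For a family of operators on `B` parametrized by `X`, the family of adjoint operators,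
parametrized by `X*`. -/
def adjoint : a.star ⊗ B ⟶ B := a.star ◁ dag γ ≫ ext20 a.cap' B

theorem dag_adjoint : dag (a.adjoint γ) = ext02 a.cup B ≫ a.star ◁ γ := by
  rw [adjoint, dag_comp, dag_whiskerLeft, dag_dag, dag_ext20, dag_cap']

theorem cup'_adjoint : ext02 a.cup' B ≫ X ◁ a.adjoint γ = dag γ := by
  rw [adjoint, whiskerLeft_comp, ← reassoc_of% (ext02_natural (dag γ) a.cup'), a.cup'_cap',
    Category.comp_id]

theorem adjoint_eq_self_of_dag {R : FrobeniusMonoid D} {γ : R.carrier ⊗ B ⟶ B}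
    (h : dag γ = ext02 R.cup B ≫ R.carrier ◁ γ) : R.selfDual.adjoint γ = γ :=
  dag_injective (by rw [dag_adjoint, h]; rfl)

end DaggerDual

theorem IsSummand.starIncl_adjoint {X C R B : D} {a : DaggerDual X} {c : DaggerDual C}
    {act : X ⊗ R ⟶ X} {act' : C ⊗ R ⟶ C} {κ : X ⟶ C} {σ : a.star ⟶ c.star}
    (h : IsSummand a c act act' κ σ) (γ : C ⊗ B ⟶ B) :
    σ ▷ B ≫ c.adjoint γ = a.adjoint (κ ▷ B ≫ γ) := by
  rw [DaggerDual.adjoint, DaggerDual.adjoint, ← whisker_exchange_assoc, h.starIncl_cap', dag_comp,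
    dag_whiskerRight, whiskerLeft_comp, Category.assoc]

namespace FrobeniusMonoid

variable (Y : FrobeniusMonoid D) {X W V : D}

/-- The family of left multiplications by the elements of `g : X ⟶ Y`. -/
def leftMul (g : X ⟶ Y.carrier) : X ⊗ Y.carrier ⟶ Y.carrier := g ▷ Y.carrier ≫ Y.mul

theorem whiskerRight_leftMul (h : W ⟶ X) (g : X ⟶ Y.carrier) :
    h ▷ Y.carrier ≫ Y.leftMul g = Y.leftMul (h ≫ g) := by
  simp [leftMul]

theorem leftMul_one (g : X ⟶ Y.carrier) : X ◁ Y.one ≫ Y.leftMul g = (ρ_ X).hom ≫ g := by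
  rw [leftMul, whisker_exchange_assoc, Y.mul_one, rightUnitor_naturality]

theorem leftMul_injective {g h : X ⟶ Y.carrier} (H : Y.leftMul g = Y.leftMul h) : g = h := by
  rw [← cancel_epi (ρ_ X).hom, ← leftMul_one, H, leftMul_one]

theorem leftMul_leftMul (g : X ⟶ Y.carrier) (h : W ⟶ Y.carrier) :
    Y.leftMul (X ◁ h ≫ Y.leftMul g) = (α_ X W Y.carrier).hom ≫ X ◁ Y.leftMul h ≫ Y.leftMul g := by
  simp only [leftMul, comp_whiskerRight, Category.assoc, Y.mul_assoc, whiskerLeft_comp]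
  rw [whisker_exchange_assoc]
  monoidal

theorem ext12_leftMul (f : V ⟶ X ⊗ W) (g : X ⟶ Y.carrier) (h : W ⟶ Y.carrier) :
    ext12 f Y.carrier ≫ X ◁ Y.leftMul h ≫ Y.leftMul g =
      Y.leftMul (f ≫ X ◁ h ≫ Y.leftMul g) := by
  rw [← whiskerRight_leftMul, leftMul_leftMul, ext12, Category.assoc]

theorem whiskerLeft_comul_cap :
    Y.carrier ◁ dag Y.mul ≫ ext20 Y.cap Y.carrier = Y.mul := by
  have h := congrArg dag (Y.cup_whiskerLeft_mul (𝟙_ D))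
  rw [dag_comp, dag_whiskerLeft, dag_ext02, dag_ext21, dag_ext12, dag_dag, Y.dag_cup] at h
  calc _ = Y.carrier ◁ (ρ_ _).inv ≫ (Y.carrier ◁ ext12 (dag Y.mul) (𝟙_ D) ≫
        ext20 Y.cap (Y.carrier ⊗ 𝟙_ D)) ≫ (ρ_ _).hom := by
        simp only [ext12, ext20]; monoidal
    _ = _ := by rw [h]; simp only [ext21]; monoidal

end FrobeniusMonoid

namespace DaggerDual

/-- The conjugate of `g` is the mate of `g†`. -/
theorem conj_cap' {X Y : D} (a : DaggerDual X) (b : DaggerDual Y) (g : X ⟶ Y) (Z : D) :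
    a.conj b g ▷ (Y ⊗ Z) ≫ ext20 b.cap' Z = a.star ◁ dag g ▷ Z ≫ ext20 a.cap' Z := by
  have h : ext02 b.cup Z ≫ a.transpose b g ▷ (Y ⊗ Z) = ext02 a.cup Z ≫ a.star ◁ g ▷ Z := by
    have ht : a.transpose b g ▷ (Y ⊗ Z) = ext02 a.cup (b.star ⊗ (Y ⊗ Z)) ≫
        a.star ◁ g ▷ (b.star ⊗ (Y ⊗ Z)) ≫ a.star ◁ ext20 b.cap (Y ⊗ Z) := by
      simp only [transpose, ext02, ext20]; monoidal
    rw [ht, reassoc_of% (ext02_natural (ext02 b.cup Z) a.cup),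
      reassoc_of% (whiskerLeft_of_comm a.star (whisker_exchange g (ext02 b.cup Z))),
      whiskerLeft_of_comp_id a.star (b.cup_cap Z), Category.comp_id]
  simpa [conj, dag_ext02, dag_cup] using congrArg dag h

/-- The adjoint of left multiplication by `g` is left multiplication by the conjugate of `g`. -/
theorem leftMul_conj {X : D} (a : DaggerDual X) (Y : FrobeniusMonoid D) (g : X ⟶ Y.carrier) :
    Y.leftMul (a.conj Y.selfDual g) = a.adjoint (Y.leftMul g) := by
  have h := a.conj_cap' Y.selfDual g Y.carrier
  rw [FrobeniusMonoid.selfDual_cap'] at h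
  rw [FrobeniusMonoid.leftMul, adjoint, FrobeniusMonoid.leftMul, dag_comp, dag_whiskerRight,
    whiskerLeft_comp, Category.assoc, ← h, whisker_exchange_assoc]
  exact congrArg _ Y.whiskerLeft_comul_cap.symm

end DaggerDual

end Operators

/-! ### Representations of 3-structures by operators -/

namespace NormalFrobenius3

variable {D : Type u} [Category.{v} D] [MonoidalCategory D] [MonoidalDaggerCategory D]
  (T : NormalFrobenius3 D) {B : D}

/-- A family of operators `γ` on `B`, parametrized by a 3-structure, which sends triple products
to `x y* z`. -/
def IsRepresentation (γ : T.carrier ⊗ B ⟶ B) : Prop :=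
  ext31 T.mul B ≫ γ = T.carrier ◁ T.dual.star ◁ γ ≫ T.carrier ◁ T.dual.adjoint γ ≫ γ

variable {T} {γ : T.carrier ⊗ B ⟶ B}

namespace IsRepresentation

variable (hγ : T.IsRepresentation γ)
include hγ

/-- The operator `∑ x* x` is a unit for `A` on the right. -/
theorem whiskerLeft_dag_adjoint_adjoint :
    T.carrier ◁ (dag (T.dual.adjoint γ) ≫ T.dual.adjoint γ) ≫ γ = γ := by
  rw [T.dual.dag_adjoint, Category.assoc, whiskerLeft_comp, whiskerLeft_comp, Category.assoc,
    Category.assoc, ← hγ, reassoc_of% (T.right_loop_ext B)]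

/-- The adjoint family is a partial isometry. -/
theorem adjoint_comp_dag_comp :
    T.dual.adjoint γ ≫ dag (T.dual.adjoint γ) ≫ T.dual.adjoint γ = T.dual.adjoint γ := by
  have h : dag γ ≫ T.carrier ◁ (dag (T.dual.adjoint γ) ≫ T.dual.adjoint γ) = dag γ := by
    simpa using congrArg dag hγ.whiskerLeft_dag_adjoint_adjoint
  conv_lhs => rw [DaggerDual.adjoint, Category.assoc, ← ext20_natural]
  change T.dual.star ◁ dag γ ≫ T.dual.star ◁ T.carrier ◁
    (dag (T.dual.adjoint γ) ≫ T.dual.adjoint γ) ≫ _ = _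
  rw [← whiskerLeft_comp_assoc, h, DaggerDual.adjoint]

end IsRepresentation

namespace RightAlgebra

variable (R : T.RightAlgebra)

/-- The operators `x* y` by which the right algebra is represented. -/
def apply (γ : T.carrier ⊗ B ⟶ B) : R.carrier ⊗ B ⟶ B :=
  ext12 R.incl B ≫ T.dual.star ◁ γ ≫ T.dual.adjoint γ

theorem one_apply (γ : T.carrier ⊗ B ⟶ B) :
    ext01 R.one B ≫ R.apply γ = dag (T.dual.adjoint γ) ≫ T.dual.adjoint γ := by
  rw [apply, reassoc_of% (R.one_incl B), T.dual.dag_adjoint, Category.assoc]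

variable (hγ : T.IsRepresentation γ)
include hγ

theorem act_comp : ext21 R.act B ≫ γ = T.carrier ◁ R.apply γ ≫ γ := by
  rw [act_ext, Category.assoc, hγ, apply, whiskerLeft_comp, whiskerLeft_comp]
  simp only [Category.assoc]

/-- The operator of the image of `x* ⊗ y` in the right algebra is `x* y`. -/
theorem proj_apply :
    ext21 (dag R.incl) B ≫ R.apply γ = T.dual.star ◁ γ ≫ T.dual.adjoint γ := by
  rw [apply, reassoc_of% (R.split_ext B), rightProjection_ext, Category.assoc,
    ← whiskerLeft_comp_assoc, hγ, whiskerLeft_comp, whiskerLeft_comp]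
  simp only [Category.assoc]
  rw [← whiskerLeft_comp_assoc T.dual.star (T.carrier ◁ _), ← whiskerLeft_comp,
    ← reassoc_of% (ext02_natural (T.dual.star ◁ γ ≫ T.dual.adjoint γ) T.dual.cup),
    ← reassoc_of% (T.dual.dag_adjoint γ), hγ.adjoint_comp_dag_comp]

theorem mul_apply : ext21 R.mul B ≫ R.apply γ = R.carrier ◁ R.apply γ ≫ R.apply γ := by
  conv_lhs => rw [apply, reassoc_of% (R.mul_incl B), ← whiskerLeft_comp_assoc, R.act_comp hγ,
    whiskerLeft_comp, Category.assoc, ← reassoc_of% (ext12_natural (R.apply γ) R.incl)]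
  rfl

/-- The right algebra is represented by a self-adjoint family of operators. -/
theorem adjoint_apply : R.frobeniusMonoid.selfDual.adjoint (R.apply γ) = R.apply γ := by
  refine DaggerDual.adjoint_eq_self_of_dag ?_
  have h : ext12 (dag R.act) B ≫ T.carrier ◁ R.apply γ = γ ≫ dag γ := by
    rw [coact_ext, Category.assoc, ← whiskerLeft_comp, R.proj_apply hγ, whiskerLeft_comp,
      ← reassoc_of% (ext02_natural γ T.dual.cup'), T.dual.cup'_adjoint]
  rw [FrobeniusMonoid.ext02_cup]
  change dag (R.apply γ) = (ext01 R.one B ≫ ext12 (dag R.mul) B) ≫ R.carrier ◁ R.apply γ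
  rw [R.cup_ext, Category.assoc, Category.assoc, ← ext21_natural,
    reassoc_of% (whiskerLeft_of_comm T.dual.star h), ← reassoc_of% (T.dual.dag_adjoint γ), apply]
  simp [dag_ext12]

end RightAlgebra

end NormalFrobenius3

/-! ### Representations of dagger modules by operators -/

namespace DaggerModule

variable {D : Type u} [Category.{v} D] [MonoidalCategory D] [MonoidalDaggerCategory D]
  {R : FrobeniusMonoid D} (X : DaggerModule R) {B : D}

/-- Families of operators on `B`, parametrized by an algebra and by a module over it, which are
compatible with the action and with the inner product. -/
structure IsRepresentation (ρ : R.carrier ⊗ B ⟶ B) (γ : X.carrier ⊗ B ⟶ B) : Prop where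
  act_comp : ext21 X.act B ≫ γ = X.carrier ◁ ρ ≫ γ
  inner_comp : ext21 X.inner B ≫ ρ = X.dual.star ◁ γ ≫ X.dual.adjoint γ

variable {X} {ρ : R.carrier ⊗ B ⟶ B} {γ : X.carrier ⊗ B ⟶ B}

/-- A representation of a dagger module is a partial isometry. -/
theorem IsRepresentation.comp_dag_comp (h : X.IsRepresentation ρ γ) : γ ≫ dag γ ≫ γ = γ := by
  rw [← X.dual.cup'_adjoint γ, Category.assoc, reassoc_of% (ext02_natural γ X.dual.cup'),
    reassoc_of% (whiskerLeft_of_comm X.carrier h.inner_comp.symm), ← h.act_comp,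
    ← reassoc_of% (X.coact_eq_cup'_inner B), reassoc_of% (X.coact_act_ext B)]

theorem IsRepresentation.dag_comp_adjoint (h : X.IsRepresentation ρ γ) :
    X.dual.star ◁ dag γ ≫ X.dual.star ◁ γ ≫ X.dual.adjoint γ = X.dual.adjoint γ := by
  have h' : dag γ ≫ γ ≫ dag γ = dag γ := by simpa using congrArg dag h.comp_dag_comp
  rw [DaggerDual.adjoint, ← whiskerLeft_comp_assoc, ← whiskerLeft_comp_assoc, Category.assoc, h']

namespace LeftAlgebra

variable (L : X.LeftAlgebra)

/-- The operators `x y*` by which the left algebra is represented. -/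
def represent (γ : X.carrier ⊗ B ⟶ B) : L.carrier ⊗ B ⟶ B :=
  ext12 L.incl B ≫ X.carrier ◁ X.dual.adjoint γ ≫ γ

variable (h : X.IsRepresentation ρ γ)
include h

/-- The operator of the image of `x ⊗ y*` in the left algebra is `x y*`. -/
theorem proj_represent :
    ext21 (dag L.incl) B ≫ L.represent γ = X.carrier ◁ X.dual.adjoint γ ≫ γ := by
  have hl : ext12 X.coactStar B ≫ R.carrier ◁ X.dual.adjoint γ ≫ ρ = X.dual.adjoint γ := by
    rw [X.coactStar_ext, Category.assoc, ← reassoc_of% (ext21_natural (X.dual.adjoint γ) X.inner),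
      h.inner_comp, reassoc_of% (whiskerLeft_of_comp X.dual.star (X.dual.cup'_adjoint γ)),
      h.dag_comp_adjoint]
  rw [represent, reassoc_of% (L.split_ext B), leftProjection_ext, Category.assoc,
    ← reassoc_of% (ext21_natural (X.dual.adjoint γ) X.act), h.act_comp, ← whiskerLeft_comp_assoc,
    ← whiskerLeft_comp_assoc, Category.assoc, hl]

theorem apply_comp : ext21 L.apply B ≫ γ = L.carrier ◁ γ ≫ L.represent γ := by
  rw [apply_ext_inner, Category.assoc, Category.assoc, h.act_comp,
    reassoc_of% (whiskerLeft_of_comm X.carrier h.inner_comp),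
    ← reassoc_of% (ext12_natural γ L.incl)]
  rfl

theorem mul_represent :
    ext21 L.mul B ≫ L.represent γ = L.carrier ◁ L.represent γ ≫ L.represent γ := by
  conv_lhs => rw [represent, reassoc_of% (L.mul_incl B),
    ← reassoc_of% (ext21_natural (X.dual.adjoint γ) L.apply), L.apply_comp h,
    ← whiskerLeft_comp_assoc, ← whiskerLeft_comp_assoc, Category.assoc]
  rfl

/-- The left algebra is represented by a self-adjoint family of operators. -/
theorem adjoint_represent :
    L.frobeniusMonoid.selfDual.adjoint (L.represent γ) = L.represent γ := by
  refine DaggerDual.adjoint_eq_self_of_dag ?_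
  rw [FrobeniusMonoid.ext02_cup]
  change dag (L.represent γ) = (ext01 L.one B ≫ ext12 (dag L.mul) B) ≫ L.carrier ◁ L.represent γ
  rw [comul_ext, reassoc_of% (L.one_incl B), Category.assoc, Category.assoc, ← whiskerLeft_comp,
    L.proj_represent h, whiskerLeft_comp,
    ← reassoc_of% (ext12_natural (X.dual.adjoint γ) (dag L.apply)),
    reassoc_of% (X.dual.cup'_adjoint γ), dag_apply_ext, Category.assoc, ← ext21_natural,
    reassoc_of% (whiskerLeft_of_comp X.carrier (X.dual.dag_adjoint γ).symm), represent]
  simp [dag_ext12]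

end LeftAlgebra

end DaggerModule

/-! ### The enveloping module of a 3-structure -/

namespace NormalFrobenius3

variable {D : Type u} [Category.{v} D] [MonoidalCategory D] [MonoidalDaggerCategory D]
  [HasZeroMorphisms D]

/-- The data from which the enveloping 2-structure of `A` is built: the right algebra `R` of `A`,
a direct sum `C = A ⊕ R` of right `R`-modules, and the algebra of `R`-linear endomorphisms
of `C`. -/
structure EnvelopingData (T : NormalFrobenius3 D) where
  right : T.RightAlgebra
  sum : DirectSum right.module right.selfModule
  left : sum.module.LeftAlgebra

theorem exists_envelopingData [HasDaggerBiproducts D] (hdist : DistributiveDaggerBiproducts D)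
    (hsplit : HasDaggerSplittings D) (T : NormalFrobenius3 D) : Nonempty T.EnvelopingData := by
  obtain ⟨R, i, hi, hR⟩ := hsplit _ _ T.isDaggerIdempotent_rightProjection
  let R : T.RightAlgebra := ⟨R, i, hi, hR⟩
  obtain ⟨S⟩ := exists_directSum hdist hsplit R.module R.selfModule
  obtain ⟨L, j, hj, hL⟩ := hsplit _ _ S.module.isDaggerIdempotent_leftProjection
  exact ⟨⟨R, S, ⟨L, j, hj, hL⟩⟩⟩

namespace EnvelopingData

variable {T : NormalFrobenius3 D} (E : T.EnvelopingData)

/-- The module `C = A ⊕ R`. -/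
abbrev module : DaggerModule E.right.frobeniusMonoid := E.sum.module

/-- The inclusion `A ⟶ C`. -/
abbrev inl : T.carrier ⟶ E.module.carrier := E.sum.inl

/-- The inclusion `R ⟶ C`. -/
abbrev inr : E.right.carrier ⟶ E.module.carrier := E.sum.inr

/-- The inclusion `A* ⟶ C*`. -/
abbrev inlStar : T.dual.star ⟶ E.module.dual.star := E.sum.inlStar

/-- The inclusion `R* = R ⟶ C*`. -/
abbrev inrStar : E.right.carrier ⟶ E.module.dual.star := E.sum.inrStar

theorem summand_inl :
    IsSummand T.dual E.module.dual E.right.act E.module.act E.inl E.inlStar :=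
  E.sum.summand_inl

theorem summand_inr : IsSummand E.right.frobeniusMonoid.selfDual E.module.dual E.right.mul
    E.module.act E.inr E.inrStar :=
  E.sum.summand_inr

theorem inl_inr : E.inl ≫ dag E.inr = 0 := E.sum.inl_inr

theorem inr_inl : E.inr ≫ dag E.inl = 0 := by
  simpa [dag_zero] using congrArg dag E.inl_inr

theorem starInl_inner (Z : D) : E.inlStar ▷ (E.module.carrier ⊗ Z) ≫ ext21 E.module.inner Z =
    T.dual.star ◁ dag E.inl ▷ Z ≫ ext21 (dag E.right.incl) Z := by
  rw [← E.right.inner_act_ext]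
  exact E.summand_inl.starIncl_inner Z

theorem starInr_inner (Z : D) : E.inrStar ▷ (E.module.carrier ⊗ Z) ≫ ext21 E.module.inner Z =
    E.right.carrier ◁ dag E.inr ▷ Z ≫ ext21 E.right.mul Z := by
  have h := E.summand_inr.starIncl_inner Z
  rw [show E.right.frobeniusMonoid.selfDual.inner E.right.mul = E.right.mul from
    E.right.frobeniusMonoid.inner_mul] at h
  exact h

variable {Y : FrobeniusMonoid D} {g : T.carrier ⟶ Y.carrier}

/-- The element of `Y` by which an element of the right algebra acts. -/
def rightMap (Y : FrobeniusMonoid D) (g : T.carrier ⟶ Y.carrier) : E.right.carrier ⟶ Y.carrier :=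
  E.right.incl ≫ T.dual.star ◁ g ≫ Y.leftMul (T.dual.conj Y.selfDual g)

theorem leftMul_rightMap : Y.leftMul (E.rightMap Y g) = E.right.apply (Y.leftMul g) := by
  rw [rightMap, RightAlgebra.apply, ← T.dual.leftMul_conj, Y.ext12_leftMul]

variable [HasDaggerBiproducts D] (hdist : DistributiveDaggerBiproducts D)
  (hsplit : HasDaggerSplittings D)
include hdist

/-- If the operators of `A` have products zero, then so have their adjoints. -/
theorem adjoint_adjoint_eq_zero {B : D} {γ : T.carrier ⊗ B ⟶ B} (h : T.carrier ◁ γ ≫ γ = 0) :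
    T.dual.star ◁ T.dual.adjoint γ ≫ T.dual.adjoint γ = 0 := by
  have h' : dag γ ≫ T.carrier ◁ dag γ = 0 := by simpa [dag_zero] using congrArg dag h
  have h₀ : T.dual.adjoint γ ≫ dag γ =
      T.dual.star ◁ (dag γ ≫ T.carrier ◁ dag γ) ≫ ext20 T.dual.cap' _ := by
    rw [DaggerDual.adjoint, Category.assoc, ← ext20_natural, whiskerLeft_comp, Category.assoc]
  conv_lhs => arg 2; rw [DaggerDual.adjoint]
  rw [← whiskerLeft_comp_assoc, h₀, h', whiskerLeft_zero hdist, zero_comp,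
    whiskerLeft_zero hdist, zero_comp]

theorem apply_adjoint_eq_zero {B : D} {γ : T.carrier ⊗ B ⟶ B} (h : T.carrier ◁ γ ≫ γ = 0) :
    T.dual.star ◁ E.right.apply γ ≫ T.dual.adjoint γ = 0 := by
  rw [RightAlgebra.apply, whiskerLeft_comp, whiskerLeft_comp, Category.assoc, Category.assoc,
    adjoint_adjoint_eq_zero hdist h, comp_zero, comp_zero]

theorem whiskerLeft_apply_eq_zero {B : D} {γ : T.carrier ⊗ B ⟶ B} (h : T.carrier ◁ γ ≫ γ = 0) :
    E.right.carrier ◁ γ ≫ E.right.apply γ = 0 := by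
  rw [RightAlgebra.apply, reassoc_of% (ext12_natural γ E.right.incl), ← whiskerLeft_comp_assoc, h,
    whiskerLeft_zero hdist, zero_comp, comp_zero]

include hsplit in
/-- A representation of `A` by left multiplications of square zero extends to `C = A ⊕ R`. -/
theorem exists_representation (hγ : T.IsRepresentation (Y.leftMul g))
    (h₀ : T.carrier ◁ Y.leftMul g ≫ Y.leftMul g = 0) :
    ∃ k : E.module.carrier ⟶ Y.carrier, E.inl ≫ k = g ∧ E.inr ≫ k = E.rightMap Y g ∧
      E.module.IsRepresentation (E.right.apply (Y.leftMul g)) (Y.leftMul k) := by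
  obtain ⟨k, hl, hr⟩ := E.sum.isBiproduct.exists_desc g (E.rightMap Y g)
  have hl : E.inl ≫ k = g := hl
  have hr : E.inr ≫ k = E.rightMap Y g := hr
  have hl' : E.inl ▷ Y.carrier ≫ Y.leftMul k = Y.leftMul g := by
    rw [Y.whiskerRight_leftMul, hl]
  have hr' : E.inr ▷ Y.carrier ≫ Y.leftMul k = E.right.apply (Y.leftMul g) := by
    rw [Y.whiskerRight_leftMul, hr, leftMul_rightMap]
  have hlStar : E.inlStar ▷ Y.carrier ≫ E.module.dual.adjoint (Y.leftMul k) =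
      T.dual.adjoint (Y.leftMul g) := by
    rw [E.summand_inl.starIncl_adjoint, hl']
  have hrStar : E.inrStar ▷ Y.carrier ≫ E.module.dual.adjoint (Y.leftMul k) =
      E.right.apply (Y.leftMul g) := by
    rw [E.summand_inr.starIncl_adjoint, hr', E.right.adjoint_apply hγ]
  refine ⟨k, hl, hr, ?_, ?_⟩
  · refine E.sum.isBiproduct.whiskerRight_tensor_hom_ext E.right.frobeniusMonoid.selfDual
      Y.selfDual ?_ ?_
    · change E.inl ▷ (E.right.carrier ⊗ Y.carrier) ≫ _ = E.inl ▷ _ ≫ _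
      rw [← whisker_exchange_assoc, hl', ← E.right.act_comp hγ,
        reassoc_of% (E.summand_inl.incl_act Y.carrier), hl']
    · change E.inr ▷ (E.right.carrier ⊗ Y.carrier) ≫ _ = E.inr ▷ _ ≫ _
      rw [← whisker_exchange_assoc, hr', ← E.right.mul_apply hγ,
        reassoc_of% (E.summand_inr.incl_act Y.carrier), hr']
  · refine E.sum.isBiproduct_star.whiskerRight_tensor_hom_ext E.module.dual Y.selfDual ?_ ?_
    · change E.inlStar ▷ _ ≫ _ = E.inlStar ▷ _ ≫ _
      rw [← whisker_exchange_assoc, hlStar, reassoc_of% (E.starInl_inner Y.carrier),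
        E.right.proj_apply hγ]
      refine E.sum.isBiproduct.whiskerLeft_whiskerRight_hom_ext hdist Y.selfDual ?_ ?_
      · change T.dual.star ◁ E.inl ▷ _ ≫ _ = T.dual.star ◁ E.inl ▷ _ ≫ _
        rw [← whiskerLeft_comp_assoc, ← comp_whiskerRight, E.summand_inl.isometry,
          ← whiskerLeft_comp_assoc T.dual.star (E.inl ▷ _), hl']
        simp
      · change T.dual.star ◁ E.inr ▷ _ ≫ _ = T.dual.star ◁ E.inr ▷ _ ≫ _
        rw [← whiskerLeft_comp_assoc, ← comp_whiskerRight, E.inr_inl,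
          ← whiskerLeft_comp_assoc T.dual.star (E.inr ▷ _), hr',
          E.apply_adjoint_eq_zero hdist h₀, zero_whiskerRight hsplit Y.selfDual,
          whiskerLeft_zero hdist, zero_comp]
    · change E.inrStar ▷ _ ≫ _ = E.inrStar ▷ _ ≫ _
      rw [← whisker_exchange_assoc, hrStar, reassoc_of% (E.starInr_inner Y.carrier),
        E.right.mul_apply hγ]
      refine E.sum.isBiproduct.whiskerLeft_whiskerRight_hom_ext hdist Y.selfDual ?_ ?_
      · change E.right.carrier ◁ E.inl ▷ _ ≫ _ = E.right.carrier ◁ E.inl ▷ _ ≫ _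
        rw [← whiskerLeft_comp_assoc, ← comp_whiskerRight, E.inl_inr,
          ← whiskerLeft_comp_assoc E.right.carrier (E.inl ▷ _), hl',
          E.whiskerLeft_apply_eq_zero hdist h₀, zero_whiskerRight hsplit Y.selfDual,
          whiskerLeft_zero hdist, zero_comp]
      · change E.right.carrier ◁ E.inr ▷ _ ≫ _ = E.right.carrier ◁ E.inr ▷ _ ≫ _
        rw [← whiskerLeft_comp_assoc, ← comp_whiskerRight, E.summand_inr.isometry,
          ← whiskerLeft_comp_assoc E.right.carrier (E.inr ▷ _), hr']
        simp

end EnvelopingData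

end NormalFrobenius3

/-! ### The inclusion of a 3-structure into its enveloping algebra -/

section

variable {D : Type u} [Category.{v} D] [MonoidalCategory D] {X Y W V : D}

theorem ext21_comp (f : X ⊗ Y ⟶ W) (h : W ⟶ V) (Z : D) :
    ext21 (f ≫ h) Z = ext21 f Z ≫ h ▷ Z := by
  simp [ext21]

theorem ext21_whiskerLeft_comp (h : Y ⟶ W) (f : X ⊗ W ⟶ V) (Z : D) :
    ext21 (X ◁ h ≫ f) Z = X ◁ h ▷ Z ≫ ext21 f Z := by
  simp [ext21]

theorem ext21_whiskerRight_comp (h : X ⟶ W) (f : W ⊗ Y ⟶ V) (Z : D) :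
    ext21 (h ▷ Y ≫ f) Z = h ▷ (Y ⊗ Z) ≫ ext21 f Z := by
  simp [ext21]

theorem ext21_injective {f g : X ⊗ Y ⟶ W} (h : ∀ Z, ext21 f Z = ext21 g Z) : f = g :=
  eq_of_whiskerRight_eq fun Z => by simpa [ext21] using h Z

end

theorem DaggerDual.adjoint_ext {D : Type u} [Category.{v} D] [MonoidalCategory D]
    [MonoidalDaggerCategory D] {X B : D} (a : DaggerDual X) (γ : X ⊗ B ⟶ B) (Z : D) :
    ext21 (a.adjoint γ) Z = a.star ◁ ext12 (dag γ) Z ≫ ext20 a.cap' (B ⊗ Z) := by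
  simp only [adjoint, ext21, ext12, ext20]
  monoidal

namespace NormalFrobenius3

namespace EnvelopingData

variable {D : Type u} [Category.{v} D] [MonoidalCategory D] [MonoidalDaggerCategory D]
  [HasZeroMorphisms D] {T : NormalFrobenius3 D} (E : T.EnvelopingData)

/-- The algebra of `R`-linear endomorphisms of `C`. -/
abbrev algebra : FrobeniusMonoid D := E.left.frobeniusMonoid

/-- The unit of `R`, as an element of `C*`. -/
def oneStar : 𝟙_ D ⟶ E.module.dual.star := E.right.one ≫ E.inrStar

theorem oneStar_ext (Z : D) : ext01 E.oneStar Z = ext01 E.right.one Z ≫ E.inrStar ▷ Z := by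
  simp [oneStar, ext01]

theorem oneStar_inner (Z : D) : ext01 E.oneStar (E.module.carrier ⊗ Z) ≫ ext21 E.module.inner Z =
    dag E.inr ▷ Z := by
  rw [oneStar_ext, Category.assoc, starInr_inner,
    ← reassoc_of% (ext01_natural (dag E.inr ▷ Z) E.right.one)]
  exact (congrArg _ (E.right.frobeniusMonoid.one_mul_ext Z)).trans (Category.comp_id _)

theorem oneStar_coactStar (Z : D) : ext01 E.oneStar Z ≫ ext12 E.module.coactStar Z =
    ext02 E.right.frobeniusMonoid.cup Z ≫ E.right.carrier ◁ E.inrStar ▷ Z := by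
  have h : E.inrStar ▷ Z ≫ ext12 E.module.coactStar Z =
      ext12 (dag E.right.mul) Z ≫ E.right.carrier ◁ E.inrStar ▷ Z := by
    have h := E.summand_inr.starIncl_coactStar Z
    rw [show E.right.frobeniusMonoid.selfDual.coactStar E.right.mul = dag E.right.mul from
      E.right.frobeniusMonoid.coactStar_mul] at h
    exact h
  rw [oneStar_ext, Category.assoc, h, FrobeniusMonoid.ext02_cup, Category.assoc]

theorem leftProjection_dag_inr (Z : D) :
    ext22 E.module.leftProjection Z ≫ dag E.inr ▷ (E.module.dual.star ⊗ Z) =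
      dag E.inr ▷ (E.module.dual.star ⊗ Z) ≫ E.right.carrier ◁ ext12 E.module.coactStar Z ≫
        ext21 E.right.mul (E.module.dual.star ⊗ Z) := by
  rw [E.module.leftProjection_ext, Category.assoc, E.summand_inr.act_proj_ext,
    whisker_exchange_assoc]

/-- The map `C ⟶ L` sending `c` to the endomorphism which takes `(a, r)` to `c r`. -/
def corner : E.module.carrier ⟶ E.left.carrier :=
  (ρ_ _).inv ≫ E.module.carrier ◁ E.oneStar ≫ dag E.left.incl

theorem corner_ext (Z : D) : E.corner ▷ Z =
    E.module.carrier ◁ ext01 E.oneStar Z ≫ ext21 (dag E.left.incl) Z := by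
  simp only [corner, ext01, ext21]
  monoidal

theorem corner_incl (Z : D) : E.corner ▷ Z ≫ ext12 E.left.incl Z =
    E.module.carrier ◁ ext01 E.oneStar Z ≫ ext22 E.module.leftProjection Z := by
  rw [corner_ext, Category.assoc, E.left.split_ext]

/-- The element `c` of the algebra sends `(a, r)` to `c r`. -/
theorem corner_apply (Z : D) : E.corner ▷ (E.module.carrier ⊗ Z) ≫ ext21 E.left.apply Z =
    E.module.carrier ◁ dag E.inr ▷ Z ≫ ext21 E.module.act Z := by
  rw [E.left.apply_ext, reassoc_of% (E.corner_incl (E.module.carrier ⊗ Z)),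
    E.module.leftProjection_act,
    reassoc_of% (whiskerLeft_of_comp E.module.carrier (E.oneStar_inner Z))]

theorem corner_isometry : E.corner ≫ dag E.corner = 𝟙 E.module.carrier := by
  refine eq_of_whiskerRight_eq fun Z => ?_
  have h : E.inrStar ▷ Z ≫ ext10 (dag E.oneStar) Z = ext10 (dag E.right.one) Z := by
    rw [oneStar, dag_comp, ext10, comp_whiskerRight, Category.assoc, ← comp_whiskerRight_assoc,
      E.summand_inr.star_isometry, id_whiskerRight, Category.id_comp, ext10]
  have h' : ext01 E.oneStar Z ≫ ext12 E.module.coactStar Z ≫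
      E.right.carrier ◁ ext10 (dag E.oneStar) Z = ext01 E.right.one Z := by
    rw [reassoc_of% (E.oneStar_coactStar Z), whiskerLeft_of_comp _ h, FrobeniusMonoid.ext02_cup,
      Category.assoc]
    exact (congrArg _ (E.right.frobeniusMonoid.comul_counit_right_ext Z)).trans
      (Category.comp_id _)
  have hd : (dag E.corner) ▷ Z =
      ext12 E.left.incl Z ≫ E.module.carrier ◁ ext10 (dag E.oneStar) Z := by
    rw [← dag_whiskerRight, corner_ext]
    simp [dag_ext21, dag_ext01]
  rw [comp_whiskerRight, hd, reassoc_of% (E.corner_incl Z), E.module.leftProjection_ext,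
    Category.assoc, ← ext21_natural, ← whiskerLeft_comp_assoc, ← whiskerLeft_comp_assoc,
    Category.assoc, h', id_whiskerRight]
  exact E.module.act_one_ext Z

theorem leftMul_corner_ext (Z : D) : ext21 (E.algebra.leftMul E.corner) Z =
    E.module.carrier ◁ (ext12 E.left.incl Z ≫ dag E.inr ▷ (E.module.dual.star ⊗ Z)) ≫
      ext21 E.module.act (E.module.dual.star ⊗ Z) ≫ ext21 (dag E.left.incl) Z := by
  rw [FrobeniusMonoid.leftMul, ext21_whiskerRight_comp, E.left.mul_ext, ← whisker_exchange_assoc,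
    reassoc_of% (E.corner_apply (E.module.dual.star ⊗ Z)), whiskerLeft_comp, Category.assoc]

theorem adjoint_corner_ext (Z : D) :
    ext21 (E.module.dual.adjoint (E.algebra.leftMul E.corner)) Z =
      E.module.dual.star ◁ ext12 E.left.incl Z ≫ ext21 E.module.inner (E.module.dual.star ⊗ Z) ≫
        E.inr ▷ (E.module.dual.star ⊗ Z) ≫ ext21 (dag E.left.incl) Z := by
  rw [E.module.dual.adjoint_ext, ← dag_ext21, leftMul_corner_ext]
  simp only [dag_comp, dag_whiskerLeft, dag_whiskerRight, dag_ext12, dag_ext21, dag_dag,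
    whiskerLeft_comp, Category.assoc, ext20_natural]
  rw [E.module.inner_ext, Category.assoc,
    reassoc_of% (ext20_natural (E.inr ▷ (E.module.dual.star ⊗ Z)) E.module.dual.cap')]

/-- In the algebra of endomorphisms, the product `c* c'` is the element `⟨c, c'⟩` of `R`. -/
theorem corner_adjoint : E.module.dual.star ◁ E.corner ≫
    E.module.dual.adjoint (E.algebra.leftMul E.corner) = E.module.inner ≫ E.inr ≫ E.corner := by
  refine ext21_injective fun Z => ?_
  rw [ext21_whiskerLeft_comp, adjoint_corner_ext, ext21_comp, comp_whiskerRight,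
    ← whiskerLeft_comp_assoc, corner_incl, E.module.leftProjection_ext, whiskerLeft_comp,
    whiskerLeft_comp, Category.assoc, Category.assoc, ← reassoc_of% (E.module.inner_mul _),
    ← reassoc_of% (E.summand_inr.incl_act (E.module.dual.star ⊗ Z)),
    reassoc_of% (ext21_natural (ext12 E.module.coactStar Z) E.module.inner),
    reassoc_of% (ext21_natural (ext01 E.oneStar Z) E.module.inner), whisker_exchange_assoc,
    whisker_exchange_assoc, ← reassoc_of% (E.module.leftProjection_ext Z),
    E.left.leftProjection_proj, ← corner_ext]

/-- In the algebra of endomorphisms, the product of `c : C` and `r : R` is the element `c r` of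
`C`. -/
theorem corner_act : E.module.carrier ◁ (E.inr ≫ E.corner) ≫ E.algebra.leftMul E.corner =
    E.module.act ≫ E.corner := by
  refine ext21_injective fun Z => ?_
  have h : E.inr ▷ Z ≫ E.corner ▷ Z ≫ ext12 E.left.incl Z ≫
      dag E.inr ▷ (E.module.dual.star ⊗ Z) = E.right.carrier ◁ ext01 E.oneStar Z ≫
        E.right.carrier ◁ ext12 E.module.coactStar Z ≫
          ext21 E.right.mul (E.module.dual.star ⊗ Z) := by
    rw [reassoc_of% (E.corner_incl Z), leftProjection_dag_inr, whisker_exchange_assoc,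
      ← comp_whiskerRight_assoc, E.summand_inr.isometry, id_whiskerRight, Category.id_comp]
  rw [ext21_whiskerLeft_comp, leftMul_corner_ext, ext21_comp, comp_whiskerRight,
    ← whiskerLeft_comp_assoc, Category.assoc, h, whiskerLeft_comp, whiskerLeft_comp,
    Category.assoc, Category.assoc, ← reassoc_of% (E.module.act_assoc_ext _),
    reassoc_of% (ext21_natural (ext12 E.module.coactStar Z) E.module.act),
    reassoc_of% (ext21_natural (ext01 E.oneStar Z) E.module.act),
    ← reassoc_of% (E.module.leftProjection_ext Z), E.left.leftProjection_proj, ← corner_ext]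

theorem conj_corner_ext (Z : D) : E.module.dual.conj E.algebra.selfDual E.corner ▷ Z =
    ext12 E.module.coactStar Z ≫ E.inr ▷ (E.module.dual.star ⊗ Z) ≫ ext21 (dag E.left.incl) Z := by
  have h := E.algebra.leftMul_one (E.module.dual.conj E.algebra.selfDual E.corner)
  rw [E.module.dual.leftMul_conj] at h
  calc _ = (ρ_ E.module.dual.star).inv ▷ Z ≫ ((ρ_ E.module.dual.star).hom ≫
          E.module.dual.conj E.algebra.selfDual E.corner) ▷ Z := by simp
    _ = E.module.dual.star ◁ ext01 E.algebra.one Z ≫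
          ext21 (E.module.dual.adjoint (E.algebra.leftMul E.corner)) Z := by
        rw [← h]; simp only [ext01, ext21]; monoidal
    _ = _ := by
        rw [adjoint_corner_ext, ← whiskerLeft_comp_assoc, E.left.one_incl,
          E.module.coactStar_ext, Category.assoc]

/-- The product `c c'*` is the projection of `c ⊗ c'*` to the algebra, so that the algebra is
spanned by such products. -/
theorem whiskerLeft_conj_corner :
    E.module.carrier ◁ E.module.dual.conj E.algebra.selfDual E.corner ≫
      E.algebra.leftMul E.corner = dag E.left.incl := by
  refine ext21_injective fun Z => ?_
  have h : E.inr ▷ (E.module.dual.star ⊗ Z) ≫ ext22 E.module.leftProjection Z ≫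
      dag E.inr ▷ (E.module.dual.star ⊗ Z) = E.right.carrier ◁ ext12 E.module.coactStar Z ≫
          ext21 E.right.mul (E.module.dual.star ⊗ Z) := by
    rw [leftProjection_dag_inr, ← comp_whiskerRight_assoc, E.summand_inr.isometry, id_whiskerRight,
      Category.id_comp]
  rw [ext21_whiskerLeft_comp, leftMul_corner_ext, conj_corner_ext, ← whiskerLeft_comp_assoc,
    Category.assoc, Category.assoc, reassoc_of% (E.left.split_ext Z), h,
    E.module.coactStar_coactStar, ← reassoc_of% (E.module.leftProjection_ext Z),
    E.left.leftProjection_proj]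

/-- The inclusion of `A` into its enveloping algebra. -/
def incl : T.carrier ⟶ E.left.carrier := E.inl ≫ E.corner

theorem incl_isometry : IsIsometry E.incl := by
  rw [IsIsometry, incl, dag_comp, Category.assoc, reassoc_of% E.corner_isometry]
  exact E.summand_inl.isometry

theorem whiskerLeft_incl_adjoint : T.dual.star ◁ E.incl ≫
    T.dual.adjoint (E.algebra.leftMul E.incl) = dag E.right.incl ≫ E.inr ≫ E.corner := by
  have h : E.inlStar ▷ E.module.carrier ≫ E.module.inner =
      T.dual.star ◁ dag E.inl ≫ dag E.right.incl :=
    ext21_injective fun Z => by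
      rw [ext21_whiskerRight_comp, ext21_whiskerLeft_comp, starInl_inner]
  rw [incl, ← E.algebra.whiskerRight_leftMul, ← E.summand_inl.starIncl_adjoint, whiskerLeft_comp,
    Category.assoc, whisker_exchange_assoc, corner_adjoint, reassoc_of% h,
    ← whiskerLeft_comp_assoc, E.summand_inl.isometry, whiskerLeft_id, Category.id_comp]

/-- The elements of the right algebra are the products `x* y` with `x` and `y` in `A`, so that its
inclusion is determined by that of `A`. -/
theorem inr_corner : E.inr ≫ E.corner = E.rightMap E.algebra E.incl := by
  have h : E.right.incl ≫ dag E.right.incl = 𝟙 _ := E.right.isometry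
  rw [rightMap, T.dual.leftMul_conj, whiskerLeft_incl_adjoint, reassoc_of% h]

theorem incl_mul : T.mul ≫ E.incl = T.carrier ◁ (T.dual.star ◁ E.incl ≫
    E.algebra.leftMul (T.dual.conj E.algebra.selfDual E.incl)) ≫ E.algebra.leftMul E.incl := by
  have h : T.carrier ◁ dag E.right.incl ≫ E.right.act = T.mul :=
    eq_of_whiskerRight_eq fun Z =>
      (cancel_epi (T.carrier ◁ (α_ _ _ _).inv ≫ (α_ _ _ _).inv)).1 <| by
        simpa [ext21, ext31] using E.right.whiskerLeft_proj_act Z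
  rw [T.dual.leftMul_conj, whiskerLeft_incl_adjoint, whiskerLeft_comp, Category.assoc]
  conv_rhs => arg 2; arg 2; rw [incl, ← E.algebra.whiskerRight_leftMul]
  rw [whisker_exchange_assoc, corner_act, reassoc_of% E.summand_inl.act_incl, reassoc_of% h, incl]

theorem incl_mul_incl [HasDaggerBiproducts D] (hdist : DistributiveDaggerBiproducts D) :
    T.carrier ◁ E.incl ≫ E.algebra.leftMul E.incl = 0 := by
  -- an element of `A` acts on `C = A ⊕ R` with values in the summand `A`
  have h : E.incl ▷ 𝟙_ D ≫ ext12 E.left.incl (𝟙_ D) ≫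
      dag E.inr ▷ (E.module.dual.star ⊗ 𝟙_ D) = 0 := by
    have h₀ : (0 : T.carrier ⟶ E.right.carrier) ▷ 𝟙_ D = 0 := by simp
    rw [incl, comp_whiskerRight, Category.assoc, reassoc_of% (E.corner_incl (𝟙_ D)),
      leftProjection_dag_inr, whisker_exchange_assoc, ← comp_whiskerRight_assoc, E.inl_inr, h₀,
      zero_comp]
  have h' : ext21 (E.module.carrier ◁ E.incl ≫ E.algebra.leftMul E.corner) (𝟙_ D) = 0 := by
    rw [ext21_whiskerLeft_comp, leftMul_corner_ext, ← whiskerLeft_comp_assoc, h,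
      whiskerLeft_zero hdist, zero_comp]
  have h'' : E.module.carrier ◁ E.incl ≫ E.algebra.leftMul E.corner = 0 := by
    have h₁ : (E.module.carrier ◁ E.incl ≫ E.algebra.leftMul E.corner) ▷ 𝟙_ D = 0 := by
      rw [← cancel_epi (α_ _ _ _).inv, comp_zero]; exact h'
    calc _ = (ρ_ _).inv ≫ (E.module.carrier ◁ E.incl ≫ E.algebra.leftMul E.corner) ▷ 𝟙_ D ≫
          (ρ_ _).hom := by simp
      _ = 0 := by rw [h₁, zero_comp, comp_zero]
  conv_lhs => arg 2; rw [incl, ← E.algebra.whiskerRight_leftMul]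
  rw [whisker_exchange_assoc, h'', comp_zero]

end EnvelopingData

end NormalFrobenius3

/-! ### 2-structures and dagger Frobenius monoids -/

section

variable {D : Type u} [Category.{v} D] [MonoidalCategory D] [MonoidalDaggerCategory D]

namespace Frobenius2

variable (Y : Frobenius2 D)

/-- The underlying dagger Frobenius monoid of a 2-structure, forgetting the chosen dual. -/
@[reducible] def frobeniusMonoid : FrobeniusMonoid D where
  carrier := Y.carrier
  mul := Y.mul
  one := Y.one
  one_mul := Y.one_mul
  mul_one := Y.mul_one
  mul_assoc := Y.mul_assoc
  frobenius := Y.frobenius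

/-- The involution compares the chosen dual of `Y` with `Y` as its own dual. -/
theorem conj_id_selfDual :
    Y.frobeniusMonoid.selfDual.conj Y.dual (𝟙 Y.carrier) = Y.involution := by
  simp [DaggerDual.conj, DaggerDual.transpose, involution, involutionRight, DaggerDual.dag_cap,
    FrobeniusMonoid.selfDual_cup, FrobeniusMonoid.dag_cup, FrobeniusMonoid.cap]

theorem conj_eq {X : D} (a : DaggerDual X) (g : X ⟶ Y.carrier) :
    a.conj Y.dual g = a.conj Y.frobeniusMonoid.selfDual g ≫ Y.involution := by
  rw [← Y.conj_id_selfDual, ← DaggerDual.conj_comp, Category.comp_id]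

theorem conj_comp_dag_involution {X : D} (a : DaggerDual X) (g : X ⟶ Y.carrier) :
    a.conj Y.dual g ≫ dag Y.involution = a.conj Y.frobeniusMonoid.selfDual g := by
  rw [conj_eq, Category.assoc, Y.involution_unitary.1, Category.comp_id]

/-- The triple product of elements of `g` in a 2-structure, in terms of left multiplications. -/
theorem tensor_ternaryMul {X : D} (a : DaggerDual X) (g : X ⟶ Y.carrier) :
    (g ⊗ₘ (a.conj Y.dual g ⊗ₘ g)) ≫ Y.ternaryMul =
      X ◁ (a.star ◁ g ≫ Y.frobeniusMonoid.leftMul (a.conj Y.frobeniusMonoid.selfDual g)) ≫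
        Y.frobeniusMonoid.leftMul g := by
  rw [← conj_comp_dag_involution]
  rw [ternaryMul, Y.mul_assoc, Iso.inv_hom_id_assoc, MonoidalCategory.tensorHom_def' g,
    MonoidalCategory.tensorHom_def' _ g]
  simp only [FrobeniusMonoid.leftMul, whiskerLeft_comp, comp_whiskerRight, Category.assoc]
  rw [← whisker_exchange_assoc, ← whisker_exchange_assoc]

/-- A map which preserves triple products represents `A` by left multiplications. -/
theorem isRepresentation {T : NormalFrobenius3 D} {g : T.carrier ⟶ Y.carrier}
    (h : PreservesTernary T.dual Y.dual T.mul Y.ternaryMul g) :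
    T.IsRepresentation (Y.frobeniusMonoid.leftMul g) := by
  rw [PreservesTernary, tensor_ternaryMul] at h
  have h' := congrArg Y.frobeniusMonoid.leftMul h
  rw [← FrobeniusMonoid.whiskerRight_leftMul, FrobeniusMonoid.leftMul_leftMul,
    FrobeniusMonoid.leftMul_leftMul] at h'
  rw [NormalFrobenius3.IsRepresentation, ← DaggerDual.leftMul_conj, ext31, Category.assoc,
    Category.assoc, h']
  simp

end Frobenius2

/-- A dagger Frobenius monoid as a 2-structure, with itself as the chosen dual. -/
@[reducible] def FrobeniusMonoid.frobenius2 (R : FrobeniusMonoid D) : Frobenius2 D where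
  carrier := R.carrier
  dual := R.selfDual
  mul := R.mul
  one := R.one
  one_mul := R.one_mul
  mul_one := R.mul_one
  mul_assoc := R.mul_assoc
  frobenius := R.frobenius
  symmetric := by
    have h₁ := R.selfDual.pairing.coevaluation_evaluation'
    have h₂ := R.selfDual.pairing.evaluation_coevaluation'
    change R.carrier ◁ R.cup ≫ (α_ _ _ _).inv ≫ R.cap ▷ R.carrier = _ at h₁
    change R.cup ▷ R.carrier ≫ (α_ _ _ _).hom ≫ R.carrier ◁ R.cap = _ at h₂
    rw [involutionRight, involutionLeft, selfDual_cup', selfDual_cup, ← cap, reassoc_of% h₁,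
      reassoc_of% h₂]
    simp

theorem FrobeniusMonoid.frobenius2_involution (R : FrobeniusMonoid D) :
    R.frobenius2.involution = 𝟙 R.carrier := by
  rw [← Frobenius2.conj_id_selfDual]
  exact DaggerDual.conj_id _

variable {R : FrobeniusMonoid D} {Y : Frobenius2 D}

/-- A morphism into a 2-structure which preserves multiplication and conjugation. -/
def FrobeniusMonoid.homMk (F : R.carrier ⟶ Y.carrier)
    (hmul : R.mul ≫ F = R.carrier ◁ F ≫ Y.frobeniusMonoid.leftMul F)
    (hconj : R.selfDual.conj Y.frobeniusMonoid.selfDual F = F) : R.frobenius2 ⟶ Y where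
  hom := F
  map_mul := by
    rw [MonoidalCategory.tensorHom_def', Category.assoc]
    exact hmul
  map_involution := by
    rw [R.frobenius2_involution, Category.id_comp]
    exact ((Y.conj_eq _ F).trans (by rw [hconj])).symm

theorem FrobeniusMonoid.hom_conj (F : R.frobenius2 ⟶ Y) :
    R.selfDual.conj Y.frobeniusMonoid.selfDual F.hom = F.hom := by
  have h := F.map_involution
  rw [R.frobenius2_involution, Category.id_comp] at h
  rw [← Y.conj_comp_dag_involution]
  exact (congrArg (· ≫ dag Y.involution) h.symm).trans
    (by rw [Category.assoc, Y.involution_unitary.1, Category.comp_id])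

theorem FrobeniusMonoid.leftMul_hom (F : R.frobenius2 ⟶ Y) {X : D} (g : X ⟶ R.carrier) :
    R.leftMul g ≫ F.hom = X ◁ F.hom ≫ Y.frobeniusMonoid.leftMul (g ≫ F.hom) := by
  have h : R.mul ≫ F.hom = (F.hom ⊗ₘ F.hom) ≫ Y.mul := F.map_mul
  rw [leftMul, leftMul, Category.assoc, h, MonoidalCategory.tensorHom_def', Category.assoc,
    ← whisker_exchange_assoc, comp_whiskerRight, Category.assoc]

end

/-! ### The universal property of the enveloping algebra -/

namespace NormalFrobenius3.EnvelopingData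

variable {D : Type u} [Category.{v} D] [MonoidalCategory D] [MonoidalDaggerCategory D]
  [HasZeroMorphisms D] {T : NormalFrobenius3 D} (E : T.EnvelopingData) {Y : Frobenius2 D}

theorem rightMap_hom (F : E.algebra.frobenius2 ⟶ Y) (g : T.carrier ⟶ E.left.carrier) :
    E.rightMap E.algebra g ≫ F.hom = E.rightMap Y.frobeniusMonoid (g ≫ F.hom) := by
  rw [rightMap, rightMap, Category.assoc, Category.assoc, FrobeniusMonoid.leftMul_hom,
    ← whiskerLeft_comp_assoc]
  conv_rhs => rw [T.dual.conj_comp E.algebra.selfDual, FrobeniusMonoid.hom_conj]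

/-- A morphism out of the enveloping algebra is determined by its restriction to `C`. -/
theorem eq_of_corner (F : E.algebra.frobenius2 ⟶ Y) : F.hom = E.left.incl ≫
    E.module.carrier ◁ E.module.dual.conj Y.frobeniusMonoid.selfDual (E.corner ≫ F.hom) ≫
      Y.frobeniusMonoid.leftMul (E.corner ≫ F.hom) := by
  have h : E.left.incl ≫ dag E.left.incl = 𝟙 _ := E.left.isometry
  rw [E.module.dual.conj_comp E.algebra.selfDual, FrobeniusMonoid.hom_conj, whiskerLeft_comp,
    Category.assoc, ← FrobeniusMonoid.leftMul_hom, reassoc_of% E.whiskerLeft_conj_corner,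
    reassoc_of% h]

/-- A morphism out of the enveloping algebra is determined by its restriction to `A`. -/
theorem hom_ext {F G : E.algebra.frobenius2 ⟶ Y} (h : E.incl ≫ F.hom = E.incl ≫ G.hom) :
    F = G := by
  have hr : E.inr ≫ E.corner ≫ F.hom = E.inr ≫ E.corner ≫ G.hom := by
    rw [reassoc_of% E.inr_corner, reassoc_of% E.inr_corner, rightMap_hom, rightMap_hom, h]
  have hc : E.corner ≫ F.hom = E.corner ≫ G.hom :=
    E.sum.isBiproduct.hom_ext' (by simpa [incl] using h) hr
  refine Frobenius2.Hom.ext ?_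
  rw [E.eq_of_corner F, E.eq_of_corner G, hc]

variable [HasDaggerBiproducts D] (hdist : DistributiveDaggerBiproducts D)

/-- The enveloping 2-structure of a 3-structure. -/
@[reducible] def binSub : BinSub D where
  tern := T
  two := E.algebra.frobenius2
  incl := E.incl
  isometry := E.incl_isometry
  preserves := by
    exact E.incl_mul.trans (E.algebra.frobenius2.tensor_ternaryMul T.dual E.incl).symm
  mul_zero := by
    rw [MonoidalCategory.tensorHom_def', Category.assoc]
    exact E.incl_mul_incl hdist

variable (hsplit : HasDaggerSplittings D)
include hdist hsplit

/-- A triple product preserving map of square zero extends to the enveloping algebra.  Since `Y`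
acts faithfully on itself by left multiplication, it suffices to represent the algebra by left
multiplications. -/
theorem exists_hom (g : T.carrier ⟶ Y.carrier)
    (hg : PreservesTernary T.dual Y.dual T.mul Y.ternaryMul g) (h₀ : (g ⊗ₘ g) ≫ Y.mul = 0) :
    ∃ F : E.algebra.frobenius2 ⟶ Y, E.incl ≫ F.hom = g := by
  have hγ := Y.isRepresentation hg
  have h₀' : T.carrier ◁ Y.frobeniusMonoid.leftMul g ≫ Y.frobeniusMonoid.leftMul g = 0 := by
    have h : T.carrier ◁ g ≫ Y.frobeniusMonoid.leftMul g = 0 := by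
      rw [FrobeniusMonoid.leftMul, ← h₀, MonoidalCategory.tensorHom_def', Category.assoc]
    rw [← cancel_epi (α_ _ _ _).hom, ← FrobeniusMonoid.leftMul_leftMul, h,
      FrobeniusMonoid.leftMul, zero_whiskerRight hsplit Y.frobeniusMonoid.selfDual, zero_comp,
      comp_zero]
  obtain ⟨k, hl, hr, hk⟩ := E.exists_representation hdist hsplit hγ h₀'
  have hF : Y.frobeniusMonoid.leftMul (E.left.incl ≫
      E.module.carrier ◁ E.module.dual.conj Y.frobeniusMonoid.selfDual k ≫
        Y.frobeniusMonoid.leftMul k) = E.left.represent (Y.frobeniusMonoid.leftMul k) := by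
    rw [← FrobeniusMonoid.ext12_leftMul, DaggerDual.leftMul_conj]; rfl
  generalize E.left.incl ≫ E.module.carrier ◁ E.module.dual.conj Y.frobeniusMonoid.selfDual k ≫
    Y.frobeniusMonoid.leftMul k = F at hF
  refine ⟨FrobeniusMonoid.homMk F ?_ ?_, ?_⟩
  · refine Y.frobeniusMonoid.leftMul_injective ?_
    rw [FrobeniusMonoid.leftMul_leftMul, ← FrobeniusMonoid.whiskerRight_leftMul, hF,
      ← cancel_epi (α_ _ _ _).inv, Iso.inv_hom_id_assoc]
    have h := E.left.mul_represent hk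
    rw [ext21, Category.assoc] at h
    exact h
  · refine Y.frobeniusMonoid.leftMul_injective ?_
    rw [DaggerDual.leftMul_conj, hF]
    exact E.left.adjoint_represent hk
  · refine Y.frobeniusMonoid.leftMul_injective ?_
    have hrStar : E.inrStar ▷ Y.carrier ≫
        E.module.dual.adjoint (Y.frobeniusMonoid.leftMul k) =
          E.right.apply (Y.frobeniusMonoid.leftMul g) := by
      rw [E.summand_inr.starIncl_adjoint, Y.frobeniusMonoid.whiskerRight_leftMul, hr,
        leftMul_rightMap, E.right.adjoint_apply hγ]
    have hone : ext01 E.oneStar Y.carrier ≫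
        E.module.dual.adjoint (Y.frobeniusMonoid.leftMul k) =
          dag (T.dual.adjoint (Y.frobeniusMonoid.leftMul g)) ≫
            T.dual.adjoint (Y.frobeniusMonoid.leftMul g) := by
      rw [oneStar_ext, Category.assoc, hrStar, RightAlgebra.one_apply]
    change Y.frobeniusMonoid.leftMul (E.incl ≫ F) = _
    rw [incl, Category.assoc, ← FrobeniusMonoid.whiskerRight_leftMul,
      ← FrobeniusMonoid.whiskerRight_leftMul, hF, E.corner_ext, Category.assoc,
      E.left.proj_represent hk, ← whiskerLeft_comp_assoc, hone, ← whisker_exchange_assoc,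
      FrobeniusMonoid.whiskerRight_leftMul, hl, hγ.whiskerLeft_dag_adjoint_adjoint]

/-- Morphisms out of the enveloping 2-structure are determined by their restrictions, and every
morphism of 3-structures is a restriction. -/
theorem restrict_bijective (Y : BinSub D) :
    Function.Bijective fun f : E.binSub hdist ⟶ Y => (BinSub.restrict f : T ⟶ Y.tern) := by
  constructor
  · intro f f' h
    have h' : E.incl ≫ f.two.hom ≫ dag Y.incl = E.incl ≫ f'.two.hom ≫ dag Y.incl :=
      congrArg Frobenius3.Hom.hom h
    refine BinSub.Hom.ext (E.hom_ext ?_)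
    have hf : E.incl ≫ f.two.hom = E.incl ≫ f.two.hom ≫ dag Y.incl ≫ Y.incl := f.restricts
    have hf' : E.incl ≫ f'.two.hom = E.incl ≫ f'.two.hom ≫ dag Y.incl ≫ Y.incl := f'.restricts
    rw [hf, hf', reassoc_of% h']
  · intro φ
    have hY : Y.incl ≫ dag Y.incl = 𝟙 _ := Y.isometry
    obtain ⟨F, hF⟩ := E.exists_hom hdist hsplit (φ.hom ≫ Y.incl) (φ.preserves.comp Y.preserves)
      (by rw [← tensorHom_comp_tensorHom, Category.assoc, Y.mul_zero, comp_zero])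
    refine ⟨⟨F, ?_⟩, Frobenius3.Hom.ext ?_⟩
    · change E.incl ≫ F.hom = E.incl ≫ F.hom ≫ dag Y.incl ≫ Y.incl
      rw [reassoc_of% hF, reassoc_of% hY, hF]
    · change E.incl ≫ F.hom ≫ dag Y.incl = φ.hom
      rw [reassoc_of% hF, hY, Category.comp_id]

end NormalFrobenius3.EnvelopingData

/-! ### Specialness for idempotent addition -/

section

variable {D : Type u} [Category.{v} D] [MonoidalCategory D] [MonoidalDaggerCategory D]
  [HasZeroMorphisms D]

/-- If addition is idempotent, a composite through a biproduct whose two components agree is equal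
to each of them. -/
theorem AdditionIdempotent.comp_eq [HasDaggerBiproducts D] (hadd : AdditionIdempotent D)
    {P Q X Y : D} {t : BinaryBicone P Q} (ht : IsDaggerBiproduct t) {n : X ⟶ t.pt}
    {h : t.pt ⟶ Y} {f : X ⟶ Y}
    (h₁ : n ≫ t.fst ≫ t.inl ≫ h = f) (h₂ : n ≫ t.snd ≫ t.inr ≫ h = f) : n ≫ h = f := by
  let _ : HasBinaryBiproducts D := hasBinaryBiproducts D
  have hf : biprod.lift f f ≫ biprod.desc (𝟙 Y) (𝟙 Y) = f :=
    (SemiadditiveOfBinaryBiproducts.add_eq_left_addition f f).symm.trans (hadd X Y f)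
  have hh : biprod.lift (t.fst ≫ t.inl ≫ h) (t.snd ≫ t.inr ≫ h) ≫
      biprod.desc (𝟙 Y) (𝟙 Y) = h := by
    refine ht.hom_ext' ?_ ?_
    · have : t.inl ≫ biprod.lift (t.fst ≫ t.inl ≫ h) (t.snd ≫ t.inr ≫ h) =
          (t.inl ≫ h) ≫ biprod.inl := by ext <;> simp
      rw [reassoc_of% this]; simp
    · have : t.inr ≫ biprod.lift (t.fst ≫ t.inl ≫ h) (t.snd ≫ t.inr ≫ h) =
          (t.inr ≫ h) ≫ biprod.inr := by ext <;> simp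
      rw [reassoc_of% this]; simp
  have hn : n ≫ biprod.lift (t.fst ≫ t.inl ≫ h) (t.snd ≫ t.inr ≫ h) = biprod.lift f f := by
    ext <;> simp [h₁, h₂]
  rw [← hh, reassoc_of% hn, hf]

namespace NormalFrobenius3.EnvelopingData

variable {T : NormalFrobenius3 D} (E : T.EnvelopingData)

/-- The summand `A` contributes the unit of `R` to `∑ ⟨c, c⟩`. -/
theorem cup_inl_inner (Z : D) : ext02 E.module.dual.cup Z ≫ E.module.dual.star ◁ dag E.inl ▷ Z ≫
    E.module.dual.star ◁ E.inl ▷ Z ≫ ext21 E.module.inner Z = ext01 E.right.one Z := by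
  rw [reassoc_of% (E.summand_inl.cup_proj Z), ← whisker_exchange_assoc, starInl_inner,
    ← whiskerLeft_comp_assoc, ← comp_whiskerRight, E.summand_inl.isometry, E.right.one_ext]
  simp

/-- The summand `R` contributes the unit of `R` to `∑ ⟨c, c⟩`. -/
theorem cup_inr_inner (Z : D) : ext02 E.module.dual.cup Z ≫ E.module.dual.star ◁ dag E.inr ▷ Z ≫
    E.module.dual.star ◁ E.inr ▷ Z ≫ ext21 E.module.inner Z = ext01 E.right.one Z := by
  have h : ext02 E.right.frobeniusMonoid.cup Z ≫ ext21 E.right.mul Z = ext01 E.right.one Z := by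
    rw [FrobeniusMonoid.ext02_cup, Category.assoc]
    simp [ext12, ext21, ← comp_whiskerRight, E.right.comul_mul]
  rw [reassoc_of% (E.summand_inr.cup_proj Z), ← whisker_exchange_assoc, starInr_inner,
    ← whiskerLeft_comp_assoc, ← comp_whiskerRight, E.summand_inr.isometry, ← h,
    FrobeniusMonoid.selfDual_cup]
  simp

/-- The composite `m m†` is multiplication by `∑ ⟨c, c⟩`, a sum of one unit of `R` for each of the
two summands of `C`. -/
theorem isSpecial [HasDaggerBiproducts D] (hdist : DistributiveDaggerBiproducts D)
    (hadd : AdditionIdempotent D) :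
    (E.binSub hdist).two.IsSpecial := by
  refine E.left.comul_mul fun Z => ?_
  obtain ⟨t, ht, u, hl, hr, -, hu⟩ := E.sum.isBiproduct.exists_distributor hdist E.module.dual.star
  have hl : t.inl ≫ u = E.module.dual.star ◁ E.inl := hl
  have hr : t.inr ≫ u = E.module.dual.star ◁ E.inr := hr
  have hl' : dag u ≫ dag t.inl = E.module.dual.star ◁ dag E.inl := by rw [← dag_comp, hl]; simp
  have hr' : dag u ≫ dag t.inr = E.module.dual.star ◁ dag E.inr := by rw [← dag_comp, hr]; simp
  have h : (E.module.dual.cup ≫ dag u) ≫ u ≫ E.module.inner = E.right.one := by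
    refine hadd.comp_eq ht ?_ ?_
    · rw [ht.fst_eq, reassoc_of% hl, Category.assoc, reassoc_of% hl']
      refine eq_of_whiskerRight_eq fun Z => (cancel_epi (λ_ Z).inv).1 ?_
      simpa [ext01, ext02, ext21] using E.cup_inl_inner Z
    · rw [ht.snd_eq, reassoc_of% hr, Category.assoc, reassoc_of% hr']
      refine eq_of_whiskerRight_eq fun Z => (cancel_epi (λ_ Z).inv).1 ?_
      simpa [ext01, ext02, ext21] using E.cup_inr_inner Z
  rw [Category.assoc, reassoc_of% hu] at h
  calc _ = ext01 (E.module.dual.cup ≫ E.module.inner) Z := by simp [ext01, ext02, ext21]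
    _ = _ := by rw [h]

end NormalFrobenius3.EnvelopingData

end

end Enveloping

theorem mainTheorem8 {D : Type u} [Category.{v} D] [MonoidalCategory D]
    [Enveloping.MonoidalDaggerCategory D] [HasZeroMorphisms D]
    [Enveloping.HasDaggerBiproducts D]
    (hdist : Enveloping.DistributiveDaggerBiproducts D)
    (hsplit : Enveloping.HasDaggerSplittings D) :
    ∃ (E : Enveloping.NormalFrobenius3 D ⥤ Enveloping.BinSub D)
      (adj : E ⊣ Enveloping.subFunctor D)
      (hE : E ⋙ Enveloping.subFunctor D = 𝟭 (Enveloping.NormalFrobenius3 D)),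
      adj.unit = eqToHom hE.symm ∧
      (Enveloping.AdditionIdempotent D →
        ∀ T : Enveloping.NormalFrobenius3 D, (E.obj T).two.IsSpecial) := by
  have data : ∀ T : Enveloping.NormalFrobenius3 D, T.EnvelopingData := fun T =>
    Classical.choice (T.exists_envelopingData hdist hsplit)
  let e : ∀ (T : Enveloping.NormalFrobenius3 D) (Y : Enveloping.BinSub D),
      ((data T).binSub hdist ⟶ Y) ≃ (T ⟶ (Enveloping.subFunctor D).obj Y) := fun T Y =>
    Equiv.ofBijective (fun f => (Enveloping.subFunctor D).map f)
      ((data T).restrict_bijective hdist hsplit Y)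
  have he : ∀ T Y Y' g h, e T Y' (h ≫ g) = e T Y h ≫ (Enveloping.subFunctor D).map g :=
    fun T Y Y' g h => (Enveloping.subFunctor D).map_comp h g
  -- the 3-structure of `E T` is `T` by definition, so that the unit at `T` is an endomorphism
  have hid : ∀ T, e T _ (𝟙 _) = 𝟙 T := fun T => (Enveloping.subFunctor D).map_id _
  have hE : Adjunction.leftAdjointOfEquiv e he ⋙ Enveloping.subFunctor D = 𝟭 _ := by
    refine CategoryTheory.Functor.hext (fun T => rfl) fun T T' f => heq_of_eq ?_
    exact ((e T _).apply_symm_apply _).trans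
      ((congrArg (fun t => f ≫ t) (hid T')).trans (Category.comp_id f))
  refine ⟨Adjunction.leftAdjointOfEquiv e he, Adjunction.adjunctionOfEquivLeft e he, hE, ?_,
    fun hadd T => (data T).isSpecial hdist hadd⟩
  ext T
  rw [eqToHom_app]
  exact hid T
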